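/- **Setting.** Let $\mathbf z\sim P$ be a random variable on a space $\mathcal Z$, let $\Phi:\mathcal Z\to\bar{\mathcal Z}\subset\mathbb R^{d_l}$ be continuous with $\Phi(\mathbf z)$ supported on a bounded set, and let $\bar k_z$ be a bounded measurable reproducing kernel on $\bar{\mathcal Z}$ such that the eigenvalues (in decreasing order) of the integral operator of $\bar k_z$ with respect to the law of $\Phi(\mathbf z)$ satisfy $\lambda_i\lesssim i^{-(\bar b+1)}$ for some $\bar b>0$. Let $k_z(z,z')=\bar k_z(\Phi(z),\Phi(z'))$ and let $\mathcal I$ be its RKHS; for an $L_2(P)$ class $h$, $\|h\|_{\mathcal I}$ is the smallest $\mathcal I$-norm of a representative of $h$. Let $(\lambda_i,\psi_i)_i$ be an orthonormal system of eigenpairs with positive eigenvalues, in decreasing order, of the integral operator $f\mapsto\int k_z(\cdot,z')f(z')P(dz')$ on $L_2(P)$, and let $\mathrm{Proj}_r$ be the $L_2(P)$-orthogonal projection onto the span of the first $r$ of the $\psi_i$ (all of them if there are fewer than $r$). $\|\cdot\|_2$ is the $L_2(P)$ norm. Assume that (jointly measurable) draws $g\sim\mathcal{GP}(0,k_z)$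 have finite $L_\infty(P)$ norm almost surely. **Regression oracle.** Consider observations $(\mathbf z,g(\mathbf z)+\mathbf e)$ of a draw $g$, where the law of the noise $\mathbf e$ may depend on $\mathbf z$, on $g$ and on further randomness drawn together with $g$; given all that is drawn with $g$, $\mathbf z\sim P$ and $\mathbb E(\mathbf e\mid\mathbf z)=0$; and $g(\mathbf z)+\mathbf e$ is $1$-subgaussian, i.e. $\mathbb E e^{t(g(\mathbf z)+\mathbf e)}\le e^{t^2/2}$ for all $t\in\mathbb R$ (expectation also over $g$). A regression algorithm returns, from a data set $\mathcal D^{(n)}$ of $n$ observations of the same draw $g$, i.i.d. given all that is drawn with $g$, an estimator $\hat g_{u,n}$ (jointly measurable in the data and the evaluation point) with $$\mathbb E_{g}\,\mathbb E_{\mathcal D^{(n)}}\|\hat g_{u,n}-g\|_2^2\le\xi_n^2\quad(n\ge1),\qquad \xi_n\ge 0,\ \xi_n\to0.$$ **Learned RKHS.** Let $m=m(n_1)\to\infty$ as $n_1\to\infty$. Let $g^{(1)},\dots,g^{(m)}$ be i.i.d. draws from $\mathcal{GP}(0,k_z)$ (together with the further randomness above), and let $\mathcal D^{(n_1)}=\{(\tilde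 z_i,g^{(j)}(\tilde z_i)+\epsilon_i^{(j)}):i\le n_1,j\le m\}$ be a data set with shared instruments $\tilde z_i$ such that for each $j$ the draw $g^{(j)}$ and its observations are distributed as above. Let $\hat g_u^{(j)}$ be the output of the algorithm on the observations of $g^{(j)}$. Fix any constant $C_k>0$ and let $\hat g^{(j)}=\min\{C_k\log n_1,\hat g_u^{(j)}\}$ for all $j$ (the same holds with the two-sided truncation $\hat g^{(j)}=\max\{-C_k\log n_1,\min\{C_k\log n_1,\hat g_u^{(j)}\}\}$). Let $$\tilde{\mathcal I}=\Big\{\sum_{j=1}^m\theta_j\hat g^{(j)}:\theta\in\mathbb R^m\Big\},\qquad \|h\|_{\tilde{\mathcal I}}=\min\Big\{\sqrt m\,\|\theta\|_2: h=\sum_{j=1}^m\theta_j\hat g^{(j)}\Big\}.$$ **Theorem.** There is a universal constant $c_r>0$ such that in every such setting there are events $E_{n_1}$, determined by $g^{(1)},\dots,g^{(m)}$ and $\mathcal D^{(n_1)}$, with $\mathbb P(E_{n_1})\to1$ as $n_1\to\infty$, such that on $E_{n_1}$, for every $g^*\in L_2(P)$ there exists $\tilde g^*\in\tilde{\mathcal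 I}$ with $$\|\tilde g^*\|_{\tilde{\mathcal I}}\le c_r\|\mathrm{Proj}_{m'}g^*\|_{\mathcal I},$$ $$\|\tilde g^*-g^*\|_2\le c_r\|\mathrm{Proj}_{m'}g^*\|_{\mathcal I}\big(\xi_{n_1}+m^{-(\bar b+1)/2}\big)\sqrt{\log n_1}+\|g^*-\mathrm{Proj}_{m'}g^*\|_2,$$ where $m'=\lfloor m/2\rfloor$. -/

import Mathlib

open MeasureTheory ProbabilityTheory Filter Topology
open scoped ENNReal NNReal

noncomputable section

namespace KernelLearning

/-- `(lam i, psi i)`, over those `i` with `0 < lam i`, is a complete system of eigenpairs for the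
positive eigenvalues of the integral operator `f ↦ ∫ k(·, z') f(z') P(dz')` on `L²(P)`: the
eigenvalues are listed in decreasing order and with multiplicity, the eigenfunctions are
orthonormal, and the operator vanishes on their orthogonal complement. If there are only finitely
many positive eigenvalues, the remaining `lam i` are `0` and the remaining `psi i` are irrelevant. -/
structure IsMercerSystem {Z : Type*} [MeasurableSpace Z] (k : Z → Z → ℝ) (P : Measure Z)
    (lam : ℕ → ℝ) (psi : ℕ → Lp ℝ 2 P) : Prop where
  nonneg : ∀ i, 0 ≤ lam i
  antitone : Antitone lam
  orthonormal : Orthonormal ℝ (fun i : {i : ℕ // 0 < lam i} => psi i)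
  eigen : ∀ i, 0 < lam i →
    (fun z => ∫ z', k z z' * psi i z' ∂P) =ᵐ[P] fun z => lam i * psi i z
  complete : ∀ f : Lp ℝ 2 P, (∀ i, 0 < lam i → inner ℝ (psi i) f = 0) →
    (fun z => ∫ z', k z z' * f z' ∂P) =ᵐ[P] 0

open Classical in
/-- Orthogonal projection in `L²(P)` onto the span of the top `r` Mercer eigenfunctions. -/
def mercerProj {Z : Type*} [MeasurableSpace Z] {P : Measure Z} (lam : ℕ → ℝ)
    (psi : ℕ → Lp ℝ 2 P) (r : ℕ) (f : Lp ℝ 2 P) : Lp ℝ 2 P :=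
  ∑ i ∈ (Finset.range r).filter (fun i => 0 < lam i), (inner ℝ (psi i) f) • psi i

/-- The norm of an `L²(P)` class in the reproducing kernel Hilbert space `H`: the smallest norm of
an element of `H` that represents the class. -/
def rkhsNorm {Z : Type*} [MeasurableSpace Z] (P : Measure Z) (H : Type*) [NormedAddCommGroup H]
    [InnerProductSpace ℝ H] [RKHS ℝ H Z ℝ] (h : Lp ℝ 2 P) : ℝ :=
  sInf {r : ℝ | ∃ f : H, (⇑f : Z → ℝ) =ᵐ[P] h ∧ r = ‖f‖}

/-- The input-space kernel induced by a feature map and a latent-space kernel. -/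
def inducedKernel {Z Zbar : Type*} (Phi : Z → Zbar) (kbar : Zbar → Zbar → ℝ) : Z → Z → ℝ :=
  fun z z' => kbar (Phi z) (Phi z')

/-- Feature map into a latent space contained in `ℝ^d` and a bounded latent kernel with
polynomial eigendecay. -/
structure IsLatentKernel {Z : Type*} [TopologicalSpace Z] [MeasurableSpace Z] (P : Measure Z)
    {d : ℕ} {Zbar : Set (EuclideanSpace ℝ (Fin d))} (Phi : Z → Zbar) (kbar : Zbar → Zbar → ℝ)
    (b : ℝ) : Prop where
  continuous_phi : Continuous Phi
  bounded_latent : ∃ S : Set (EuclideanSpace ℝ (Fin d)), Bornology.IsBounded S ∧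
    ∀ᵐ z ∂P, (Phi z : EuclideanSpace ℝ (Fin d)) ∈ S
  posSemidef : (Matrix.of kbar).PosSemidef
  measurable_kernel : Measurable (Function.uncurry kbar)
  bounded_kernel : ∃ B : ℝ, ∀ x y, |kbar x y| ≤ B
  b_pos : 0 < b
  eigendecay : ∃ (lam : ℕ → ℝ) (psi : ℕ → Lp ℝ 2 (P.map Phi)) (C : ℝ),
    IsMercerSystem kbar (P.map Phi) lam psi ∧ ∀ i : ℕ, lam i ≤ C * ((i : ℝ) + 1) ^ (-(b + 1))

/-- `g` is a (jointly measurable) centred Gaussian process with covariance `k`, defined on the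
probability space `(U, ν)`, whose draws have finite `L_∞(P)` norm almost surely. -/
structure IsBoundedGPPrior {Z U : Type*} [MeasurableSpace Z] [MeasurableSpace U]
    (k : Z → Z → ℝ) (P : Measure Z) (ν : Measure U) (g : U → Z → ℝ) : Prop where
  measurable : Measurable (Function.uncurry g)
  gaussian : IsGaussianProcess (fun z u => g u z) ν
  mean_zero : ∀ z, ∫ u, g u z ∂ν = 0
  covariance : ∀ z z', ∫ u, g u z * g u z' ∂ν = k z z'
  sup_norm : ∀ᵐ u ∂ν, eLpNorm (g u) ∞ P < ∞

/-- `κ u` is the law of the pair (instrument `z`, noise `e`) of one observation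
`(z, g u z + e)` of the draw `g u`: `z ∼ P`, `E(e ∣ z) = 0`, and `g(z) + e` is `1`-subgaussian
(jointly over the draw and the observation). The noise may depend on the draw through `u`. -/
structure IsNoiseModel {Z U : Type*} [MeasurableSpace Z] [MeasurableSpace U]
    (P : Measure Z) (ν : Measure U) (g : U → Z → ℝ) (κ : Kernel U (Z × ℝ)) : Prop where
  law_instrument : ∀ᵐ u ∂ν, (κ u).map Prod.fst = P
  integrable_noise : ∀ᵐ u ∂ν, Integrable (fun p : Z × ℝ => p.2) (κ u)
  cond_mean_zero : ∀ᵐ u ∂ν, ∀ A : Set Z, MeasurableSet A →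
    ∫ p in Prod.fst ⁻¹' A, p.2 ∂(κ u) = 0
  subgaussian : HasSubgaussianMGF (fun q : U × (Z × ℝ) => g q.1 q.2.1 + q.2.2) 1 (ν ⊗ₘ κ)

/-- The regression algorithm `A` (mapping a sample of size `n` to an estimator `Z → ℝ`) has squared
`L²(P)` error at most `ξ n ^ 2` on average over the Gaussian process draw and the sample, where
`ξ n → 0`. -/
structure IsRegressionOracle {Z U : Type*} [MeasurableSpace Z] [MeasurableSpace U]
    (P : Measure Z) (ν : Measure U) (g : U → Z → ℝ) (κ : Kernel U (Z × ℝ))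
    (A : (n : ℕ) → (Fin n → Z × ℝ) → Z → ℝ) (ξ : ℕ → ℝ) : Prop where
  measurable : ∀ n, Measurable (Function.uncurry (A n))
  nonneg : ∀ n, 0 ≤ ξ n
  tendsto_zero : Tendsto ξ atTop (𝓝 0)
  error : ∀ n, 0 < n →
    ∫⁻ u, ∫⁻ D, (∫⁻ z, ‖A n D z - g u z‖ₑ ^ 2 ∂P)
      ∂(Measure.pi fun _ : Fin n => (κ u).map fun p => (p.1, g u p.1 + p.2)) ∂ν
      ≤ ENNReal.ofReal (ξ n ^ 2)

/-- `m` i.i.d. draws `u j` from the prior, shared instruments `z i` and noises `e i j`. For each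
`j`, conditionally on the draw `u j` the pairs `(z i, e i j)`, `i < n`, are i.i.d. with law
`κ (u j)`. Nothing else is required of the joint behaviour of the noises. -/
structure IsSharedDataset {Z U Ω : Type*} [MeasurableSpace Z] [MeasurableSpace U]
    [MeasurableSpace Ω] (ν : Measure U) (κ : Kernel U (Z × ℝ)) (Q : Measure Ω) {n m : ℕ}
    (u : Fin m → Ω → U) (z : Fin n → Ω → Z) (e : Fin n → Fin m → Ω → ℝ) : Prop where
  measurable_draw : ∀ j, Measurable (u j)
  measurable_instrument : ∀ i, Measurable (z i)
  measurable_noise : ∀ i j, Measurable (e i j)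
  indep_draws : iIndepFun u Q
  law_draw : ∀ j, Q.map (u j) = ν
  cond_iid : ∀ (j : Fin m) (S : Set U) (T : Fin n → Set (Z × ℝ)), MeasurableSet S →
    (∀ i, MeasurableSet (T i)) →
    Q {ω | u j ω ∈ S ∧ ∀ i, (z i ω, e i j ω) ∈ T i} = ∫⁻ v in S, ∏ i, κ v (T i) ∂ν

/-- The shared data set: row `i` consists of the instrument `z i` and of the noisy values
`g (u j) (z i) + e i j` of all the draws. -/
def sharedData {Z U Ω : Type*} (g : U → Z → ℝ) {n m : ℕ} (u : Fin m → Ω → U) (z : Fin n → Ω → Z)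
    (e : Fin n → Fin m → Ω → ℝ) (ω : Ω) : Fin n → Z × (Fin m → ℝ) :=
  fun i => (z i ω, fun j => g (u j ω) (z i ω) + e i j ω)

/-- The `σ`-algebra generated by the prior draws (through their values) and the data set. -/
abbrev dataSigma {Z U Ω : Type*} [MeasurableSpace Z] (g : U → Z → ℝ) {n m : ℕ}
    (u : Fin m → Ω → U) (z : Fin n → Ω → Z) (e : Fin n → Fin m → Ω → ℝ) : MeasurableSpace Ω :=
  MeasurableSpace.comap
    (fun ω => ((fun j z' => g (u j ω) z' : Fin m → Z → ℝ), sharedData g u z e ω)) inferInstance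

/-- Truncation of a real number at a level `B`: from above, or from both sides. -/
def truncations : Set (ℝ → ℝ → ℝ) :=
  {fun B x => min B x, fun B x => max (-B) (min B x)}

/-- The truncated estimates `ĝ⁽ʲ⁾`, as functions of the shared data set. -/
def denoised {Z : Type*} (A : (n : ℕ) → (Fin n → Z × ℝ) → Z → ℝ) (tr : ℝ → ℝ → ℝ) (Ck : ℝ)
    {n m : ℕ} (D : Fin n → Z × (Fin m → ℝ)) : Fin m → Z → ℝ :=
  fun j z => tr (Ck * Real.log n) (A n (fun i => ((D i).1, (D i).2 j)) z)

/-- The approximate function space: all linear combinations of the functions `G j`. -/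
def approxSpace {Z : Type*} {m : ℕ} (G : Fin m → Z → ℝ) : Set (Z → ℝ) :=
  {h | ∃ θ : EuclideanSpace ℝ (Fin m), h = fun z => ∑ j, θ j * G j z}

/-- Its norm `√m ‖θ‖₂`, minimised over the coefficient vectors `θ` that represent the function. -/
def approxNorm {Z : Type*} {m : ℕ} (G : Fin m → Z → ℝ) (h : Z → ℝ) : ℝ :=
  sInf {r : ℝ | ∃ θ : EuclideanSpace ℝ (Fin m),
    (h = fun z => ∑ j, θ j * G j z) ∧ r = Real.sqrt m * ‖θ‖}

end KernelLearning

end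

/-!
# Learned reproducing kernel Hilbert spaces

Write `V j` for the class in `L²(P)` of the `j`-th draw and `a i j = ⟪psi i, V j⟫ / √(lam i)` for
its normalised coefficients. The `a i j` are independent standard Gaussian variables, and `V j`
lies in the closed span of the `psi i` (`IsBoundedGPPrior.isStdGaussianFamily_coeff`,
`IsBoundedGPPrior.ae_mem_closure_span`). The projection of `g*` onto the leading `r = m / 2`
eigenfunctions is `∑ i < r, w i √(lam i) psi i`, where the Euclidean norm of `w` is at most the norm
of the projection in the reproducing kernel Hilbert space
(`exists_leadingCombination_eq_mercerProj`).

Hence one looks for `θ` with `∑ j, θ j * a i j = w i` for all `i < r`. The matrix of the `a i j`,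
`i < r`, has at least twice as many columns as rows, so its smallest singular value is at least
`√m / 2000` with high probability, and the solution of least norm satisfies `√m ‖θ‖ ≤ 2000 ‖w‖`
(`measure_exists_sum_indicator_sq_lt_le`, `exists_min_norm_preimage`). This bound survives when the
columns of a small proportion of the draws are deleted. The draws whose essential supremum exceeds
the truncation level are deleted in this way, since truncation may increase the error of their
estimates; for the other draws it does not.

For this `θ` the combination `∑ j, θ j V j` differs from the projection only by its coefficients at
the indices `i ≥ r`. They are controlled by the operator norm of the Gaussian matrix with rows
weighted by `√(lam i)`, whose square is `O(m t)` for `t = C m ^ (-(b + 1))`, because the eigendecay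
bounds each of the remaining eigenvalues by `t` and their sum by `t m`
(`measure_exists_finset_quadratic_gt_le`, `exists_tail_bound`). The constant `C` depends on the
kernel, and it is absorbed by the factor `√(log n)`. The replacement of `V j` by the estimates costs
at most `‖θ‖` times the root of the sum of the squared errors; the expectation of this sum is at
most `m ξ n ^ 2`, and Markov's inequality with the factor `log n` bounds it with high probability
(`IsRegressionOracle.lintegral_error_le`, `measure_not_approximatesLeading_le`). Properties of the
noise enter through the risk bound of the regression algorithm alone.

The event must be determined by the data. It is described by countably many strict inequalities
between measurable functions of the data, with `w` and `θ` in dense sequences, and a density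
argument recovers all `w` (`DenselyApproximatesLeading`).
-/

noncomputable section

namespace KernelLearning

/-! ### Standard Gaussian families -/

/-- A family of real random variables all of whose finite linear combinations `∑ w i * a i` have
the law `N(0, ∑ (w i) ^ 2)`, that is, a family of independent standard Gaussian variables. -/
structure IsStdGaussianFamily {U ι : Type*} [MeasurableSpace U] (ν : Measure U)
    (a : ι → U → ℝ) : Prop where
  measurable : ∀ i, Measurable (a i)
  map_sum : ∀ (s : Finset ι) (w : ι → ℝ), ν.map (fun u => ∑ i ∈ s, w i * a i u) =
    gaussianReal 0 (∑ i ∈ s, w i ^ 2).toNNReal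

lemma lintegral_exp_mul_sq_gaussianReal {t : ℝ} (ht : t < 1 / 2) :
    ∫⁻ x, ENNReal.ofReal (Real.exp (t * x ^ 2)) ∂(gaussianReal 0 1) =
      ENNReal.ofReal (Real.sqrt (1 / (1 - 2 * t))) := by
  have hb : 0 < 1 / 2 - t := by linarith
  rw [gaussianReal_of_var_ne_zero 0 one_ne_zero,
    lintegral_withDensity_eq_lintegral_mul _ (measurable_gaussianPDF 0 1) (by fun_prop)]
  have h1 : ∀ x : ℝ, (gaussianPDF 0 1 * fun x => ENNReal.ofReal (Real.exp (t * x ^ 2))) x =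
      ENNReal.ofReal ((√(2 * Real.pi))⁻¹ * Real.exp (-(1 / 2 - t) * x ^ 2)) := by
    intro x
    simp only [Pi.mul_apply, gaussianPDF]
    rw [← ENNReal.ofReal_mul (gaussianPDFReal_nonneg _ _ _), gaussianPDFReal]
    simp only [NNReal.coe_one, mul_one, sub_zero]
    rw [mul_assoc, ← Real.exp_add]
    congr 3
    ring
  simp_rw [h1]
  rw [← ofReal_integral_eq_lintegral_ofReal ((integrable_exp_neg_mul_sq hb).const_mul _)
    (ae_of_all _ fun x => by positivity), integral_const_mul, integral_gaussian,
    ← Real.sqrt_inv, ← Real.sqrt_mul (by positivity)]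
  congr 2
  have : 1 - 2 * t ≠ 0 := by linarith
  field_simp

lemma one_div_one_sub_le_exp {x : ℝ} (hx0 : 0 ≤ x) (hx : x ≤ 1 / 2) :
    1 / (1 - x) ≤ Real.exp (2 * x) := by
  rw [div_le_iff₀ (by linarith)]
  have h := Real.add_one_le_exp (2 * x)
  nlinarith

lemma lintegral_exp_mul_sq_gaussianReal_le {t : ℝ} (ht0 : 0 ≤ t) (ht : t ≤ 1 / 4) :
    ∫⁻ x, ENNReal.ofReal (Real.exp (t * x ^ 2)) ∂(gaussianReal 0 1) ≤
      ENNReal.ofReal (Real.exp (2 * t)) := by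
  rw [lintegral_exp_mul_sq_gaussianReal (by linarith)]
  apply ENNReal.ofReal_le_ofReal
  rw [Real.sqrt_le_left (Real.exp_pos _).le, ← Real.exp_nat_mul]
  refine (one_div_one_sub_le_exp (by linarith) (by linarith)).trans (le_of_eq ?_)
  congr 1

namespace IsStdGaussianFamily

variable {U ι : Type*} [MeasurableSpace U] {ν : Measure U} {a : ι → U → ℝ}

lemma map_eq (ha : IsStdGaussianFamily ν a) (i : ι) : ν.map (a i) = gaussianReal 0 1 := by
  simpa using ha.map_sum {i} 1

lemma comp {κ : Type*} (ha : IsStdGaussianFamily ν a) {f : κ → ι} (hf : Function.Injective f) :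
    IsStdGaussianFamily ν (fun k => a (f k)) where
  measurable k := ha.measurable _
  map_sum s w := by
    classical
    have := ha.map_sum (s.map ⟨f, hf⟩) (Function.extend f w 0)
    simpa [Finset.sum_map, hf.extend_apply] using this

/-- The linear combinations determine the joint characteristic function. -/
lemma iIndepFun [Fintype ι] [IsProbabilityMeasure ν] (ha : IsStdGaussianFamily ν a) :
    iIndepFun a ν := by
  classical
  rw [iIndepFun_iff_map_fun_eq_pi_map (fun i => (ha.measurable i).aemeasurable)]
  simp_rw [ha.map_eq]
  have hmeas := ha.measurable
  have hm : Measurable fun u i => a i u := measurable_pi_lambda _ hmeas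
  have hm2 : Measurable ((WithLp.toLp 2 : (ι → ℝ) → EuclideanSpace ℝ ι) ∘ fun u i => a i u) :=
    (by fun_prop : Measurable (WithLp.toLp 2 : (ι → ℝ) → EuclideanSpace ℝ ι)).comp hm
  have key : ν.map ((WithLp.toLp 2 : (ι → ℝ) → EuclideanSpace ℝ ι) ∘ fun u i => a i u) =
      (Measure.pi fun _ : ι => gaussianReal 0 1).map (WithLp.toLp 2) := by
    rw [map_pi_eq_stdGaussian]
    have hP : IsProbabilityMeasure
      (ν.map ((WithLp.toLp 2 : (ι → ℝ) → EuclideanSpace ℝ ι) ∘ fun u i => a i u)) :=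
      Measure.isProbabilityMeasure_map hm2.aemeasurable
    apply Measure.ext_of_charFun (E := EuclideanSpace ℝ ι)
    ext t
    rw [charFun_stdGaussian, charFun_apply,
      integral_map hm2.aemeasurable (Measurable.aestronglyMeasurable (by fun_prop))]
    have h := congrArg (fun μ => charFun μ 1) (ha.map_sum Finset.univ t)
    simp only at h
    rw [charFun_gaussianReal, charFun_apply_real,
      integral_map (Measurable.aemeasurable (Finset.measurable_sum _ fun i _ =>
        (hmeas i).const_mul _)) (Measurable.aestronglyMeasurable (by fun_prop))] at h
    simp only [Function.comp_apply, PiLp.inner_apply]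
    have h2 : ∀ u, ∑ i, inner ℝ (a i u) (t i) = ∑ i, t i * a i u := fun u => by
      simp [mul_comm]
    have h4 : (0:ℝ) ≤ ∑ i, t i ^ 2 := by positivity
    simp_rw [h2, ← Complex.ofReal_pow, EuclideanSpace.real_norm_sq_eq]
    simp only [Complex.ofReal_one, one_mul, Real.coe_toNNReal _ h4] at h
    rw [h]
    congr 1
    push_cast
    ring
  have h := congrArg (fun μ => μ.map (WithLp.ofLp : EuclideanSpace ℝ ι → ι → ℝ)) key
  simp only at h
  rw [Measure.map_map (by fun_prop) hm2, Measure.map_map (by fun_prop) (by fun_prop)] at h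
  simpa [Function.comp_def] using h

/-- Exponential moments of weighted chi-squared variables. -/
lemma lintegral_exp_sum_sq_le [Fintype ι] [IsProbabilityMeasure ν] (ha : IsStdGaussianFamily ν a)
    {c : ι → ℝ} (hc0 : ∀ i, 0 ≤ c i) (hc : ∀ i, c i ≤ 1 / 4) :
    ∫⁻ u, ENNReal.ofReal (Real.exp (∑ i, c i * a i u ^ 2)) ∂ν ≤
      ENNReal.ofReal (Real.exp (2 * ∑ i, c i)) := by
  have h1 : ∀ u, ENNReal.ofReal (Real.exp (∑ i, c i * a i u ^ 2)) =
      ∏ i, ENNReal.ofReal (Real.exp (c i * a i u ^ 2)) := fun u => by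
    rw [Real.exp_sum, ENNReal.ofReal_prod_of_nonneg (fun i _ => (Real.exp_pos _).le)]
  simp_rw [h1]
  have hind : ProbabilityTheory.iIndepFun
      (fun i u => ENNReal.ofReal (Real.exp (c i * a i u ^ 2))) ν :=
    ha.iIndepFun.comp (fun i x => ENNReal.ofReal (Real.exp (c i * x ^ 2))) (fun i => by fun_prop)
  have hmeas := ha.measurable
  rw [lintegral_prod_eq_prod_lintegral_of_indepFun Finset.univ _ hind (fun i => by fun_prop),
    Finset.mul_sum, Real.exp_sum, ENNReal.ofReal_prod_of_nonneg (fun i _ => (Real.exp_pos _).le)]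
  refine Finset.prod_le_prod' fun i _ => ?_
  refine le_trans (le_of_eq ?_) (lintegral_exp_mul_sq_gaussianReal_le (hc0 i) (hc i))
  rw [← ha.map_eq i, lintegral_map (by fun_prop) (ha.measurable i)]

/-- Combining independent copies of a standard Gaussian family with coefficients on the unit
sphere yields again a standard Gaussian family. -/
lemma sum_smul_comp {Ω : Type*} [MeasurableSpace Ω] {Q : Measure Ω} [IsProbabilityMeasure Q]
    {m : ℕ} {u : Fin m → Ω → U} (ha : IsStdGaussianFamily ν a) (hu : ∀ j, Measurable (u j))
    (hind : ProbabilityTheory.iIndepFun u Q) (hlaw : ∀ j, Q.map (u j) = ν)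
    {θ : Fin m → ℝ} (hθ : ∑ j, θ j ^ 2 = 1) :
    IsStdGaussianFamily Q (fun i ω => ∑ j, θ j * a i (u j ω)) where
  measurable i := by
    have := ha.measurable i
    fun_prop
  map_sum s w := by
    have hm := ha.measurable
    have hA : Measurable fun v => ∑ i ∈ s, w i * a i v := by fun_prop
    have h1 : (fun ω => ∑ i ∈ s, w i * ∑ j, θ j * a i (u j ω)) =
        fun ω => ∑ j, θ j * ∑ i ∈ s, w i * a i (u j ω) := by
      ext ω
      simp_rw [Finset.mul_sum]
      rw [Finset.sum_comm]
      exact Finset.sum_congr rfl fun j _ => Finset.sum_congr rfl fun i _ => by ring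
    rw [h1]
    have hX : ∀ j, Measurable fun ω => θ j * ∑ i ∈ s, w i * a i (u j ω) := fun j =>
      (hA.comp (hu j)).const_mul _
    have hindX : ProbabilityTheory.iIndepFun
        (fun j ω => θ j * ∑ i ∈ s, w i * a i (u j ω)) Q :=
      hind.comp (fun j v => θ j * ∑ i ∈ s, w i * a i v) (fun j => hA.const_mul _)
    have hP : IsProbabilityMeasure (Q.map fun ω => ∑ j, θ j * ∑ i ∈ s, w i * a i (u j ω)) :=
      Measure.isProbabilityMeasure_map (by fun_prop)
    apply Measure.ext_of_charFun
    rw [hindX.charFun_map_fun_sum_eq_prod (fun j => (hX j).aemeasurable)]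
    ext t
    have hlawX : ∀ j, Q.map (fun ω => θ j * ∑ i ∈ s, w i * a i (u j ω)) =
        gaussianReal 0 (θ j ^ 2 * ∑ i ∈ s, w i ^ 2).toNNReal := by
      intro j
      have := ha.map_sum s (fun i => θ j * w i)
      rw [← hlaw j, Measure.map_map (by fun_prop) (hu j)] at this
      simp only [mul_pow, mul_assoc, ← Finset.mul_sum] at this
      exact this
    simp_rw [Finset.prod_apply, hlawX, charFun_gaussianReal]
    rw [← Complex.exp_sum]
    have hS : (0:ℝ) ≤ ∑ i ∈ s, w i ^ 2 := by positivity
    congr 1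
    have hx : ∀ j, ((θ j ^ 2 * ∑ i ∈ s, w i ^ 2).toNNReal : ℝ) = θ j ^ 2 * ∑ i ∈ s, w i ^ 2 :=
      fun j => Real.coe_toNNReal _ (by positivity)
    simp only [hx, Real.coe_toNNReal _ hS]
    simp only [Complex.ofReal_zero, mul_zero, zero_mul, zero_sub, Finset.sum_neg_distrib]
    rw [← Finset.sum_div, ← Finset.sum_mul, ← Complex.ofReal_sum, ← Finset.sum_mul, hθ, one_mul]

end IsStdGaussianFamily

/-! ### Nets of the sphere and operator norms of Gaussian matrices -/

/-- Comparison of volumes: an `η`-separated subset of the unit sphere has at most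
`(1 + 2 / η) ^ dim` elements. -/
lemma card_le_of_separated {E : Type*} [NormedAddCommGroup E] [NormedSpace ℝ E]
    [FiniteDimensional ℝ E] {η : ℝ} (hη : 0 < η) {N : Finset E} (h1 : ∀ x ∈ N, ‖x‖ = 1)
    (hsep : ∀ x ∈ N, ∀ y ∈ N, x ≠ y → η < ‖x - y‖) :
    (N.card : ℝ) ≤ (1 + 2 / η) ^ Module.finrank ℝ E := by
  borelize E
  let μ : Measure E := Measure.addHaar
  have hball : ∀ (x : E) {r : ℝ}, 0 < r →
      μ (Metric.ball x r) = ENNReal.ofReal (r ^ Module.finrank ℝ E) * μ (Metric.ball 0 1) :=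
    fun x r hr => Measure.addHaar_ball_of_pos μ x hr
  have hdisj : (N : Set E).PairwiseDisjoint fun x => Metric.ball x (η / 2) := by
    intro x hx y hy hxy
    apply Metric.ball_disjoint_ball
    rw [dist_eq_norm]
    linarith [hsep x hx y hy hxy]
  have hsub : (⋃ x ∈ N, Metric.ball x (η / 2)) ⊆ Metric.ball 0 (1 + η / 2) := by
    intro z hz
    simp only [Set.mem_iUnion, Metric.mem_ball, exists_prop] at hz
    obtain ⟨x, hx, hzx⟩ := hz
    rw [Metric.mem_ball, dist_zero_right]
    have := norm_le_norm_add_norm_sub x z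
    rw [dist_eq_norm, norm_sub_rev] at hzx
    linarith [h1 x hx]
  have h := measure_mono (μ := μ) hsub
  rw [measure_biUnion_finset hdisj fun x _ => measurableSet_ball, hball 0 (by linarith)] at h
  simp_rw [fun x : E => hball x (half_pos hη)] at h
  rw [Finset.sum_const, nsmul_eq_mul, ← mul_assoc,
    ENNReal.mul_le_mul_iff_left (Metric.measure_ball_pos μ _ one_pos).ne' measure_ball_lt_top.ne,
    ← ENNReal.ofReal_natCast, ← ENNReal.ofReal_mul (by positivity),
    ENNReal.ofReal_le_ofReal_iff (by positivity)] at h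
  have h2 : (1 + 2 / η) = (1 + η / 2) / (η / 2) := by field_simp; ring
  rw [h2, div_pow, le_div_iff₀ (by positivity)]
  exact h

/-- A maximal `η`-separated subset of the unit sphere is an `η`-net. -/
lemma exists_sphere_net (E : Type*) [NormedAddCommGroup E] [NormedSpace ℝ E]
    [FiniteDimensional ℝ E] {η : ℝ} (hη : 0 < η) :
    ∃ N : Finset E, (∀ x ∈ N, ‖x‖ = 1) ∧ (∀ x : E, ‖x‖ = 1 → ∃ y ∈ N, ‖x - y‖ ≤ η) ∧
      (N.card : ℝ) ≤ (1 + 2 / η) ^ Module.finrank ℝ E := by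
  classical
  let P : ℕ → Prop := fun n => ∃ N : Finset E, (∀ x ∈ N, ‖x‖ = 1) ∧
    (∀ x ∈ N, ∀ y ∈ N, x ≠ y → η < ‖x - y‖) ∧ N.card = n
  let K : ℕ := ⌊(1 + 2 / η) ^ Module.finrank ℝ E⌋₊
  have hPK : ∀ n, P n → n ≤ K := fun n ⟨N, h1, h2, h3⟩ =>
    Nat.le_floor (h3 ▸ card_le_of_separated hη h1 h2)
  have hP0 : P 0 := ⟨∅, by simp, by simp, rfl⟩
  obtain ⟨N, h1, h2, h3⟩ := Nat.findGreatest_spec (P := P) (Nat.zero_le K) hP0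
  refine ⟨N, h1, fun x hx => ?_, card_le_of_separated hη h1 h2⟩
  by_contra! hcon
  have hxN : x ∉ N := fun hxN => by have := hcon x hxN; simp at this; linarith
  have hP : P (Nat.findGreatest P K + 1) := by
    refine ⟨insert x N, ?_, ?_, by rw [Finset.card_insert_of_notMem hxN, h3]⟩
    · intro y hy
      rcases Finset.mem_insert.1 hy with rfl | hy
      exacts [hx, h1 y hy]
    · intro y hy z hz hyz
      rcases Finset.mem_insert.1 hy with rfl | hyN <;>
        rcases Finset.mem_insert.1 hz with rfl | hzN
      · exact absurd rfl hyz
      · exact hcon z hzN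
      · rw [norm_sub_rev]; exact hcon y hyN
      · exact h2 y hyN z hzN hyz
  have := Nat.le_findGreatest (hPK _ hP) hP
  omega

/-- The linear map between Euclidean spaces with the given matrix of coefficients. -/
def euclideanMap {ι κ : Type*} [Fintype ι] [Fintype κ] (B : κ → ι → ℝ) :
    EuclideanSpace ℝ ι →L[ℝ] EuclideanSpace ℝ κ :=
  LinearMap.toContinuousLinearMap
    { toFun := fun θ => WithLp.toLp 2 fun k => ∑ j, B k j * θ j
      map_add' := fun x y => by ext k; simp [mul_add, Finset.sum_add_distrib]
      map_smul' := fun c x => by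
        ext k
        simp only [PiLp.smul_apply, smul_eq_mul, RingHom.id_apply, Finset.mul_sum]
        exact Finset.sum_congr rfl fun j _ => by ring }

lemma euclideanMap_apply {ι κ : Type*} [Fintype ι] [Fintype κ] (B : κ → ι → ℝ)
    (θ : EuclideanSpace ℝ ι) (k : κ) : euclideanMap B θ k = ∑ j, B k j * θ j := rfl

lemma norm_euclideanMap_sq {ι κ : Type*} [Fintype ι] [Fintype κ] (B : κ → ι → ℝ)
    (θ : EuclideanSpace ℝ ι) : ‖euclideanMap B θ‖ ^ 2 = ∑ k, (∑ j, B k j * θ j) ^ 2 := by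
  rw [EuclideanSpace.real_norm_sq_eq]
  rfl

lemma opNorm_le_of_sphere_net {E F : Type*} [NormedAddCommGroup E] [NormedSpace ℝ E]
    [NormedAddCommGroup F] [NormedSpace ℝ F] (L : E →L[ℝ] F) {N : Finset E}
    (hN : ∀ x : E, ‖x‖ = 1 → ∃ y ∈ N, ‖x - y‖ ≤ 1 / 2) {t : ℝ} (ht : 0 ≤ t)
    (hL : ∀ y ∈ N, ‖L y‖ ≤ t) : ‖L‖ ≤ 2 * t := by
  -- approximating a unit vector by the net costs at most half of the norm that is to be bounded
  have h : ‖L‖ ≤ t + ‖L‖ / 2 := by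
    refine ContinuousLinearMap.opNorm_le_of_unit_norm (by positivity) fun x hx => ?_
    obtain ⟨y, hy, hxy⟩ := hN x hx
    calc ‖L x‖ = ‖L y + L (x - y)‖ := by rw [← map_add]; congr 2; abel
      _ ≤ ‖L y‖ + ‖L (x - y)‖ := norm_add_le _ _
      _ ≤ t + ‖L‖ * ‖x - y‖ := add_le_add (hL y hy) (L.le_opNorm _)
      _ ≤ t + ‖L‖ / 2 := by nlinarith [norm_nonneg L]
  linarith

section RandomMatrix

variable {U ι Ω : Type*} [MeasurableSpace U] {ν : Measure U} {a : ι → U → ℝ} [Fintype ι]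
  [MeasurableSpace Ω] {Q : Measure Ω} [IsProbabilityMeasure Q] {m : ℕ} {u : Fin m → Ω → U}

/-- Chernoff's bound for the quadratic form at a fixed unit vector. Its rate beats the number of
elements of a `1 / 2`-net of the sphere, which is at most `5 ^ m`. -/
lemma measure_quadratic_ge_le (ha : IsStdGaussianFamily ν a) (hu : ∀ j, Measurable (u j))
    (hind : iIndepFun u Q) (hlaw : ∀ j, Q.map (u j) = ν) {σ : ι → ℝ} {s : ℝ} (hs : 0 < s)
    (hσ0 : ∀ i, 0 ≤ σ i) (hσ : ∀ i, σ i ≤ s) (hsum : ∑ i, σ i ≤ s * m)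
    {θ : EuclideanSpace ℝ (Fin m)} (hθ : ‖θ‖ = 1) :
    Q {ω | 16 * s * m ≤ ∑ i, σ i * (∑ j, θ j * a i (u j ω)) ^ 2} ≤
      ENNReal.ofReal (Real.exp (-(7 / 2) * m)) := by
  have hθ2 : ∑ j, θ j ^ 2 = 1 := by rw [← EuclideanSpace.real_norm_sq_eq, hθ, one_pow]
  have hY := ha.sum_smul_comp hu hind hlaw hθ2
  have h4s : (0:ℝ) < 4 * s := by linarith
  have hL := hY.lintegral_exp_sum_sq_le (c := fun i => σ i / (4 * s))
    (fun i => div_nonneg (hσ0 i) h4s.le) (fun i => by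
      rw [div_le_iff₀ h4s]; linarith [hσ i])
  set f : Ω → ℝ≥0∞ := fun ω =>
    ENNReal.ofReal (Real.exp (∑ i, σ i / (4 * s) * (∑ j, θ j * a i (u j ω)) ^ 2)) with hf
  have hsub : {ω | 16 * s * m ≤ ∑ i, σ i * (∑ j, θ j * a i (u j ω)) ^ 2} ⊆
      {ω | ENNReal.ofReal (Real.exp (4 * m)) ≤ f ω} := by
    intro ω hω
    simp only [Set.mem_ofPred_eq] at hω
    apply ENNReal.ofReal_le_ofReal
    rw [Real.exp_le_exp]
    have : ∑ i, σ i / (4 * s) * (∑ j, θ j * a i (u j ω)) ^ 2 =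
        (∑ i, σ i * (∑ j, θ j * a i (u j ω)) ^ 2) / (4 * s) := by
      rw [Finset.sum_div]; exact Finset.sum_congr rfl fun i _ => by ring
    rw [this, le_div_iff₀ h4s]
    linarith
  have hmeas := hY.measurable
  have hfm : Measurable f := by
    refine ENNReal.measurable_ofReal.comp (Real.measurable_exp.comp ?_)
    exact Finset.measurable_sum _ fun i _ => ((hmeas i).pow_const 2).const_mul _
  have hM := mul_meas_ge_le_lintegral₀ (μ := Q) hfm.aemeasurable
    (ENNReal.ofReal (Real.exp (4 * m)))
  have h2 : ENNReal.ofReal (Real.exp (4 * m)) *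
      Q {ω | 16 * s * m ≤ ∑ i, σ i * (∑ j, θ j * a i (u j ω)) ^ 2} ≤
      ENNReal.ofReal (Real.exp (m / 2)) := by
    refine (mul_le_mul_right (measure_mono hsub) _).trans (hM.trans (hL.trans ?_))
    apply ENNReal.ofReal_le_ofReal
    rw [Real.exp_le_exp, ← Finset.sum_div, ← mul_div_assoc, div_le_iff₀ h4s]
    linarith
  have h3 : ENNReal.ofReal (Real.exp (m / 2)) = ENNReal.ofReal (Real.exp (4 * m)) *
      ENNReal.ofReal (Real.exp (-(7 / 2) * m)) := by
    rw [← ENNReal.ofReal_mul (Real.exp_pos _).le, ← Real.exp_add]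
    congr 2; ring
  rw [h3] at h2
  exact (ENNReal.mul_le_mul_iff_right (by simp [Real.exp_pos]) ENNReal.ofReal_ne_top).1 h2

/-- Operator norm of a Gaussian matrix with weighted rows: the weights bring in the largest weight
and the sum of the weights divided by the number of columns, but not the number of rows. -/
lemma measure_exists_quadratic_gt_le (ha : IsStdGaussianFamily ν a) (hu : ∀ j, Measurable (u j))
    (hind : iIndepFun u Q) (hlaw : ∀ j, Q.map (u j) = ν) {σ : ι → ℝ} {s : ℝ} (hs : 0 < s)
    (hσ0 : ∀ i, 0 ≤ σ i) (hσ : ∀ i, σ i ≤ s) (hsum : ∑ i, σ i ≤ s * m) :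
    Q {ω | ¬ ∀ θ : EuclideanSpace ℝ (Fin m),
      ∑ i, σ i * (∑ j, θ j * a i (u j ω)) ^ 2 ≤ 64 * s * m * ‖θ‖ ^ 2} ≤
      ENNReal.ofReal (Real.exp (-m)) := by
  obtain ⟨N, hN1, hN2, hN3⟩ :=
    exists_sphere_net (EuclideanSpace ℝ (Fin m)) (by norm_num : (0:ℝ) < 1 / 2)
  have hsub : {ω | ¬ ∀ θ : EuclideanSpace ℝ (Fin m),
      ∑ i, σ i * (∑ j, θ j * a i (u j ω)) ^ 2 ≤ 64 * s * m * ‖θ‖ ^ 2} ⊆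
      ⋃ θ ∈ N, {ω | 16 * s * m ≤ ∑ i, σ i * (∑ j, θ j * a i (u j ω)) ^ 2} := by
    intro ω hω
    by_contra hcon
    simp only [Set.mem_iUnion, Set.mem_ofPred_eq, exists_prop, not_exists, not_and, not_le] at hcon
    apply hω
    let L := euclideanMap fun i j => √(σ i) * a i (u j ω)
    have hLn : ∀ θ, ‖L θ‖ ^ 2 = ∑ i, σ i * (∑ j, θ j * a i (u j ω)) ^ 2 := by
      intro θ
      rw [norm_euclideanMap_sq]
      refine Finset.sum_congr rfl fun i _ => ?_
      have : ∑ j, √(σ i) * a i (u j ω) * θ j = √(σ i) * ∑ j, θ j * a i (u j ω) := by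
        rw [Finset.mul_sum]; exact Finset.sum_congr rfl fun j _ => by ring
      rw [this, mul_pow, Real.sq_sqrt (hσ0 i)]
    have hL : ‖L‖ ≤ 2 * √(16 * s * m) := by
      refine opNorm_le_of_sphere_net L hN2 (Real.sqrt_nonneg _) fun θ hθ => ?_
      apply Real.le_sqrt_of_sq_le
      rw [hLn]
      exact (hcon θ hθ).le
    intro θ
    rw [← hLn]
    calc ‖L θ‖ ^ 2 ≤ (2 * √(16 * s * m) * ‖θ‖) ^ 2 := by
          gcongr; exact L.le_of_opNorm_le hL θ
      _ = 64 * s * m * ‖θ‖ ^ 2 := by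
          rw [mul_pow, mul_pow, Real.sq_sqrt (by positivity)]; ring
  refine (measure_mono hsub).trans ((measure_biUnion_finset_le _ _).trans ?_)
  refine (Finset.sum_le_sum fun θ hθ =>
    measure_quadratic_ge_le ha hu hind hlaw hs hσ0 hσ hsum (hN1 θ hθ)).trans ?_
  rw [Finset.sum_const, nsmul_eq_mul, ← ENNReal.ofReal_natCast,
    ← ENNReal.ofReal_mul (by positivity)]
  apply ENNReal.ofReal_le_ofReal
  -- the net has at most `5 ^ m` elements, and `5 ≤ exp (5 / 2)`
  have h5 : (N.card : ℝ) ≤ Real.exp ((5 / 2) * m) := by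
    refine hN3.trans ?_
    rw [finrank_euclideanSpace_fin, mul_comm (5 / 2 : ℝ), Real.exp_nat_mul]
    gcongr
    have h1 : (1 + 2 / (1 / 2) : ℝ) = 5 := by norm_num
    rw [h1]
    have h2 : Real.exp (5 / 2) = Real.exp (1 / 2) * (Real.exp 1) ^ 2 := by
      rw [← Real.exp_nat_mul, ← Real.exp_add]; norm_num
    have h3 := Real.exp_one_gt_d9
    have h4 := Real.add_one_le_exp (1 / 2 : ℝ)
    rw [h2]
    nlinarith
  calc (N.card : ℝ) * Real.exp (-(7 / 2) * m) ≤
      Real.exp ((5 / 2) * m) * Real.exp (-(7 / 2) * m) := by gcongr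
    _ = Real.exp (-m) := by rw [← Real.exp_add]; congr 1; ring

end RandomMatrix

/-! ### Smallest singular values of Gaussian matrices -/

section RandomMatrix

variable {U ι Ω : Type*} [MeasurableSpace U] {ν : Measure U} {a : ι → U → ℝ}

/-- The marginals of a standard Gaussian family put little mass near the origin, and discarding a
set `S` of small probability does not change this. -/
lemma lintegral_exp_neg_sq_indicator_le (ha : IsStdGaussianFamily ν a) [Fintype ι]
    {S : Set U} (hS : MeasurableSet S) (hνS : ν S ≤ ENNReal.ofReal (1 / 4000))
    {w : EuclideanSpace ℝ ι} (hw : ‖w‖ = 1) :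
    ∫⁻ v, ENNReal.ofReal (Real.exp (-(1000000 * (Sᶜ.indicator (fun v => ∑ i, w i * a i v) v) ^ 2)))
      ∂ν ≤ ENNReal.ofReal (1 / 1000) := by
  have hmeas := ha.measurable
  have hA : Measurable fun v => ∑ i, w i * a i v := by fun_prop
  have hlaw : ν.map (fun v => ∑ i, w i * a i v) = gaussianReal 0 1 := by
    rw [ha.map_sum Finset.univ w, ← EuclideanSpace.real_norm_sq_eq, hw]
    simp
  calc ∫⁻ v, ENNReal.ofReal
        (Real.exp (-(1000000 * (Sᶜ.indicator (fun v => ∑ i, w i * a i v) v) ^ 2))) ∂ν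
      ≤ ∫⁻ v, (ENNReal.ofReal (Real.exp (-1000000 * (∑ i, w i * a i v) ^ 2))
          + S.indicator 1 v) ∂ν := by
        refine lintegral_mono fun v => ?_
        by_cases hv : v ∈ S
        · simp [hv]
        · simp [hv]
    _ = ∫⁻ x, ENNReal.ofReal (Real.exp (-1000000 * x ^ 2)) ∂(gaussianReal 0 1) + ν S := by
        rw [lintegral_add_left (by fun_prop), lintegral_indicator_one hS, ← hlaw,
          lintegral_map (by fun_prop) hA]
    _ ≤ ENNReal.ofReal (3 / 4000) + ENNReal.ofReal (1 / 4000) := by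
        gcongr
        rw [lintegral_exp_mul_sq_gaussianReal (by norm_num)]
        apply ENNReal.ofReal_le_ofReal
        apply Real.sqrt_le_iff.2
        norm_num
    _ = ENNReal.ofReal (1 / 1000) := by
        rw [← ENNReal.ofReal_add (by norm_num) (by norm_num)]; norm_num

variable [Fintype ι]
  [MeasurableSpace Ω] {Q : Measure Ω} {m : ℕ} {u : Fin m → Ω → U}

/-- Small ball estimate for a fixed unit vector, by Markov's inequality applied to
`∏ j, exp (-(1000 * A (u j)) ^ 2)`. The factor `1 / 1000` per draw has to beat the cardinality of a
net whose mesh is small compared to the lower bound. -/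
lemma measure_sum_indicator_sq_le (ha : IsStdGaussianFamily ν a) (hu : ∀ j, Measurable (u j))
    (hind : iIndepFun u Q) (hlaw : ∀ j, Q.map (u j) = ν)
    {S : Set U} (hS : MeasurableSet S) (hνS : ν S ≤ ENNReal.ofReal (1 / 4000))
    {w : EuclideanSpace ℝ ι} (hw : ‖w‖ = 1) :
    Q {ω | ∑ j, (Sᶜ.indicator (fun v => ∑ i, w i * a i v) (u j ω)) ^ 2 ≤ m / 1000000} ≤
      ENNReal.ofReal ((Real.exp 1 / 1000) ^ m) := by
  have hmeas := ha.measurable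
  have hA : Measurable (Sᶜ.indicator fun v => ∑ i, w i * a i v) :=
    Measurable.indicator (by fun_prop) hS.compl
  set A := Sᶜ.indicator fun v => ∑ i, w i * a i v with hAdef
  let F : U → ℝ≥0∞ := fun v => ENNReal.ofReal (Real.exp (-(1000000 * A v ^ 2)))
  have hF : Measurable F := by
    exact ENNReal.measurable_ofReal.comp (Real.measurable_exp.comp
      (((hA.pow_const 2).const_mul _).neg))
  have hprod : ∫⁻ ω, ∏ j, F (u j ω) ∂Q ≤ ENNReal.ofReal ((1 / 1000) ^ m) := by
    rw [lintegral_prod_eq_prod_lintegral_of_indepFun Finset.univ (fun j ω => F (u j ω))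
      (hind.comp (fun _ => F) fun _ => hF) (fun j => hF.comp (hu j))]
    have h1 : ∀ j, ∫⁻ ω, F (u j ω) ∂Q ≤ ENNReal.ofReal (1 / 1000) := fun j => by
      rw [← lintegral_map hF (hu j), hlaw j]
      exact lintegral_exp_neg_sq_indicator_le ha hS hνS hw
    refine (Finset.prod_le_prod' fun j _ => h1 j).trans ?_
    rw [Finset.prod_const, ENNReal.ofReal_pow (by norm_num)]
    simp
  have hM := mul_meas_ge_le_lintegral₀ (μ := Q) (f := fun ω => ∏ j, F (u j ω))
    (Finset.measurable_prod _ fun j _ => hF.comp (hu j)).aemeasurable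
    (ENNReal.ofReal (Real.exp (-m)))
  have hsub : {ω | ∑ j, A (u j ω) ^ 2 ≤ m / 1000000} ⊆
      {ω | ENNReal.ofReal (Real.exp (-m)) ≤ ∏ j, F (u j ω)} := by
    intro ω hω
    simp only [Set.mem_ofPred_eq] at hω ⊢
    rw [← ENNReal.ofReal_prod_of_nonneg (fun i _ => (Real.exp_pos _).le), ← Real.exp_sum]
    apply ENNReal.ofReal_le_ofReal
    rw [Real.exp_le_exp, Finset.sum_neg_distrib, ← Finset.mul_sum]
    linarith
  have h2 := (mul_le_mul_right (measure_mono hsub) _).trans (hM.trans hprod)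
  have h3 : ENNReal.ofReal ((1 / 1000) ^ m) = ENNReal.ofReal (Real.exp (-m)) *
      ENNReal.ofReal ((Real.exp 1 / 1000) ^ m) := by
    have h4 : Real.exp (-m) * Real.exp 1 ^ m = 1 := by
      rw [← Real.exp_nat_mul, ← Real.exp_add]
      simp
    rw [← ENNReal.ofReal_mul (Real.exp_pos _).le, div_pow, div_pow, ← mul_div_assoc, h4, one_pow]
  rw [h3] at h2
  exact (ENNReal.mul_le_mul_iff_right (by simp [Real.exp_pos]) ENNReal.ofReal_ne_top).1 h2

variable [IsProbabilityMeasure Q]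

/-- Smallest singular value of a Gaussian matrix with at least twice as many columns as rows, in
which the columns that fall into a set `S` of small probability are replaced by zero. The small ball
estimate on a net of the sphere extends to the sphere by the bound for the operator norm. -/
lemma measure_exists_sum_indicator_sq_lt_le (ha : IsStdGaussianFamily ν a)
    (hu : ∀ j, Measurable (u j)) (hind : iIndepFun u Q) (hlaw : ∀ j, Q.map (u j) = ν)
    (hm : 2 * Fintype.card ι ≤ m)
    {S : Set U} (hS : MeasurableSet S) (hνS : ν S ≤ ENNReal.ofReal (1 / 4000)) :
    Q {ω | ¬ ∀ w : EuclideanSpace ℝ ι, m / 4000000 * ‖w‖ ^ 2 ≤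
      ∑ j, (Sᶜ.indicator (fun v => ∑ i, w i * a i v) (u j ω)) ^ 2} ≤
      ENNReal.ofReal (Real.exp (-m)) + ENNReal.ofReal ((1 / 2) ^ m) := by
  obtain ⟨N, hN1, hN2, hN3⟩ :=
    exists_sphere_net (EuclideanSpace ℝ ι) (by norm_num : (0:ℝ) < 1 / 16000)
  have hupper := measure_exists_quadratic_gt_le ha hu hind hlaw (σ := 1) (s := 1) one_pos
    (fun _ => zero_le_one) (fun _ => le_rfl) (by
      have : (2:ℝ) * Fintype.card ι ≤ m := by exact_mod_cast hm
      simp only [Pi.one_apply, Finset.sum_const, Finset.card_univ, nsmul_eq_mul, mul_one, one_mul]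
      linarith [(Fintype.card ι).cast_nonneg (α := ℝ)])
  have hsub : {ω | ¬ ∀ w : EuclideanSpace ℝ ι, m / 4000000 * ‖w‖ ^ 2 ≤
      ∑ j, (Sᶜ.indicator (fun v => ∑ i, w i * a i v) (u j ω)) ^ 2} ⊆
      {ω | ¬ ∀ θ : EuclideanSpace ℝ (Fin m),
        ∑ i, (1 : ι → ℝ) i * (∑ j, θ j * a i (u j ω)) ^ 2 ≤ 64 * 1 * m * ‖θ‖ ^ 2} ∪
      ⋃ w ∈ N, {ω | ∑ j, (Sᶜ.indicator (fun v => ∑ i, w i * a i v) (u j ω)) ^ 2 ≤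
        m / 1000000} := by
    intro ω hω
    by_contra hcon
    rw [Set.mem_union, not_or] at hcon
    obtain ⟨hup, hlow⟩ := hcon
    simp only [Set.mem_ofPred_eq, not_not, Pi.one_apply, one_mul] at hup
    simp only [Set.mem_iUnion, Set.mem_ofPred_eq, exists_prop, not_exists, not_and,
      not_le] at hlow
    apply hω
    let L := euclideanMap fun j i => Sᶜ.indicator (a i) (u j ω)
    have hLapp : ∀ (w : EuclideanSpace ℝ ι) j, ∑ i, Sᶜ.indicator (a i) (u j ω) * w i =
        Sᶜ.indicator (fun v => ∑ i, w i * a i v) (u j ω) := by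
      intro w j
      by_cases hj : u j ω ∈ S
      · simp [hj]
      · simp [hj, mul_comm]
    have hLn : ∀ w, ‖L w‖ ^ 2 =
        ∑ j, (Sᶜ.indicator (fun v => ∑ i, w i * a i v) (u j ω)) ^ 2 := by
      intro w
      rw [norm_euclideanMap_sq]
      exact Finset.sum_congr rfl fun j _ => by rw [hLapp]
    -- The matrix has operator norm at most `8 √m`, because its transpose has.
    have hLup : ∀ w, ‖L w‖ ≤ 8 * √m * ‖w‖ := by
      intro w
      have h1 : ‖L w‖ ^ 2 ≤ ∑ j, (∑ i, w i * a i (u j ω)) ^ 2 := by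
        rw [hLn]
        refine Finset.sum_le_sum fun j _ => ?_
        by_cases hj : u j ω ∈ S
        · simp only [Set.mem_compl_iff, hj, not_true_eq_false, not_false_eq_true,
            Set.indicator_of_notMem]
          nlinarith [sq_nonneg (∑ i, w i * a i (u j ω))]
        · simp [hj]
      let t : EuclideanSpace ℝ (Fin m) := WithLp.toLp 2 fun j => ∑ i, w i * a i (u j ω)
      have ht : ‖t‖ ^ 2 = ∑ j, (∑ i, w i * a i (u j ω)) ^ 2 := EuclideanSpace.real_norm_sq_eq t
      have h2 : ‖t‖ ^ 2 = ∑ i, w i * ∑ j, t j * a i (u j ω) := by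
        rw [ht]
        simp_rw [Finset.mul_sum]
        rw [Finset.sum_comm]
        refine Finset.sum_congr rfl fun j _ => ?_
        rw [sq]
        nth_rw 1 [Finset.sum_mul]
        refine Finset.sum_congr rfl fun i _ => ?_
        change _ = w i * ((∑ i, w i * a i (u j ω)) * a i (u j ω))
        ring
      have h3 := Finset.sum_mul_sq_le_sq_mul_sq Finset.univ w
        fun i => ∑ j, t j * a i (u j ω)
      rw [← h2, ← EuclideanSpace.real_norm_sq_eq] at h3
      have h4 := hup t
      have h5 : ‖t‖ ^ 2 * ‖t‖ ^ 2 ≤ (‖w‖ ^ 2 * (64 * m)) * ‖t‖ ^ 2 := by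
        calc ‖t‖ ^ 2 * ‖t‖ ^ 2 = (‖t‖ ^ 2) ^ 2 := by ring
          _ ≤ _ := h3
          _ ≤ ‖w‖ ^ 2 * (64 * m * ‖t‖ ^ 2) := by
            gcongr
            simpa using h4
          _ = _ := by ring
      have h6 : ‖t‖ ^ 2 ≤ ‖w‖ ^ 2 * (64 * m) := by
        rcases (sq_nonneg ‖t‖).eq_or_lt with h | h
        · rw [← h]; positivity
        · exact le_of_mul_le_mul_right h5 h
      rw [← ht] at h1
      refine le_of_sq_le_sq ?_ (by positivity)
      refine (h1.trans h6).trans (le_of_eq ?_)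
      rw [mul_pow, mul_pow, Real.sq_sqrt (by positivity)]
      ring
    -- The net has mesh `1 / 16000`, so passing to it changes `‖L w‖` by at most `√m / 2000`.
    have hunit : ∀ w : EuclideanSpace ℝ ι, ‖w‖ = 1 → √m / 2000 ≤ ‖L w‖ := by
      intro w hw
      obtain ⟨y, hy, hwy⟩ := hN2 w hw
      have h1 : √m / 1000 ≤ ‖L y‖ := by
        have := (hlow y hy).le
        rw [← hLn] at this
        refine le_of_sq_le_sq (le_trans (le_of_eq ?_) this) (norm_nonneg _)
        rw [div_pow, Real.sq_sqrt (by positivity)]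
        norm_num
      have h2 : ‖L y‖ ≤ ‖L w‖ + ‖L (w - y)‖ := by
        rw [map_sub]
        exact norm_le_norm_add_norm_sub _ _
      have h3 := hLup (w - y)
      have h4 : 8 * √m * ‖w - y‖ ≤ 8 * √m * (1 / 16000) := by gcongr
      linarith
    intro w
    rw [← hLn]
    rcases eq_or_ne w 0 with rfl | hw
    · simp
    have hwn : 0 < ‖w‖ := norm_pos_iff.2 hw
    have h1 := hunit (‖w‖⁻¹ • w) (by rw [norm_smul, norm_inv, norm_norm, inv_mul_cancel₀ hwn.ne'])
    rw [map_smul, norm_smul, norm_inv, norm_norm, inv_mul_eq_div, le_div_iff₀ hwn] at h1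
    calc (m : ℝ) / 4000000 * ‖w‖ ^ 2 = (√m / 2000 * ‖w‖) ^ 2 := by
          rw [mul_pow, div_pow, Real.sq_sqrt (by positivity)]; norm_num
      _ ≤ ‖L w‖ ^ 2 := by gcongr
  refine (measure_mono hsub).trans ((measure_union_le _ _).trans ?_)
  gcongr
  refine (measure_biUnion_finset_le _ _).trans ((Finset.sum_le_sum fun w hw =>
    measure_sum_indicator_sq_le ha hu hind hlaw hS hνS (hN1 w hw)).trans ?_)
  rw [Finset.sum_const, nsmul_eq_mul, ← ENNReal.ofReal_natCast,
    ← ENNReal.ofReal_mul (by positivity)]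
  apply ENNReal.ofReal_le_ofReal
  have he : Real.exp 1 < 2.7182818286 := Real.exp_one_lt_d9
  have he0 := Real.exp_pos 1
  obtain ⟨k, hk⟩ := Nat.exists_eq_add_of_le hm
  rw [finrank_euclideanSpace] at hN3
  set r := Fintype.card ι with hr
  calc (N.card : ℝ) * (Real.exp 1 / 1000) ^ m
      ≤ (1 + 2 / (1 / 16000)) ^ r * (Real.exp 1 / 1000) ^ m := by gcongr
    _ = ((1 + 2 / (1 / 16000)) * (Real.exp 1 / 1000) ^ 2) ^ r * (Real.exp 1 / 1000) ^ k := by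
        rw [hk, pow_add, pow_mul, mul_pow]; ring
    _ ≤ (1 / 4) ^ r * (1 / 2) ^ k := by
        have h1 : (1 + 2 / (1 / 16000)) * (Real.exp 1 / 1000) ^ 2 ≤ (1 / 4 : ℝ) := by
          have : Real.exp 1 ^ 2 ≤ 2.7182818286 ^ 2 := by gcongr
          rw [div_pow]
          norm_num at this ⊢
          linarith
        have h2 : Real.exp 1 / 1000 ≤ (1 / 2 : ℝ) := by linarith
        exact mul_le_mul (pow_le_pow_left₀ (by positivity) h1 _)
          (pow_le_pow_left₀ (by positivity) h2 _) (by positivity) (by positivity)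
    _ = (1 / 2) ^ m := by
        rw [hk, pow_add, pow_mul]; norm_num

end RandomMatrix

/-- A matrix whose transpose is bounded below by `c` has a right inverse of norm at most `c⁻¹`,
whose range consists of combinations of its rows. -/
lemma exists_min_norm_preimage {ι κ : Type*} [Fintype ι] [Fintype κ] (B : κ → ι → ℝ) {c : ℝ}
    (hc : 0 < c) (hB : ∀ w : EuclideanSpace ℝ ι, c ^ 2 * ‖w‖ ^ 2 ≤ ∑ k, (∑ i, w i * B k i) ^ 2)
    (w : EuclideanSpace ℝ ι) :
    ∃ v : EuclideanSpace ℝ ι, ∃ θ : EuclideanSpace ℝ κ, (∀ k, θ k = ∑ i, v i * B k i) ∧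
      (∀ i, ∑ k, θ k * B k i = w i) ∧ c * ‖θ‖ ≤ ‖w‖ := by
  let L := euclideanMap B
  have hLn : ∀ v, c * ‖v‖ ≤ ‖L v‖ := fun v => by
    refine le_of_sq_le_sq ?_ (norm_nonneg _)
    rw [norm_euclideanMap_sq, mul_pow]
    refine (hB v).trans (le_of_eq (Finset.sum_congr rfl fun k _ => ?_))
    simp_rw [mul_comm]
  -- The preimage of least norm is `L v`, where `v` solves the normal equations `Lᵀ L v = w`.
  let T : EuclideanSpace ℝ ι →ₗ[ℝ] EuclideanSpace ℝ ι := (L.adjoint ∘L L).toLinearMap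
  have hT : ∀ v x, inner ℝ (T v) x = inner ℝ (L v) (L x) := fun v x =>
    ContinuousLinearMap.adjoint_inner_left L x (L v)
  have hinj : Function.Injective T := by
    rw [injective_iff_map_eq_zero]
    intro v hv
    have h := hT v v
    rw [hv, inner_zero_left, real_inner_self_eq_norm_sq] at h
    have h1 : ‖L v‖ = 0 := by simpa using h.symm
    have h2 := hLn v
    rw [h1] at h2
    have : ‖v‖ ≤ 0 := by
      by_contra hcon
      push Not at hcon
      nlinarith
    exact norm_le_zero_iff.1 this
  obtain ⟨v, hv⟩ := LinearMap.injective_iff_surjective.1 hinj w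
  refine ⟨v, L v, fun k => ?_, fun i => ?_, ?_⟩
  · rw [euclideanMap_apply]
    simp_rw [mul_comm]
  · classical
    have h := hT v (EuclideanSpace.single i 1)
    rw [hv, EuclideanSpace.inner_single_right] at h
    simp only [one_mul, PiLp.inner_apply] at h
    have h2 : ∀ k, L (EuclideanSpace.single i 1) k = B k i := fun k => by
      rw [euclideanMap_apply]
      simp
    simp only [h2] at h
    simpa [mul_comm] using h.symm
  · have h := hT v v
    rw [hv, real_inner_self_eq_norm_sq] at h
    have h1 := real_inner_le_norm w v
    have h2 := hLn v
    rcases (norm_nonneg (L v)).eq_or_lt with h0 | h0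
    · rw [← h0]; simp
    · refine le_of_mul_le_mul_right ?_ h0
      nlinarith [norm_nonneg w]

/-! ### Sections of jointly measurable functions as elements of `L²` -/

section SectionLp

variable {U Z : Type*} [MeasurableSpace Z] {P : Measure Z}

open Classical in
/-- The class in `L²(P)` of the section `f u` of a function of two variables; it is `0` when this
section is not square integrable. -/
def sectionLp (P : Measure Z) (f : U → Z → ℝ) (u : U) : Lp ℝ 2 P :=
  if h : MemLp (f u) 2 P then h.toLp (f u) else 0

lemma sectionLp_of_memLp {f : U → Z → ℝ} {u : U} (h : MemLp (f u) 2 P) :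
    sectionLp P f u = h.toLp (f u) := dif_pos h

lemma coeFn_sectionLp {f : U → Z → ℝ} {u : U} (h : MemLp (f u) 2 P) :
    sectionLp P f u =ᵐ[P] f u := by
  rw [sectionLp_of_memLp h]
  exact h.coeFn_toLp

lemma inner_sectionLp {f : U → Z → ℝ} {u : U} (h : MemLp (f u) 2 P) (φ : Lp ℝ 2 P) :
    inner ℝ φ (sectionLp P f u) = ∫ z, φ z * f u z ∂P := by
  rw [L2.inner_def]
  refine integral_congr_ae ?_
  filter_upwards [coeFn_sectionLp h] with z hz
  simp [hz, mul_comm]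

variable [MeasurableSpace U]

lemma memLp_section_indicator [IsFiniteMeasure P] {S : Set (U × Z)} (hS : MeasurableSet S) (u : U) :
    MemLp (fun z => S.indicator (1 : U × Z → ℝ) (u, z)) 2 P := by
  have h := memLp_indicator_const (μ := P) 2 (measurable_prodMk_left hS : MeasurableSet
    (Prod.mk u ⁻¹' S)) (1 : ℝ) (Or.inr (measure_ne_top _ _))
  exact h

lemma stronglyMeasurable_sectionLp_indicator [IsFiniteMeasure P] {S : Set (U × Z)}
    (hS : MeasurableSet S) :
    StronglyMeasurable (sectionLp P fun u z => S.indicator (1 : U × Z → ℝ) (u, z)) := by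
  induction S, hS using MeasurableSpace.induction_on_inter generateFrom_prod.symm
    isPiSystem_prod with
  | empty =>
    have : sectionLp P (fun (u : U) z => (∅ : Set (U × Z)).indicator (1 : U × Z → ℝ) (u, z)) =
        fun _ => 0 := by
      ext1 u
      rw [sectionLp_of_memLp (memLp_section_indicator .empty u)]
      simp only [Set.indicator_empty]
      exact MemLp.toLp_zero _
    rw [this]
    exact stronglyMeasurable_const
  | basic S hS =>
    obtain ⟨A, hA, B, hB, rfl⟩ := hS
    have : sectionLp P (fun (u : U) z => (A ×ˢ B).indicator (1 : U × Z → ℝ) (u, z)) =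
        A.indicator fun _ => indicatorConstLp 2 hB (measure_ne_top P B) 1 := by
      ext1 u
      rw [sectionLp_of_memLp (memLp_section_indicator (hA.prod hB) u)]
      by_cases hu : u ∈ A
      · rw [Set.indicator_of_mem hu, indicatorConstLp]
        congr 1
        ext z
        by_cases hz : z ∈ B <;> simp [hu, hz]
      · rw [Set.indicator_of_notMem hu]
        simp only [Set.indicator, Set.mem_prod, hu, false_and, if_false]
        exact MemLp.toLp_zero _
    rw [this]
    exact stronglyMeasurable_const.indicator hA
  | compl S hS ih =>
    have : sectionLp P (fun (u : U) z => Sᶜ.indicator (1 : U × Z → ℝ) (u, z)) =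
        fun u => (memLp_const (1 : ℝ)).toLp (fun _ => 1) -
          sectionLp P (fun u z => S.indicator (1 : U × Z → ℝ) (u, z)) u := by
      ext1 u
      rw [sectionLp_of_memLp (memLp_section_indicator hS.compl u),
        sectionLp_of_memLp (memLp_section_indicator hS u), ← MemLp.toLp_sub]
      congr 1
      ext z
      by_cases hz : (u, z) ∈ S <;> simp [hz]
    rw [this]
    exact stronglyMeasurable_const.sub ih
  | iUnion S hdisj hS ih =>
    refine stronglyMeasurable_of_tendsto (f := fun n u => ∑ k ∈ Finset.range n,
      sectionLp P (fun u z => (S k).indicator (1 : U × Z → ℝ) (u, z)) u) atTop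
      (fun n => Finset.stronglyMeasurable_fun_sum _ fun k _ => ih k) ?_
    rw [tendsto_pi_nhds]
    intro u
    have hm : ∀ n, MemLp (fun z => ∑ k ∈ Finset.range n,
        (S k).indicator (1 : U × Z → ℝ) (u, z)) 2 P := fun n =>
      memLp_finsetSum _ fun k _ => memLp_section_indicator (hS k) u
    have h1 : ∀ n, ∑ k ∈ Finset.range n,
        sectionLp P (fun u z => (S k).indicator (1 : U × Z → ℝ) (u, z)) u =
        (hm n).toLp _ := by
      intro n
      induction n with
      | zero =>
        simp only [Finset.range_zero, Finset.sum_empty]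
        exact (MemLp.toLp_zero _).symm
      | succ n ihn =>
        rw [Finset.sum_range_succ, ihn, sectionLp_of_memLp (memLp_section_indicator (hS n) u),
          ← MemLp.toLp_add]
        congr 1
        ext z
        simp [Finset.sum_range_succ]
    simp only [h1]
    rw [sectionLp_of_memLp (memLp_section_indicator (P := P) (.iUnion hS) u)]
    rw [Lp.tendsto_Lp_iff_tendsto_eLpNorm'']
    have hle : ∀ n z, ‖∑ k ∈ Finset.range n, (S k).indicator (1 : U × Z → ℝ) (u, z)‖ ≤ 1 := by
      intro n z
      rw [← Finset.indicator_biUnion_apply]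
      · by_cases hz : (u, z) ∈ ⋃ i ∈ Finset.range n, S i
        · rw [Set.indicator_of_mem hz]; simp
        · rw [Set.indicator_of_notMem hz]; simp
      · exact fun i _ j _ hij => hdisj hij
    refine tendsto_Lp_finite_of_tendsto_ae one_le_two ENNReal.ofNat_ne_top (fun n => (hm n).1)
      (memLp_section_indicator (.iUnion hS) u) ?_ ?_
    · refine unifIntegrable_of one_le_two ENNReal.ofNat_ne_top (fun n => (hm n).1) fun ε hε =>
        ⟨2, fun n => ?_⟩
      have : {x | (2 : ℝ≥0) ≤ ‖∑ k ∈ Finset.range n,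
          (S k).indicator (1 : U × Z → ℝ) (u, x)‖₊} = ∅ := by
        ext z
        have := hle n z
        simp only [Set.mem_ofPred_eq, Set.mem_empty_iff_false, iff_false, not_le]
        rw [← NNReal.coe_lt_coe, coe_nnnorm]
        exact this.trans_lt (by norm_num)
      rw [this]
      simp
    · refine ae_of_all _ fun z => ?_
      by_cases hz : (u, z) ∈ ⋃ k, S k
      · obtain ⟨k, hk⟩ := Set.mem_iUnion.1 hz
        refine tendsto_const_nhds.congr' ?_
        filter_upwards [eventually_gt_atTop k] with n hn
        rw [Set.indicator_of_mem hz, Finset.sum_eq_single_of_mem k (Finset.mem_range.2 hn),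
          Set.indicator_of_mem hk]
        intro l _ hl
        exact Set.indicator_of_notMem
          (fun hl' => (Set.disjoint_left.1 (hdisj hl) hl') hk) _
      · refine tendsto_const_nhds.congr fun n => ?_
        rw [Set.indicator_of_notMem hz, Finset.sum_eq_zero]
        exact fun l _ => Set.indicator_of_notMem
          (fun hl => hz (Set.mem_iUnion.2 ⟨l, hl⟩)) _

lemma memLp_section_simpleFunc [IsFiniteMeasure P] (F : SimpleFunc (U × Z) ℝ) (u : U) :
    MemLp (fun z => F (u, z)) 2 P := by
  have := (F.comp (Prod.mk u) measurable_prodMk_left).memLp_of_isFiniteMeasure 2 P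
  exact this

lemma stronglyMeasurable_sectionLp_simpleFunc [IsFiniteMeasure P] (F : SimpleFunc (U × Z) ℝ) :
    StronglyMeasurable (sectionLp P fun u z => F (u, z)) := by
  induction F using SimpleFunc.induction with
  | const c hS =>
    rename_i S
    have : sectionLp P (fun (u : U) z => (SimpleFunc.piecewise S hS (SimpleFunc.const _ c)
        (SimpleFunc.const _ 0)) (u, z)) =
        fun u => c • sectionLp P (fun u z => S.indicator (1 : U × Z → ℝ) (u, z)) u := by
      ext1 u
      rw [sectionLp_of_memLp (memLp_section_simpleFunc _ u),
        sectionLp_of_memLp (memLp_section_indicator hS u), ← MemLp.toLp_const_smul]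
      congr 1
      ext z
      by_cases hz : (u, z) ∈ S <;> simp [hz]
    rw [this]
    exact (stronglyMeasurable_sectionLp_indicator hS).const_smul c
  | add _ hF hG =>
    rename_i F G _
    have : sectionLp P (fun (u : U) z => (F + G) (u, z)) =
        sectionLp P (fun u z => F (u, z)) + sectionLp P (fun u z => G (u, z)) := by
      ext1 u
      rw [Pi.add_apply, sectionLp_of_memLp (memLp_section_simpleFunc _ u),
        sectionLp_of_memLp (memLp_section_simpleFunc F u),
        sectionLp_of_memLp (memLp_section_simpleFunc G u), ← MemLp.toLp_add]
      rfl
    rw [this]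
    exact hF.add hG

lemma measurableSet_memLp_section [SFinite P] {f : U → Z → ℝ}
    (hf : Measurable (Function.uncurry f)) : MeasurableSet {u | MemLp (f u) 2 P} := by
  have h : {u | MemLp (f u) 2 P} = {u | ∫⁻ z, ‖f u z‖ₑ ^ 2 ∂P < ∞} := by
    ext u
    have hfu : Measurable (f u) := hf.comp measurable_prodMk_left
    simp only [Set.mem_ofPred_eq, MemLp, hfu.aestronglyMeasurable, true_and]
    rw [eLpNorm_lt_top_iff_lintegral_rpow_enorm_lt_top (by norm_num) (by norm_num)]
    simp
  rw [h]
  exact measurableSet_lt (hf.enorm.pow_const 2).lintegral_prod_right' measurable_const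

/-- The sections of a jointly measurable function form a strongly measurable map into `L²(P)`; in
particular they stay in a separable subspace, although `L²(P)` need not be separable. -/
lemma stronglyMeasurable_sectionLp [IsFiniteMeasure P] {f : U → Z → ℝ}
    (hf : Measurable (Function.uncurry f)) : StronglyMeasurable (sectionLp P f) := by
  classical
  set S := {u | MemLp (f u) 2 P} with hSdef
  have hS : MeasurableSet S := measurableSet_memLp_section hf
  let F : ℕ → SimpleFunc (U × Z) ℝ := fun n =>
    SimpleFunc.approxOn (Function.uncurry f) hf Set.univ 0 (Set.mem_univ _) n
  refine stronglyMeasurable_of_tendsto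
    (f := fun n => S.indicator (sectionLp P fun u z => F n (u, z))) atTop
    (fun n => (stronglyMeasurable_sectionLp_simpleFunc (F n)).indicator hS) ?_
  rw [tendsto_pi_nhds]
  intro u
  by_cases hu : u ∈ S
  · have hu' : MemLp (f u) 2 P := hu
    simp only [Set.indicator_of_mem hu]
    rw [sectionLp_of_memLp hu']
    have h1 : ∀ n, sectionLp P (fun u z => F n (u, z)) u =
        (memLp_section_simpleFunc (F n) u).toLp _ := fun n =>
      sectionLp_of_memLp (f := fun u z => F n (u, z)) (memLp_section_simpleFunc (F n) u)
    simp_rw [h1]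
    rw [Lp.tendsto_Lp_iff_tendsto_eLpNorm'']
    have := SimpleFunc.tendsto_approxOn_Lp_eLpNorm (p := 2) (μ := P)
      (hf.comp measurable_prodMk_left : Measurable (f u)) (Set.mem_univ (0 : ℝ)) (by norm_num)
      (by simp) (by simpa using hu'.2)
    exact this
  · have : sectionLp P f u = 0 := dif_neg hu
    simp [Set.indicator_of_notMem hu, this]

end SectionLp

/-! ### Integrals of a Gaussian process against square integrable functions -/

lemma coeFn_finsetSum_Lp {α ι : Type*} [MeasurableSpace α] {μ : Measure α} (s : Finset ι)
    (f : ι → Lp ℝ 2 μ) : ⇑(∑ i ∈ s, f i) =ᵐ[μ] fun x => ∑ i ∈ s, f i x := by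
  filter_upwards [Lp.coeFn_finsetSum s f] with x hx
  rw [hx, Finset.sum_apply]

section GaussianSpace

variable {U : Type*} [MeasurableSpace U] {ν : Measure U} [IsProbabilityMeasure ν]

lemma continuous_integral_cexp (t : ℝ) :
    Continuous fun x : Lp ℝ 2 ν => ∫ u, Complex.exp (t * x u * Complex.I) ∂ν := by
  have hint : ∀ x : Lp ℝ 2 ν, Integrable (fun u => Complex.exp (t * x u * Complex.I)) ν := by
    intro x
    have hx := (Lp.stronglyMeasurable x).measurable
    refine Integrable.of_bound (C := 1) (Measurable.aestronglyMeasurable (by fun_prop)) ?_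
    refine ae_of_all _ fun u => ?_
    rw [← Complex.ofReal_mul, Complex.norm_exp_ofReal_mul_I]
  refine LipschitzWith.continuous (K := ‖t‖₊) (LipschitzWith.of_dist_le_mul fun x y => ?_)
  rw [dist_eq_norm, ← integral_sub (hint x) (hint y), dist_eq_norm]
  have hpt : ∀ a b : ℝ, ‖Complex.exp (t * a * Complex.I) - Complex.exp (t * b * Complex.I)‖ ≤
      |t| * |a - b| := by
    intro a b
    have h1 : Complex.exp (t * a * Complex.I) = Complex.exp (t * b * Complex.I) *
        Complex.exp (Complex.I * ((t * (a - b) : ℝ) : ℂ)) := by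
      rw [← Complex.exp_add]; congr 1; push_cast; ring
    rw [h1, ← mul_sub_one, norm_mul, ← Complex.ofReal_mul, Complex.norm_exp_ofReal_mul_I, one_mul,
      ← abs_mul]
    exact Real.norm_exp_I_mul_ofReal_sub_one_le
  have hxy : MemLp (fun u => (x - y) u) 2 ν := Lp.memLp (x - y)
  calc ‖∫ u, (Complex.exp (t * x u * Complex.I) - Complex.exp (t * y u * Complex.I)) ∂ν‖
      ≤ ∫ u, |t| * ‖(x - y) u‖ ∂ν := by
        refine norm_integral_le_of_norm_le ((hxy.integrable one_le_two).norm.const_mul _) ?_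
        filter_upwards [Lp.coeFn_sub x y] with u hu
        rw [hu]
        exact hpt _ _
    _ = |t| * ∫ u, ‖(x - y) u‖ ∂ν := integral_const_mul _ _
    _ ≤ |t| * ‖x - y‖ := by
        gcongr
        have h1 := eLpNorm_le_eLpNorm_of_exponent_le (μ := ν) one_le_two hxy.1
        rw [eLpNorm_one_eq_lintegral_enorm] at h1
        rw [integral_norm_eq_lintegral_enorm hxy.1, Lp.norm_def]
        exact ENNReal.toReal_mono hxy.2.ne h1
    _ = ‖t‖₊ * ‖x - y‖ := by rw [coe_nnnorm, Real.norm_eq_abs]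

/-- The centred Gaussian variables form a closed subset of `L²`: the characteristic function and the
variance are continuous. -/
lemma isClosed_gaussian : IsClosed {x : Lp ℝ 2 ν | ∀ t : ℝ,
    ∫ u, Complex.exp (t * x u * Complex.I) ∂ν = Complex.exp (-(‖x‖ ^ 2 * t ^ 2 / 2))} := by
  simp only [Set.ofPred_forall]
  refine isClosed_iInter fun t => isClosed_eq (continuous_integral_cexp t) ?_
  fun_prop

lemma map_eq_gaussianReal_of_integral_cexp {X : U → ℝ} (hX : AEMeasurable X ν) {v : ℝ≥0}
    (h : ∀ t : ℝ, ∫ u, Complex.exp (t * X u * Complex.I) ∂ν = Complex.exp (-(v * t ^ 2 / 2))) :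
    ν.map X = gaussianReal 0 v := by
  have := Measure.isProbabilityMeasure_map hX
  apply Measure.ext_of_charFun
  ext t
  rw [charFun_gaussianReal, charFun_apply_real, integral_map hX (by fun_prop), h]
  simp

end GaussianSpace

namespace IsBoundedGPPrior

variable {Z U : Type*} [MeasurableSpace Z] [MeasurableSpace U] {k : Z → Z → ℝ} {P : Measure Z}
  {ν : Measure U} {g : U → Z → ℝ} {B : ℝ}

lemma memLp_eval (hg : IsBoundedGPPrior k P ν g) (z : Z) : MemLp (fun u => g u z) 2 ν :=
  (hg.gaussian.hasGaussianLaw_eval z).memLp_two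

/-- The class of the value of the process at the point `z` in the Gaussian Hilbert space. -/
def evalLp (hg : IsBoundedGPPrior k P ν g) (z : Z) : Lp ℝ 2 ν := (hg.memLp_eval z).toLp _

lemma coeFn_evalLp (hg : IsBoundedGPPrior k P ν g) (z : Z) :
    hg.evalLp z =ᵐ[ν] fun u => g u z := (hg.memLp_eval z).coeFn_toLp

variable [IsProbabilityMeasure P]

lemma ae_memLp (hg : IsBoundedGPPrior k P ν g) : ∀ᵐ u ∂ν, MemLp (g u) 2 P := by
  filter_upwards [hg.sup_norm] with u hu
  have h : MemLp (g u) ∞ P :=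
    ⟨(hg.measurable.comp measurable_prodMk_left).aestronglyMeasurable, hu⟩
  exact h.mono_exponent le_top

lemma stronglyMeasurable_section (hg : IsBoundedGPPrior k P ν g) :
    StronglyMeasurable (sectionLp P g) := stronglyMeasurable_sectionLp hg.measurable

lemma measurable_inner (hg : IsBoundedGPPrior k P ν g) (φ : Lp ℝ 2 P) :
    Measurable fun u => (inner ℝ φ (sectionLp P g u) : ℝ) :=
  ((innerSL ℝ φ).continuous.comp_stronglyMeasurable hg.stronglyMeasurable_section).measurable

variable [IsProbabilityMeasure ν]

lemma integrable_mul_mul (hg : IsBoundedGPPrior k P ν g) (hB : ∀ z z', |k z z'| ≤ B) (α : Lp ℝ 2 ν)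
    (φ : Lp ℝ 2 P) :
    Integrable (Function.uncurry fun u z => α u * (φ z * g u z)) (ν.prod P) := by
  have hα := (Lp.stronglyMeasurable α).measurable
  have hφ := (Lp.stronglyMeasurable φ).measurable
  have hgm := hg.measurable
  have hm : Measurable (Function.uncurry fun u z => α u * (φ z * g u z)) :=
    (hα.comp measurable_fst).mul ((hφ.comp measurable_snd).mul hgm)
  rw [integrable_prod_iff' hm.aestronglyMeasurable]
  have hz : ∀ z, Integrable (fun u => α u * g u z) ν := fun z =>
    (Lp.memLp α).integrable_mul (hg.memLp_eval z)
  refine ⟨ae_of_all _ fun z => ?_, ?_⟩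
  · refine ((hz z).const_mul (φ z)).congr (ae_of_all _ fun u => ?_)
    simp only [Function.uncurry_apply_pair]; ring
  · have hB0 : ∀ z, ∫ u, ‖α u * g u z‖ ∂ν ≤ ‖α‖ * √B := by
      intro z
      have h1 := integral_mul_le_Lp_mul_Lq_of_nonneg (μ := ν) (p := 2) (q := 2)
        (f := fun u => ‖α u‖) (g := fun u => ‖g u z‖) Real.HolderConjugate.two_two
        (ae_of_all _ fun _ => norm_nonneg _) (ae_of_all _ fun _ => norm_nonneg _)
        (by simpa using (Lp.memLp α).norm) (by simpa using (hg.memLp_eval z).norm)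
      have h2 : (∫ u, ‖α u‖ ^ (2:ℝ) ∂ν) ^ (1 / (2:ℝ)) = ‖α‖ := by
        rw [← Real.sqrt_eq_rpow, ← Real.sqrt_sq (norm_nonneg α), ← real_inner_self_eq_norm_sq,
          L2.inner_def]
        congr 1
        refine integral_congr_ae (ae_of_all _ fun u => ?_)
        simp [sq]
      have h3 : (∫ u, ‖g u z‖ ^ (2:ℝ) ∂ν) ^ (1 / (2:ℝ)) = √(k z z) := by
        rw [← Real.sqrt_eq_rpow, ← hg.covariance z z]
        congr 1
        refine integral_congr_ae (ae_of_all _ fun u => ?_)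
        simp [sq]
      rw [h2, h3] at h1
      simp_rw [norm_mul]
      refine h1.trans ?_
      gcongr
      exact (le_abs_self _).trans (hB z z)
    have hφi : Integrable (fun z => ‖α‖ * √B * ‖φ z‖) P :=
      ((Lp.memLp φ).integrable one_le_two).norm.const_mul _
    refine hφi.mono' (hm.norm.comp measurable_swap).aestronglyMeasurable.integral_prod_right'
      (ae_of_all _ fun z => ?_)
    · rw [Real.norm_of_nonneg (integral_nonneg fun _ => norm_nonneg _)]
      have : ∀ u, ‖Function.uncurry (fun u z => α u * (φ z * g u z)) (u, z)‖ =
          ‖φ z‖ * ‖α u * g u z‖ := fun u => by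
        rw [Function.uncurry_apply_pair, ← norm_mul]; congr 1; ring
      simp_rw [this]
      rw [integral_const_mul, mul_comm]
      gcongr
      exact hB0 z

/-- Fubini's theorem for the mixed moments of an integral of the process against `φ`. -/
lemma integral_mul_inner (hg : IsBoundedGPPrior k P ν g) (hB : ∀ z z', |k z z'| ≤ B)
    (α : Lp ℝ 2 ν) (φ : Lp ℝ 2 P) :
    ∫ u, α u * inner ℝ φ (sectionLp P g u) ∂ν = ∫ z, φ z * ∫ u, α u * g u z ∂ν ∂P := by
  have h := integral_integral_swap (hg.integrable_mul_mul hB α φ)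
  have h1 : ∀ z, ∫ u, α u * (φ z * g u z) ∂ν = φ z * ∫ u, α u * g u z ∂ν := fun z => by
    rw [← integral_const_mul]; congr 1; ext u; ring
  simp_rw [h1, integral_const_mul] at h
  rw [← h]
  refine integral_congr_ae ?_
  filter_upwards [hg.ae_memLp] with u hu
  rw [inner_sectionLp hu]

lemma memLp_sectionLp (hg : IsBoundedGPPrior k P ν g) (hB : ∀ z z', |k z z'| ≤ B) :
    MemLp (sectionLp P g) 2 ν := by
  refine ⟨hg.stronglyMeasurable_section.aestronglyMeasurable, ?_⟩
  rw [eLpNorm_lt_top_iff_lintegral_rpow_enorm_lt_top (by norm_num) (by norm_num)]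
  have h1 : ∀ᵐ u ∂ν, ‖sectionLp P g u‖ₑ ^ (2 : ℝ≥0∞).toReal = ∫⁻ z, ‖g u z‖ₑ ^ 2 ∂P := by
    filter_upwards [hg.ae_memLp] with u hu
    rw [sectionLp_of_memLp hu, Lp.enorm_toLp,
      eLpNorm_eq_lintegral_rpow_enorm_toReal (by norm_num) (by norm_num)]
    rw [← ENNReal.rpow_mul]
    simp
  rw [lintegral_congr_ae h1,
    lintegral_lintegral_swap (hg.measurable.enorm.pow_const 2).aemeasurable]
  have h2 : ∀ z, ∫⁻ u, ‖g u z‖ₑ ^ 2 ∂ν ≤ ENNReal.ofReal B := by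
    intro z
    have h3 : ∀ u, ‖g u z‖ₑ ^ 2 = ENNReal.ofReal (g u z * g u z) := fun u => by
      rw [← enorm_pow, Real.enorm_of_nonneg (by positivity), sq]
    simp_rw [h3]
    have h4 : Integrable (fun u => g u z * g u z) ν :=
      (hg.memLp_eval z).integrable_mul (hg.memLp_eval z)
    rw [← ofReal_integral_eq_lintegral_ofReal h4 (ae_of_all _ fun u => mul_self_nonneg _),
      hg.covariance]
    exact ENNReal.ofReal_le_ofReal ((le_abs_self _).trans (hB z z))
  calc ∫⁻ z, ∫⁻ u, ‖g u z‖ₑ ^ 2 ∂ν ∂P ≤ ∫⁻ _, ENNReal.ofReal B ∂P := lintegral_mono h2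
    _ < ∞ := by simp

lemma memLp_inner (hg : IsBoundedGPPrior k P ν g) (hB : ∀ z z', |k z z'| ≤ B) (φ : Lp ℝ 2 P) :
    MemLp (fun u => (inner ℝ φ (sectionLp P g u) : ℝ)) 2 ν :=
  (innerSL ℝ φ).comp_memLp' (hg.memLp_sectionLp hB)

/-- The covariance of the integrals of the process is the quadratic form of the integral
operator. -/
lemma integral_inner_mul_inner (hg : IsBoundedGPPrior k P ν g) (hB : ∀ z z', |k z z'| ≤ B)
    (φ φ' : Lp ℝ 2 P) :
    ∫ u, inner ℝ φ (sectionLp P g u) * inner ℝ φ' (sectionLp P g u) ∂ν =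
      ∫ z, φ' z * ∫ z', k z z' * φ z' ∂P ∂P := by
  have h := hg.integral_mul_inner hB ((hg.memLp_inner hB φ).toLp _) φ'
  have hae := (hg.memLp_inner hB φ).coeFn_toLp
  rw [integral_congr_ae (g := fun u => inner ℝ φ (sectionLp P g u) *
    inner ℝ φ' (sectionLp P g u)) (by filter_upwards [hae] with u hu; rw [hu])] at h
  rw [h]
  congr 1
  ext z
  congr 1
  have h2 := hg.integral_mul_inner hB (hg.evalLp z) φ
  rw [integral_congr_ae (g := fun u => inner ℝ φ (sectionLp P g u) * g u z)
    (by filter_upwards [hae] with u hu; rw [hu]),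
    integral_congr_ae (g := fun u => hg.evalLp z u * inner ℝ φ (sectionLp P g u))
    (by filter_upwards [hg.coeFn_evalLp z] with u hu; rw [hu, mul_comm]), h2]
  congr 1
  ext z'
  rw [mul_comm, ← hg.covariance z z']
  congr 1
  refine integral_congr_ae ?_
  filter_upwards [hg.coeFn_evalLp z] with u hu
  rw [hu]

/-- The integral of the process against `φ` lies in the closed linear span of the values of the
process, because it is orthogonal to everything that is orthogonal to them; so it is Gaussian. -/
lemma map_inner_eq_gaussianReal (hg : IsBoundedGPPrior k P ν g) (hB : ∀ z z', |k z z'| ≤ B)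
    (φ : Lp ℝ 2 P) :
    ν.map (fun u => (inner ℝ φ (sectionLp P g u) : ℝ)) =
      gaussianReal 0 (∫ u, (inner ℝ φ (sectionLp P g u) : ℝ) ^ 2 ∂ν).toNNReal := by
  set x : Lp ℝ 2 ν := (hg.memLp_inner hB φ).toLp _ with hx
  have hxae : x =ᵐ[ν] fun u => (inner ℝ φ (sectionLp P g u) : ℝ) :=
    (hg.memLp_inner hB φ).coeFn_toLp
  let M : Submodule ℝ (Lp ℝ 2 ν) := Submodule.span ℝ (Set.range hg.evalLp)
  have hmem : x ∈ M.topologicalClosure := by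
    rw [← Submodule.orthogonal_orthogonal_eq_closure, Submodule.mem_orthogonal]
    intro α hα
    have h1 : ∀ z, ∫ u, α u * g u z ∂ν = 0 := by
      intro z
      have h2 := (Submodule.mem_orthogonal' _ _).1 hα (hg.evalLp z)
        (Submodule.subset_span ⟨z, rfl⟩)
      rw [L2.inner_def] at h2
      rw [← h2]
      refine integral_congr_ae ?_
      filter_upwards [hg.coeFn_evalLp z] with u hu
      simp [hu, mul_comm]
    have h3 := hg.integral_mul_inner hB α φ
    simp only [h1, mul_zero, integral_zero] at h3
    rw [L2.inner_def, ← h3]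
    refine integral_congr_ae ?_
    filter_upwards [hxae] with u hu
    simp [hu, mul_comm]
  have hspan : (M : Set (Lp ℝ 2 ν)) ⊆ {x : Lp ℝ 2 ν | ∀ t : ℝ,
      ∫ u, Complex.exp (t * x u * Complex.I) ∂ν = Complex.exp (-(‖x‖ ^ 2 * t ^ 2 / 2))} := by
    intro y hy t
    obtain ⟨c, rfl⟩ := Finsupp.mem_span_range_iff_exists_finsupp.1 hy
    set y := c.sum fun z a => a • hg.evalLp z with hydef
    let Y : U → ℝ := fun u => ∑ z ∈ c.support, c z • g u z
    have hY : HasGaussianLaw Y ν := (hg.gaussian.smul c).hasGaussianLaw_fun_sum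
    have hyY : y =ᵐ[ν] Y := by
      have h1 : y =ᵐ[ν] fun u => ∑ z ∈ c.support, (c z • hg.evalLp z : Lp ℝ 2 ν) u := by
        rw [hydef, Finsupp.sum]
        exact coeFn_finsetSum_Lp _ _
      have h2 : ∀ᵐ u ∂ν, ∀ z ∈ c.support, (c z • hg.evalLp z : Lp ℝ 2 ν) u = c z • g u z := by
        refine (Filter.eventually_all_finset c.support).2 fun z _ => ?_
        filter_upwards [Lp.coeFn_smul (c z) (hg.evalLp z), hg.coeFn_evalLp z] with u h1 h2
        rw [h1, Pi.smul_apply, h2]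
      filter_upwards [h1, h2] with u h1 h2
      rw [h1]
      exact Finset.sum_congr rfl h2
    have hmean : ∫ u, Y u ∂ν = 0 := by
      rw [integral_finsetSum]
      · refine Finset.sum_eq_zero fun z _ => ?_
        rw [integral_smul, hg.mean_zero, smul_zero]
      · exact fun z _ => ((hg.memLp_eval z).integrable one_le_two).smul (c z)
    have hnorm : ‖y‖ ^ 2 = ∫ u, Y u ^ 2 ∂ν := by
      rw [← real_inner_self_eq_norm_sq, L2.inner_def]
      refine integral_congr_ae ?_
      filter_upwards [hyY] with u hu
      simp [hu, sq]
    have hchar := hY.charFun_map_eq t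
    rw [charFun_apply_real, integral_map hY.aemeasurable (by fun_prop)] at hchar
    have h1 : ∫ u, Complex.exp (t * y u * Complex.I) ∂ν =
        ∫ u, Complex.exp (t * Y u * Complex.I) ∂ν := by
      refine integral_congr_ae ?_
      filter_upwards [hyY] with u hu
      rw [hu]
    rw [h1, hchar]
    have h2 : (fun u => (inner ℝ t (Y u) : ℝ)) = fun u => t * Y u := by
      ext u; simp [mul_comm]
    simp only [h2]
    rw [variance_const_mul, variance_of_integral_eq_zero hY.aemeasurable hmean,
      integral_const_mul, hmean, ← Complex.ofReal_pow ‖y‖, hnorm]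
    congr 1
    push_cast
    ring
  have hcl := closure_minimal hspan isClosed_gaussian
  have hxG := hcl hmem
  have hnorm : ‖x‖ ^ 2 = ∫ u, (inner ℝ φ (sectionLp P g u) : ℝ) ^ 2 ∂ν := by
    rw [← real_inner_self_eq_norm_sq, L2.inner_def]
    refine integral_congr_ae ?_
    filter_upwards [hxae] with u hu
    simp [hu, sq]
  refine map_eq_gaussianReal_of_integral_cexp (hg.measurable_inner φ).aemeasurable fun t => ?_
  have h := hxG t
  rw [← integral_congr_ae (f := fun u => Complex.exp (t * x u * Complex.I))
    (by filter_upwards [hxae] with u hu; rw [hu]), h,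
    Real.coe_toNNReal _ (integral_nonneg fun u => sq_nonneg _), ← hnorm]
  push_cast
  rfl

end IsBoundedGPPrior

/-! ### Expansion of the draws in the eigenfunctions -/

section Hilbert

variable {E I : Type*} [NormedAddCommGroup E] [InnerProductSpace ℝ E] {e : I → E}

lemma norm_sum_inner_smul_sq (he : Orthonormal ℝ e) (s : Finset I) (c : I → ℝ) :
    ‖∑ i ∈ s, c i • e i‖ ^ 2 = ∑ i ∈ s, c i ^ 2 := by
  rw [← real_inner_self_eq_norm_sq, he.inner_sum]
  simp [sq]

/-- A vector of the closed span of an orthonormal family is controlled by its coefficients. -/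
lemma norm_sub_sum_inner_smul_le (he : Orthonormal ℝ e) {v : E}
    (hv : v ∈ (Submodule.span ℝ (Set.range e)).topologicalClosure) {s₀ : Finset I} {t : ℝ}
    (ht : ∀ s : Finset I, Disjoint s s₀ → ∑ i ∈ s, (inner ℝ (e i) v) ^ 2 ≤ t) :
    ‖v - ∑ i ∈ s₀, (inner ℝ (e i) v : ℝ) • e i‖ ≤ √t := by
  classical
  refine le_of_forall_pos_le_add fun ε hε => ?_
  obtain ⟨w, hw, hvw⟩ := Metric.mem_closure_iff.1 hv ε hε
  obtain ⟨c, rfl⟩ := Finsupp.mem_span_range_iff_exists_finsupp.1 hw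
  set s := c.support \ s₀ with hs
  have hdisj : Disjoint s s₀ := Finset.sdiff_disjoint
  let p : Finset I → E := fun s => ∑ i ∈ s, (inner ℝ (e i) v : ℝ) • e i
  have hps : p (s ∪ s₀) = p s + p s₀ := Finset.sum_union hdisj
  have h1 : ‖p s‖ ≤ √t := by
    apply Real.le_sqrt_of_sq_le
    rw [norm_sum_inner_smul_sq he]
    exact ht s hdisj
  have h2 : ‖v - p (s ∪ s₀)‖ ≤ ε := by
    set w := c.sum fun i a => a • e i with hwdef
    have hw' : w = ∑ i ∈ s ∪ s₀, c i • e i := by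
      rw [hwdef, Finsupp.sum]
      refine Finset.sum_subset (fun i hi => ?_) fun i _ hi => ?_
      · by_cases h : i ∈ s₀ <;> simp_all
      · rw [Finsupp.notMem_support_iff.1 hi, zero_smul]
    have hdiff : p (s ∪ s₀) - w = ∑ i ∈ s ∪ s₀, ((inner ℝ (e i) v : ℝ) - c i) • e i := by
      rw [hw', ← Finset.sum_sub_distrib]
      exact Finset.sum_congr rfl fun i _ => (sub_smul _ _ _).symm
    have horth : inner ℝ (v - p (s ∪ s₀)) (p (s ∪ s₀) - w) = 0 := by
      rw [hdiff, inner_sum]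
      refine Finset.sum_eq_zero fun i hi => ?_
      have hcomm : inner ℝ v (e i) = inner ℝ (e i) v := real_inner_comm _ _
      have : inner ℝ (p (s ∪ s₀)) (e i) = inner ℝ (e i) v := by
        rw [real_inner_comm]
        exact he.inner_right_sum _ hi
      rw [inner_smul_right, inner_sub_left, this, hcomm, sub_self, mul_zero]
    have h3 := norm_add_sq_eq_norm_sq_add_norm_sq_real horth
    rw [sub_add_sub_cancel] at h3
    have h4 : ‖v - w‖ < ε := by rwa [← dist_eq_norm]
    nlinarith [norm_nonneg (v - p (s ∪ s₀)), norm_nonneg (v - w), norm_nonneg (p (s ∪ s₀) - w)]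
  calc ‖v - p s₀‖ = ‖(v - p (s ∪ s₀)) + p s‖ := by rw [hps]; congr 1; abel
    _ ≤ ε + √t := (norm_add_le _ _).trans (add_le_add h2 h1)
    _ = √t + ε := add_comm _ _

end Hilbert

section Countable

variable {U Ω : Type*} [MeasurableSpace U] {ν : Measure U} {p : ℕ → Prop}
  {a : {i // p i} → U → ℝ} [MeasurableSpace Ω] {Q : Measure Ω} [IsProbabilityMeasure Q] {m : ℕ}
  {u : Fin m → Ω → U}

/-- The operator norm bound for Gaussian matrices with infinitely many weighted rows. -/
lemma measure_exists_finset_quadratic_gt_le (ha : IsStdGaussianFamily ν a)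
    (hu : ∀ j, Measurable (u j)) (hind : iIndepFun u Q) (hlaw : ∀ j, Q.map (u j) = ν)
    {σ : {i // p i} → ℝ} {t : ℝ} (ht : 0 < t)
    (hσ0 : ∀ i, 0 ≤ σ i) (hσ : ∀ i, σ i ≤ t) (hsum : ∀ s : Finset {i // p i},
      ∑ i ∈ s, σ i ≤ t * m) :
    Q {ω | ¬ ∀ (s : Finset {i // p i}) (θ : EuclideanSpace ℝ (Fin m)),
      ∑ i ∈ s, σ i * (∑ j, θ j * a i (u j ω)) ^ 2 ≤ 64 * t * m * ‖θ‖ ^ 2} ≤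
      ENNReal.ofReal (Real.exp (-m)) := by
  classical
  let S : ℕ → Finset {i // p i} := fun N => (Finset.range N).subtype p
  have hSmono : Monotone S := fun N M hNM i hi => by
    simp only [S, Finset.mem_subtype, Finset.mem_range] at hi ⊢
    omega
  have hSex : ∀ s : Finset {i // p i}, ∃ N, s ⊆ S N := fun s => by
    refine ⟨s.sup (fun i => i.1) + 1, fun i hi => ?_⟩
    simp only [S, Finset.mem_subtype, Finset.mem_range]
    exact Nat.lt_succ_of_le (Finset.le_sup (f := fun i : {i // p i} => i.1) hi)
  let bad : ℕ → Set Ω := fun N => {ω | ¬ ∀ θ : EuclideanSpace ℝ (Fin m),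
    ∑ i ∈ S N, σ i * (∑ j, θ j * a i (u j ω)) ^ 2 ≤ 64 * t * m * ‖θ‖ ^ 2}
  have hle : ∀ {s s' : Finset {i // p i}}, s ⊆ s' → ∀ (θ : EuclideanSpace ℝ (Fin m)) ω,
      ∑ i ∈ s, σ i * (∑ j, θ j * a i (u j ω)) ^ 2 ≤
        ∑ i ∈ s', σ i * (∑ j, θ j * a i (u j ω)) ^ 2 := fun h θ ω =>
    Finset.sum_le_sum_of_subset_of_nonneg h fun i _ _ => mul_nonneg (hσ0 i) (sq_nonneg _)
  have hbadmono : Monotone bad := fun N M hNM ω hω hcon =>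
    hω fun θ => (hle (hSmono hNM) θ ω).trans (hcon θ)
  have hsub : {ω | ¬ ∀ (s : Finset {i // p i}) (θ : EuclideanSpace ℝ (Fin m)),
      ∑ i ∈ s, σ i * (∑ j, θ j * a i (u j ω)) ^ 2 ≤ 64 * t * m * ‖θ‖ ^ 2} ⊆ ⋃ N, bad N := by
    intro ω hω
    by_contra hcon
    apply hω
    intro s θ
    obtain ⟨N, hN⟩ := hSex s
    have : ω ∉ bad N := fun h => hcon (Set.mem_iUnion.2 ⟨N, h⟩)
    simp only [bad, Set.mem_ofPred_eq, not_not] at this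
    exact (hle hN θ ω).trans (this θ)
  refine (measure_mono hsub).trans ?_
  rw [hbadmono.measure_iUnion]
  refine iSup_le fun N => ?_
  have h := measure_exists_quadratic_gt_le (Q := Q) (u := u) (ι := S N)
    (ha.comp Subtype.val_injective) hu hind hlaw (σ := fun i => σ i.1) ht
    (fun i => hσ0 i) (fun i => hσ i) (by
      rw [Finset.sum_coe_sort (S N) σ]; exact hsum _)
  refine le_trans (le_of_eq ?_) h
  congr 1
  ext ω
  simp only [bad, Set.mem_ofPred_eq]
  refine not_congr (forall_congr' fun θ => ?_)
  rw [← Finset.sum_coe_sort (S N)]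

end Countable

namespace IsBoundedGPPrior

variable {Z U : Type*} [MeasurableSpace Z] [MeasurableSpace U] {k : Z → Z → ℝ} {P : Measure Z}
  [IsProbabilityMeasure P] {ν : Measure U} [IsProbabilityMeasure ν] {g : U → Z → ℝ} {B : ℝ}
  {lam : ℕ → ℝ} {psi : ℕ → Lp ℝ 2 P}

lemma integral_inner_psi_mul_inner (hg : IsBoundedGPPrior k P ν g) (hB : ∀ z z', |k z z'| ≤ B)
    (hM : IsMercerSystem k P lam psi) {i : ℕ} (hi : 0 < lam i) (φ : Lp ℝ 2 P) :
    ∫ u, inner ℝ (psi i) (sectionLp P g u) * inner ℝ φ (sectionLp P g u) ∂ν =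
      lam i * inner ℝ (psi i) φ := by
  rw [hg.integral_inner_mul_inner hB, L2.inner_def, ← integral_const_mul]
  refine integral_congr_ae ?_
  filter_upwards [hM.eigen i hi] with z hz
  rw [hz]
  simp only [RCLike.inner_apply, conj_trivial]
  ring

/-- The normalised coefficients of the draws along the eigenfunctions of the covariance. -/
def coeff (P : Measure Z) (g : U → Z → ℝ) (lam : ℕ → ℝ) (psi : ℕ → Lp ℝ 2 P)
    (i : {i : ℕ // 0 < lam i}) (u : U) : ℝ :=
  inner ℝ (psi i) (sectionLp P g u) / √(lam i)

lemma isStdGaussianFamily_coeff (hg : IsBoundedGPPrior k P ν g) (hB : ∀ z z', |k z z'| ≤ B)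
    (hM : IsMercerSystem k P lam psi) : IsStdGaussianFamily ν (coeff P g lam psi) where
  measurable i := (hg.measurable_inner (psi i)).div_const _
  map_sum s w := by
    classical
    set φ : Lp ℝ 2 P := ∑ i ∈ s, (w i / √(lam i)) • psi i with hφ
    have h1 : (fun u => ∑ i ∈ s, w i * coeff P g lam psi i u) =
        fun u => inner ℝ φ (sectionLp P g u) := by
      ext u
      rw [hφ, sum_inner]
      refine Finset.sum_congr rfl fun i _ => ?_
      rw [real_inner_smul_left, coeff]
      ring
    rw [h1, hg.map_inner_eq_gaussianReal hB]
    congr 2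
    have hint : ∀ i j : {i : ℕ // 0 < lam i}, Integrable (fun u =>
        (inner ℝ (psi i) (sectionLp P g u) : ℝ) * inner ℝ (psi j) (sectionLp P g u)) ν :=
      fun i j => (hg.memLp_inner hB (psi i)).integrable_mul (hg.memLp_inner hB (psi j))
    have h2 : ∀ u, (inner ℝ φ (sectionLp P g u) : ℝ) ^ 2 = ∑ i ∈ s, ∑ j ∈ s,
        (w i / √(lam i)) * (w j / √(lam j)) *
          (inner ℝ (psi i) (sectionLp P g u) * inner ℝ (psi j) (sectionLp P g u)) := by
      intro u
      rw [hφ, sum_inner, sq, Finset.sum_mul_sum]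
      refine Finset.sum_congr rfl fun i _ => Finset.sum_congr rfl fun j _ => ?_
      rw [real_inner_smul_left, real_inner_smul_left]
      ring
    simp_rw [h2]
    rw [integral_finsetSum _ fun i _ => integrable_finsetSum _ fun j _ => (hint i j).const_mul _]
    refine Finset.sum_congr rfl fun i hi => ?_
    rw [integral_finsetSum _ fun j _ => (hint i j).const_mul _]
    simp_rw [integral_const_mul]
    rw [Finset.sum_eq_single_of_mem i hi]
    · rw [hg.integral_inner_psi_mul_inner hB hM i.2]
      have h3 : inner ℝ (psi i) (psi i) = (1 : ℝ) := by
        rw [real_inner_self_eq_norm_sq, hM.orthonormal.1 i, one_pow]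
      have h4 : √(lam i) * √(lam i) = lam i := Real.mul_self_sqrt i.2.le
      have h5 : √(lam i) ≠ 0 := (Real.sqrt_pos.2 i.2).ne'
      rw [h3, mul_one]
      nth_rw 3 [← h4]
      field_simp
    · intro j _ hji
      rw [hg.integral_inner_psi_mul_inner hB hM i.2, hM.orthonormal.2 hji.symm, mul_zero, mul_zero]

/-- Almost every draw lies in the closed span of the eigenfunctions: an integral against a function
orthogonal to the eigenfunctions has variance zero, and the draws take their values in a separable
subspace of `L²(P)`, so that countably many such functions detect a component outside that span. -/
lemma ae_mem_closure_span (hg : IsBoundedGPPrior k P ν g) (hB : ∀ z z', |k z z'| ≤ B)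
    (hM : IsMercerSystem k P lam psi) :
    ∀ᵐ u ∂ν, sectionLp P g u ∈ (Submodule.span ℝ
      (Set.range fun i : {i : ℕ // 0 < lam i} => psi i)).topologicalClosure := by
  set M := (Submodule.span ℝ
      (Set.range fun i : {i : ℕ // 0 < lam i} => psi i)).topologicalClosure with hMdef
  have hcomp : CompleteSpace M := (Submodule.isClosed_topologicalClosure _).completeSpace_coe
  have hsm : StronglyMeasurable fun u => Mᗮ.starProjection (sectionLp P g u) :=
    Mᗮ.starProjection.continuous.comp_stronglyMeasurable hg.stronglyMeasurable_section
  have h0 : (fun u => Mᗮ.starProjection (sectionLp P g u)) =ᵐ[ν] 0 := by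
    refine ae_eq_zero_of_forall_dual_of_isSeparable ℝ hsm.isSeparable_range (fun ℓ => ?_)
      (ae_of_all _ fun u => Set.mem_range_self u)
    obtain ⟨φ, rfl⟩ := (InnerProductSpace.toDual ℝ (Lp ℝ 2 P)).surjective ℓ
    set φ' := Mᗮ.starProjection φ with hφ'
    have h1 : ∀ u, InnerProductSpace.toDual ℝ (Lp ℝ 2 P) φ (Mᗮ.starProjection (sectionLp P g u)) =
        inner ℝ φ' (sectionLp P g u) := fun u => by
      rw [InnerProductSpace.toDual_apply_apply, hφ']
      exact (Submodule.inner_starProjection_left_eq_right _ _ _).symm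
    have h2 : ∀ i, 0 < lam i → inner ℝ (psi i) φ' = 0 := fun i hi => by
      refine (Submodule.mem_orthogonal _ _).1 (Submodule.starProjection_apply_mem Mᗮ φ) _ ?_
      exact Submodule.le_topologicalClosure _ (Submodule.subset_span ⟨⟨i, hi⟩, rfl⟩)
    have h3 : ∫ u, (inner ℝ φ' (sectionLp P g u) : ℝ) ^ 2 ∂ν = 0 := by
      simp_rw [sq]
      rw [hg.integral_inner_mul_inner hB]
      refine integral_eq_zero_of_ae ?_
      filter_upwards [hM.complete φ' h2] with z hz
      rw [hz]
      simp
    rw [integral_eq_zero_iff_of_nonneg (fun u => sq_nonneg _)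
      (hg.memLp_inner hB φ').integrable_sq] at h3
    filter_upwards [h3] with u hu
    simp only [h1]
    simpa using hu
  filter_upwards [h0] with u hu
  have h1 : M.starProjection (sectionLp P g u) + Mᗮ.starProjection (sectionLp P g u) =
      sectionLp P g u := Submodule.starProjection_add_starProjection_orthogonal _
  have h2 : Mᗮ.starProjection (sectionLp P g u) = 0 := hu
  rw [h2, add_zero] at h1
  rw [← h1]
  exact Submodule.starProjection_apply_mem M _

end IsBoundedGPPrior

/-! ### Eigendecay of the induced kernel -/

section Mercer

variable {Z : Type*} [MeasurableSpace Z] {P : Measure Z} [IsFiniteMeasure P] {k : Z → Z → ℝ}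
  {B : ℝ}

/-- The integral operator of a symmetric kernel is self-adjoint. -/
lemma integral_mul_integral_kernel_comm (hk : Measurable (Function.uncurry k))
    (hB : ∀ z z', |k z z'| ≤ B) (hsymm : ∀ z z', k z z' = k z' z) (f h : Lp ℝ 2 P) :
    ∫ z, f z * ∫ z', k z z' * h z' ∂P ∂P = ∫ z, h z * ∫ z', k z z' * f z' ∂P ∂P := by
  have hf := (Lp.memLp f).integrable one_le_two
  have hh := (Lp.memLp h).integrable one_le_two
  have hint : Integrable (Function.uncurry fun z z' => f z * (k z z' * h z')) (P.prod P) := by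
    have h1 := (hf.mul_prod hh).bdd_mul (c := B) (f := fun p : Z × Z => k p.1 p.2)
      hk.aestronglyMeasurable (ae_of_all _ fun p => hB p.1 p.2)
    refine h1.congr (ae_of_all _ fun p => ?_)
    simp only [Function.uncurry]
    ring
  have h1 := integral_integral_swap hint
  simp_rw [integral_const_mul] at h1
  rw [h1]
  congr 1
  ext z
  rw [← integral_const_mul]
  congr 1
  ext z'
  rw [hsymm z' z]
  ring

/-- A Mercer system lists the eigenvalues with their full multiplicity: there are at most `i`
orthonormal eigenfunctions with eigenvalues larger than `lam i`. -/
lemma IsMercerSystem.not_orthonormal_eigenfunctions {lam : ℕ → ℝ} {psi : ℕ → Lp ℝ 2 P}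
    (hM : IsMercerSystem k P lam psi) (hk : Measurable (Function.uncurry k))
    (hB : ∀ z z', |k z z'| ≤ B) (hsymm : ∀ z z', k z z' = k z' z) {i : ℕ}
    {q : Fin (i + 1) → Lp ℝ 2 P} (hq : Orthonormal ℝ q) {μ : Fin (i + 1) → ℝ}
    (hμ : ∀ l, lam i < μ l)
    (heig : ∀ l, (fun z => ∫ z', k z z' * q l z' ∂P) =ᵐ[P] fun z => μ l * q l z) : False := by
  classical
  -- The `q l` are orthogonal to `psi j` for `j ≥ i`, hence in the span of the at most `i` others.
  set S := (Finset.range i).filter fun j => 0 < lam j with hS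
  have hinner : ∀ (f h : Lp ℝ 2 P), (inner ℝ f h : ℝ) = ∫ z, f z * h z ∂P := fun f h => by
    rw [L2.inner_def]; congr 1; ext z; simp [mul_comm]
  have hTq : ∀ l (f : Lp ℝ 2 P), ∫ z, f z * ∫ z', k z z' * q l z' ∂P ∂P =
      μ l * inner ℝ f (q l) := fun l f => by
    rw [hinner, ← integral_const_mul]
    refine integral_congr_ae ?_
    filter_upwards [heig l] with z hz
    rw [hz]; ring
  have h1 : ∀ l j, 0 < lam j → i ≤ j → inner ℝ (psi j) (q l) = (0 : ℝ) := by
    intro l j hj hij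
    have h2 := integral_mul_integral_kernel_comm hk hB hsymm (psi j) (q l)
    rw [hTq] at h2
    have h3 : ∫ z, q l z * ∫ z', k z z' * psi j z' ∂P ∂P = lam j * inner ℝ (psi j) (q l) := by
      rw [hinner, ← integral_const_mul]
      refine integral_congr_ae ?_
      filter_upwards [hM.eigen j hj] with z hz
      rw [hz]; ring
    rw [h3] at h2
    have h4 : μ l - lam j ≠ 0 := by
      have := hM.antitone hij
      have := hμ l
      intro h; linarith
    have h5 : (μ l - lam j) * inner ℝ (psi j) (q l) = 0 := by linarith
    exact (mul_eq_zero.1 h5).resolve_left h4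
  have horth : ∀ j j', 0 < lam j → 0 < lam j' →
      inner ℝ (psi j) (psi j') = if j = j' then (1 : ℝ) else 0 := by
    intro j j' hj hj'
    have := orthonormal_iff_ite.1 hM.orthonormal ⟨j, hj⟩ ⟨j', hj'⟩
    simpa using this
  have hmem : ∀ l, q l ∈ Submodule.span ℝ ((S.image psi : Finset (Lp ℝ 2 P)) : Set _) := by
    intro l
    set p := ∑ j ∈ S, (inner ℝ (psi j) (q l) : ℝ) • psi j with hp
    set f := q l - p with hf
    have hfpsi : ∀ j, 0 < lam j → inner ℝ (psi j) f = (0 : ℝ) := by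
      intro j hj
      rw [hf, inner_sub_right, hp, inner_sum]
      have h2 : ∑ j' ∈ S, inner ℝ (psi j) ((inner ℝ (psi j') (q l) : ℝ) • psi j') =
          ∑ j' ∈ S, if j = j' then (inner ℝ (psi j') (q l) : ℝ) else 0 := by
        refine Finset.sum_congr rfl fun j' hj' => ?_
        rw [real_inner_smul_right, horth j j' hj (Finset.mem_filter.1 hj').2]
        split_ifs <;> simp
      rw [h2, Finset.sum_ite_eq]
      split_ifs with hjS
      · exact sub_self _
      · rw [sub_zero]
        refine h1 l j hj ?_
        by_contra hlt
        exact hjS (Finset.mem_filter.2 ⟨Finset.mem_range.2 (not_le.1 hlt), hj⟩)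
    have h3 : inner ℝ f (q l) = (0 : ℝ) := by
      have h4 := hTq l f
      rw [integral_mul_integral_kernel_comm hk hB hsymm] at h4
      have h5 : ∫ z, q l z * ∫ z', k z z' * f z' ∂P ∂P = 0 := by
        refine integral_eq_zero_of_ae ?_
        filter_upwards [hM.complete f hfpsi] with z hz
        rw [hz]; simp
      rw [h5] at h4
      have h6 : μ l ≠ 0 := ((hM.nonneg i).trans_lt (hμ l)).ne'
      exact (mul_eq_zero.1 h4.symm).resolve_left h6
    have h4 : inner ℝ f p = (0 : ℝ) := by
      rw [hp, inner_sum]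
      refine Finset.sum_eq_zero fun j hj => ?_
      rw [real_inner_smul_right, real_inner_comm (psi j) f, hfpsi j (Finset.mem_filter.1 hj).2,
        mul_zero]
    have h5 : f = 0 := by
      rw [← inner_self_eq_zero (𝕜 := ℝ)]
      nth_rw 2 [hf]
      rw [inner_sub_right, h3, h4, sub_zero]
    have h6 : q l = p := sub_eq_zero.1 h5
    rw [h6]
    exact Submodule.sum_mem _ fun j hj => Submodule.smul_mem _ _
      (Submodule.subset_span (Finset.mem_coe.2 (Finset.mem_image_of_mem _ hj)))
  have hle : Submodule.span ℝ (Set.range q) ≤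
      Submodule.span ℝ ((S.image psi : Finset (Lp ℝ 2 P)) : Set _) :=
    Submodule.span_le.2 (by rintro _ ⟨l, rfl⟩; exact hmem l)
  have hdim := Submodule.finrank_mono hle
  rw [finrank_span_eq_card hq.linearIndependent, Fintype.card_fin] at hdim
  have h7 := finrank_span_finset_le_card (R := ℝ) (S.image psi)
  have h8 : (S.image psi).card ≤ i :=
    Finset.card_image_le.trans ((Finset.card_filter_le _ _).trans (Finset.card_range i).le)
  simp only [Set.finrank] at h7
  omega

end Mercer

/-- The eigendecay assumed for the latent kernel holds for the induced kernel: eigenfunctions of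
the induced operator are functions of the feature map, hence push forward to eigenfunctions of the
latent operator. -/
lemma IsLatentKernel.eigenvalue_le {Z : Type*} [TopologicalSpace Z] [MeasurableSpace Z]
    [OpensMeasurableSpace Z] {P : Measure Z} [IsProbabilityMeasure P] {d : ℕ}
    {Zbar : Set (EuclideanSpace ℝ (Fin d))} {Phi : Z → Zbar} {kbar : Zbar → Zbar → ℝ} {b : ℝ}
    (hL : IsLatentKernel P Phi kbar b) {lam : ℕ → ℝ} {psi : ℕ → Lp ℝ 2 P}
    (hM : IsMercerSystem (inducedKernel Phi kbar) P lam psi) :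
    ∃ C : ℝ, ∀ i : ℕ, lam i ≤ C * ((i : ℝ) + 1) ^ (-(b + 1)) := by
  obtain ⟨lam', psi', C, hM', hC⟩ := hL.eigendecay
  obtain ⟨B, hB⟩ := hL.bounded_kernel
  have hΦ : Measurable Phi := hL.continuous_phi.measurable
  have : IsProbabilityMeasure (P.map Phi) := Measure.isProbabilityMeasure_map hΦ.aemeasurable
  have hsymm : ∀ x y, kbar x y = kbar y x := fun x y => by
    have := hL.posSemidef.isHermitian.apply x y
    simpa using this.symm
  refine ⟨C, fun i => le_trans ?_ (hC i)⟩
  by_contra! hlt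
  have hpos : ∀ l : Fin (i + 1), lam' i < lam l := fun l =>
    hlt.trans_le (hM.antitone (Nat.lt_succ_iff.1 l.2))
  have hpos0 : ∀ l : Fin (i + 1), 0 < lam l := fun l => (hM'.nonneg i).trans_lt (hpos l)
  -- The right-hand side of the eigenvalue equation depends on `z` through `Phi z` only.
  let q : Fin (i + 1) → Zbar → ℝ := fun l x =>
    (lam l)⁻¹ * ∫ z', kbar x (Phi z') * psi l z' ∂P
  have hqm : ∀ l, Measurable (q l) := fun l => by
    refine Measurable.const_mul (StronglyMeasurable.measurable ?_) _
    have hpsi := (Lp.stronglyMeasurable (psi l)).measurable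
    refine StronglyMeasurable.integral_prod_right
      (f := fun x z' => kbar x (Phi z') * psi l z') (Measurable.stronglyMeasurable ?_)
    exact (hL.measurable_kernel.comp (measurable_fst.prodMk (hΦ.comp measurable_snd))).mul
      (hpsi.comp measurable_snd)
  have hqΦ : ∀ l, (fun z => q l (Phi z)) =ᵐ[P] psi l := fun l => by
    filter_upwards [hM.eigen l (hpos0 l)] with z hz
    simp only [inducedKernel] at hz
    simp only [q]
    rw [hz, inv_mul_cancel_left₀ (hpos0 l).ne']
  have hqL : ∀ l, MemLp (q l) 2 (P.map Phi) := fun l => by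
    rw [memLp_map_measure_iff (hqm l).aestronglyMeasurable hΦ.aemeasurable]
    exact (memLp_congr_ae (hqΦ l)).2 (Lp.memLp _)
  have hcoe : ∀ l, (hqL l).toLp =ᵐ[P.map Phi] q l := fun l => (hqL l).coeFn_toLp
  refine hM'.not_orthonormal_eigenfunctions hL.measurable_kernel hB hsymm
    (q := fun l => (hqL l).toLp) ?_ hpos fun l => ?_
  · rw [orthonormal_iff_ite]
    intro l l'
    have h1 : inner ℝ ((hqL l).toLp) ((hqL l').toLp) = (inner ℝ (psi l) (psi l') : ℝ) := by
      rw [L2.inner_def, L2.inner_def]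
      rw [integral_congr_ae (g := fun x => inner ℝ (q l x) (q l' x)) (by
        filter_upwards [hcoe l, hcoe l'] with x h1 h2; rw [h1, h2])]
      have h3 := hqm l
      have h4 := hqm l'
      rw [integral_map hΦ.aemeasurable (Measurable.aestronglyMeasurable (by fun_prop))]
      refine integral_congr_ae ?_
      filter_upwards [hqΦ l, hqΦ l'] with z h1 h2
      rw [h1, h2]
    rw [h1]
    have := orthonormal_iff_ite.1 hM.orthonormal ⟨l, hpos0 l⟩ ⟨l', hpos0 l'⟩
    simpa [Fin.ext_iff] using this
  · filter_upwards [hcoe l] with x hx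
    rw [hx]
    rw [integral_congr_ae (g := fun y => kbar x y * q l y) (by
      filter_upwards [hcoe l] with y hy; rw [hy])]
    have h1 : Measurable fun y => kbar x y * q l y :=
      (hL.measurable_kernel.comp measurable_prodMk_left).mul (hqm l)
    rw [integral_map hΦ.aemeasurable h1.aestronglyMeasurable]
    rw [integral_congr_ae (g := fun z => kbar x (Phi z) * psi l z) (by
      filter_upwards [hqΦ l] with z hz; rw [← hz])]
    simp only [q]
    rw [mul_inv_cancel_left₀ (hpos0 l).ne']

/-! ### The reproducing kernel Hilbert space in `L²` -/

section RKHSInclusion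

variable {Z H : Type*} [NormedAddCommGroup H] [InnerProductSpace ℝ H] [CompleteSpace H]
  [RKHS ℝ H Z ℝ] {k : Z → Z → ℝ} {B : ℝ}

lemma norm_rkhs_apply_le (hkH : ∀ x y, RKHS.kernel H x y 1 = k x y)
    (hB : ∀ z z', |k z z'| ≤ B) (f : H) (z : Z) : ‖f z‖ ≤ √B * ‖f‖ := by
  refine (RKHS.norm_apply_le f z).trans ?_
  rw [mul_comm]
  gcongr
  refine ContinuousLinearMap.opNorm_le_bound _ ((abs_nonneg _).trans (hB z z)) fun v => ?_
  have h : RKHS.kernel H z z v = v * k z z := by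
    rw [← hkH, ← smul_eq_mul v, ← map_smul, smul_eq_mul, mul_one]
  rw [h, norm_mul, mul_comm]
  gcongr
  exact hB z z

variable [MeasurableSpace Z] {P : Measure Z} [IsProbabilityMeasure P]

/-- The elements of the space are pointwise limits of combinations of kernel sections. -/
lemma measurable_rkhs (hkH : ∀ x y, RKHS.kernel H x y 1 = k x y)
    (hk : Measurable (Function.uncurry k)) (f : H) : Measurable (f : Z → ℝ) := by
  have hspan : ∀ f ∈ Submodule.span ℝ {f : H | ∃ x v, RKHS.kerFun H x v = f},
      Measurable (f : Z → ℝ) := by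
    intro f hf
    induction hf using Submodule.span_induction with
    | mem f hf =>
      obtain ⟨x, v, rfl⟩ := hf
      have h : ⇑(RKHS.kerFun H x v) = fun z => v * k z x := by
        ext z
        rw [RKHS.kerFun_apply, ← hkH, ← smul_eq_mul v, ← map_smul, smul_eq_mul, mul_one]
      rw [h]
      exact (hk.comp measurable_prodMk_right).const_mul v
    | zero => rw [RKHS.coe_zero]; exact measurable_zero
    | add f g _ _ hf hg => rw [RKHS.coe_add]; exact hf.add hg
    | smul c f _ hf => rw [RKHS.coe_smul]; exact hf.const_smul c
  have hmem : f ∈ (Submodule.span ℝ {f : H | ∃ x v, RKHS.kerFun H x v = f}).topologicalClosure := by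
    rw [RKHS.kerFun_dense]; trivial
  obtain ⟨F, hF, hlim⟩ := mem_closure_iff_seq_limit.1 hmem
  refine measurable_of_tendsto_metrizable (fun n => hspan _ (hF n)) ?_
  rw [tendsto_pi_nhds]
  exact fun z => ((RKHS.continuous_eval z).tendsto f).comp hlim

lemma memLp_rkhs (hkH : ∀ x y, RKHS.kernel H x y 1 = k x y)
    (hk : Measurable (Function.uncurry k)) (hB : ∀ z z', |k z z'| ≤ B) (f : H) :
    MemLp (f : Z → ℝ) 2 P :=
  MemLp.of_bound (measurable_rkhs hkH hk f).aestronglyMeasurable (√B * ‖f‖)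
    (ae_of_all _ fun z => norm_rkhs_apply_le hkH hB f z)

/-- The inclusion of a reproducing kernel Hilbert space with bounded measurable kernel into
`L²(P)`. -/
def rkhsInclusion (P : Measure Z) [IsProbabilityMeasure P]
    (hkH : ∀ x y, RKHS.kernel H x y 1 = k x y) (hk : Measurable (Function.uncurry k))
    (hB : ∀ z z', |k z z'| ≤ B) : H →L[ℝ] Lp ℝ 2 P :=
  LinearMap.mkContinuous
    { toFun := fun f => (memLp_rkhs hkH hk hB f).toLp f
      map_add' := fun f g => by
        rw [← MemLp.toLp_add]
        congr 1
        exact RKHS.coe_add f g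
      map_smul' := fun c f => by
        rw [RingHom.id_apply, ← MemLp.toLp_const_smul]
        congr 1
        exact RKHS.coe_smul _ _ } (√B) fun f => by
    have h := Lp.norm_le_of_ae_bound (p := 2) (μ := P) (f := (memLp_rkhs hkH hk hB f).toLp f)
      (C := √B * ‖f‖) (by positivity) (by
        filter_upwards [(memLp_rkhs (P := P) hkH hk hB f).coeFn_toLp] with z hz
        rw [hz]
        exact norm_rkhs_apply_le hkH hB f z)
    simpa [measureUnivNNReal] using h

lemma coeFn_rkhsInclusion (hkH : ∀ x y, RKHS.kernel H x y 1 = k x y)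
    (hk : Measurable (Function.uncurry k)) (hB : ∀ z z', |k z z'| ≤ B) (f : H) :
    rkhsInclusion P hkH hk hB f =ᵐ[P] f := (memLp_rkhs hkH hk hB f).coeFn_toLp

/-- The integral operator of the kernel is the inclusion composed with its adjoint. -/
lemma rkhsInclusion_adjoint_apply (hkH : ∀ x y, RKHS.kernel H x y 1 = k x y)
    (hk : Measurable (Function.uncurry k)) (hB : ∀ z z', |k z z'| ≤ B)
    (hsymm : ∀ z z', k z z' = k z' z) (φ : Lp ℝ 2 P) (z : Z) :
    (rkhsInclusion P hkH hk hB).adjoint φ z = ∫ z', k z z' * φ z' ∂P := by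
  have h1 : (rkhsInclusion P hkH hk hB).adjoint φ z =
      inner ℝ (RKHS.kerFun H z 1) ((rkhsInclusion P hkH hk hB).adjoint φ) := by
    rw [RKHS.kerFun_inner]; simp
  rw [h1, ContinuousLinearMap.adjoint_inner_right, L2.inner_def]
  refine integral_congr_ae ?_
  filter_upwards [coeFn_rkhsInclusion (P := P) hkH hk hB (RKHS.kerFun H z 1)] with z' hz'
  rw [hz', RKHS.kerFun_apply, hkH, hsymm z z']
  simp [mul_comm]

lemma rkhsInclusion_adjoint_psi (hkH : ∀ x y, RKHS.kernel H x y 1 = k x y)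
    (hk : Measurable (Function.uncurry k)) (hB : ∀ z z', |k z z'| ≤ B)
    (hsymm : ∀ z z', k z z' = k z' z) {lam : ℕ → ℝ} {psi : ℕ → Lp ℝ 2 P}
    (hM : IsMercerSystem k P lam psi) {i : ℕ} (hi : 0 < lam i) :
    rkhsInclusion P hkH hk hB ((rkhsInclusion P hkH hk hB).adjoint (psi i)) = lam i • psi i := by
  ext1
  filter_upwards [coeFn_rkhsInclusion (P := P) hkH hk hB
    ((rkhsInclusion P hkH hk hB).adjoint (psi i)), hM.eigen i hi,
    Lp.coeFn_smul (lam i) (psi i)] with z h1 h2 h3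
  rw [h1, h3, rkhsInclusion_adjoint_apply hkH hk hB hsymm, h2]
  rfl

/-- The norm in the reproducing kernel Hilbert space of the projection of a function onto the
leading eigenfunctions dominates its Mercer norm, in which the coefficient along the `i`-th
eigenfunction has the weight `1 / √(lam i)`. -/
lemma sum_sq_div_le_rkhsNorm (hkH : ∀ x y, RKHS.kernel H x y 1 = k x y)
    (hk : Measurable (Function.uncurry k)) (hB : ∀ z z', |k z z'| ≤ B)
    (hsymm : ∀ z z', k z z' = k z' z) {lam : ℕ → ℝ} {psi : ℕ → Lp ℝ 2 P}
    (hM : IsMercerSystem k P lam psi) (r : ℕ) (f : Lp ℝ 2 P) :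
    √(∑ i ∈ (Finset.range r).subtype fun i => 0 < lam i, inner ℝ (psi i) f ^ 2 / lam i) ≤
      rkhsNorm P H (mercerProj lam psi r f) := by
  classical
  set J := rkhsInclusion P hkH hk hB with hJ
  set s := (Finset.range r).subtype fun i => 0 < lam i with hs
  have hproj : mercerProj lam psi r f = ∑ i ∈ s, (inner ℝ (psi i) f : ℝ) • psi i := by
    rw [mercerProj, hs, Finset.sum_subtype_eq_sum_filter
      (f := fun i => (inner ℝ (psi i) f : ℝ) • psi i)]
  -- `h₀` represents the projection and its inner product with any representative is the squared
  -- Mercer norm.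
  set h₀ : H := ∑ i ∈ s, ((inner ℝ (psi i) f : ℝ) / lam i) • J.adjoint (psi i) with hh₀
  have hJh₀ : J h₀ = mercerProj lam psi r f := by
    rw [hh₀, map_sum, hproj]
    refine Finset.sum_congr rfl fun i _ => ?_
    rw [map_smul, rkhsInclusion_adjoint_psi hkH hk hB hsymm hM i.2, smul_smul,
      div_mul_cancel₀ _ i.2.ne']
  have hinner : ∀ h : H, J h = mercerProj lam psi r f →
      inner ℝ h h₀ = ∑ i ∈ s, inner ℝ (psi i) f ^ 2 / lam i := by
    intro h hh
    rw [hh₀, inner_sum]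
    refine Finset.sum_congr rfl fun i hi => ?_
    have hc : inner ℝ (mercerProj lam psi r f) (psi i) = (inner ℝ (psi i) f : ℝ) := by
      rw [hproj, real_inner_comm]
      exact hM.orthonormal.inner_right_sum (fun i => inner ℝ (psi i) f) hi
    rw [real_inner_smul_right, ContinuousLinearMap.adjoint_inner_right, hh, hc]
    ring
  refine le_csInf ⟨‖h₀‖, h₀, ?_, rfl⟩ ?_
  · rw [← hJh₀]
    exact (coeFn_rkhsInclusion hkH hk hB h₀).symm
  · rintro _ ⟨h, hh, rfl⟩
    have hJh : J h = mercerProj lam psi r f := by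
      ext1
      exact (coeFn_rkhsInclusion hkH hk hB h).trans hh
    have h1 := hinner h₀ hJh₀
    have h2 := hinner h hJh
    rw [real_inner_self_eq_norm_sq] at h1
    rw [← h1, Real.sqrt_sq (norm_nonneg _)]
    have h3 := real_inner_le_norm h h₀
    rw [h2, ← h1] at h3
    rcases (norm_nonneg h₀).eq_or_lt with h0 | h0
    · rw [← h0]; exact norm_nonneg _
    · exact le_of_mul_le_mul_right (by linarith [sq ‖h₀‖]) h0

end RKHSInclusion

/-! ### The law of the data and the errors of the estimates -/

section Dataset

variable {U Y : Type*} [MeasurableSpace U] [MeasurableSpace Y]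

/-- The kernel sampling `n` independent observations from a Markov kernel. -/
def iidKernel (κ : Kernel U Y) [IsMarkovKernel κ] (n : ℕ) : Kernel U (Fin n → Y) where
  toFun v := Measure.pi fun _ => κ v
  measurable' := by
    refine Measurable.measure_of_isPiSystem_of_isProbabilityMeasure generateFrom_pi.symm
      isPiSystem_pi ?_
    rintro _ ⟨T, hT, rfl⟩
    simp only [Measure.pi_pi]
    exact Finset.measurable_fun_prod _ fun i _ => κ.measurable_coe (hT i (Set.mem_univ i))

lemma iidKernel_apply (κ : Kernel U Y) [IsMarkovKernel κ] (n : ℕ) (v : U) :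
    iidKernel κ n v = Measure.pi fun _ => κ v := rfl

instance (κ : Kernel U Y) [IsMarkovKernel κ] (n : ℕ) : IsMarkovKernel (iidKernel κ n) :=
  ⟨fun v => by rw [iidKernel_apply]; infer_instance⟩

end Dataset

namespace IsSharedDataset

variable {Z U Ω : Type*} [MeasurableSpace Z] [MeasurableSpace U] [MeasurableSpace Ω]
  {ν : Measure U} {κ : Kernel U (Z × ℝ)} {Q : Measure Ω} {n m : ℕ} {u : Fin m → Ω → U}
  {z : Fin n → Ω → Z} {e : Fin n → Fin m → Ω → ℝ}

lemma measurable_sample (h : IsSharedDataset ν κ Q u z e) (j : Fin m) :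
    Measurable fun ω => (u j ω, fun i => (z i ω, e i j ω)) :=
  (h.measurable_draw j).prodMk (measurable_pi_lambda _ fun i =>
    (h.measurable_instrument i).prodMk (h.measurable_noise i j))

variable [IsProbabilityMeasure ν] [IsMarkovKernel κ] [IsProbabilityMeasure Q]

/-- The joint law of a draw and of the instruments and noises of its observations. -/
lemma map_sample (h : IsSharedDataset ν κ Q u z e) (j : Fin m) :
    Q.map (fun ω => (u j ω, fun i => (z i ω, e i j ω))) = ν ⊗ₘ iidKernel κ n := by
  have := Measure.isProbabilityMeasure_map (μ := Q) (h.measurable_sample j).aemeasurable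
  refine ext_of_generate_finite _ (generateFrom_eq_prod MeasurableSpace.generateFrom_measurableSet
    generateFrom_pi ?_ ?_).symm (MeasurableSpace.isPiSystem_measurableSet.prod isPiSystem_pi)
    ?_ (by simp)
  · exact ⟨fun _ => Set.univ, fun _ => .univ, Set.iUnion_const _⟩
  · exact ⟨fun _ => Set.univ, fun _ => ⟨fun _ => Set.univ,
      fun _ _ => (MeasurableSet.univ : MeasurableSet (Set.univ : Set (Z × ℝ))),
      Set.pi_univ _⟩,
      Set.iUnion_const _⟩
  · rintro _ ⟨S, hS, _, ⟨T, hT, rfl⟩, rfl⟩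
    have hS' : MeasurableSet S := hS
    have hT' : ∀ i, MeasurableSet (T i) := fun i => hT i (Set.mem_univ i)
    have hTp : MeasurableSet (Set.univ.pi T) := .univ_pi hT'
    rw [Measure.map_apply (h.measurable_sample j) (hS'.prod hTp),
      Measure.compProd_apply_prod hS' hTp]
    simp only [iidKernel_apply, Measure.pi_pi]
    rw [← h.cond_iid j S T hS' hT']
    congr 1
    ext ω
    simp

end IsSharedDataset

namespace IsRegressionOracle

variable {Z U Ω : Type*} [MeasurableSpace Z] [MeasurableSpace U] [MeasurableSpace Ω]
  {P : Measure Z} [IsProbabilityMeasure P]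
  {ν : Measure U} [IsProbabilityMeasure ν] {g : U → Z → ℝ} {κ : Kernel U (Z × ℝ)}
  [IsMarkovKernel κ] {A : (n : ℕ) → (Fin n → Z × ℝ) → Z → ℝ} {ξ : ℕ → ℝ}
  {Q : Measure Ω} [IsProbabilityMeasure Q] {n m : ℕ} {u : Fin m → Ω → U} {z : Fin n → Ω → Z}
  {e : Fin n → Fin m → Ω → ℝ}

/-- The risk bound of the regression algorithm, for one of the draws behind a shared data set. -/
lemma lintegral_error_le (hA : IsRegressionOracle P ν g κ A ξ)
    (hg : Measurable (Function.uncurry g)) (h : IsSharedDataset ν κ Q u z e) (hn : 0 < n)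
    (j : Fin m) :
    ∫⁻ ω, ∫⁻ x, ‖A n (fun i => (z i ω, g (u j ω) (z i ω) + e i j ω)) x - g (u j ω) x‖ₑ ^ 2 ∂P ∂Q
      ≤ ENNReal.ofReal (ξ n ^ 2) := by
  refine le_trans (le_of_eq ?_) (hA.error n hn)
  have hobs : Measurable fun p : U × (Z × ℝ) => (p.2.1, g p.1 p.2.1 + p.2.2) := by
    have : Measurable fun p : U × (Z × ℝ) => g p.1 p.2.1 :=
      hg.comp (measurable_fst.prodMk measurable_snd.fst)
    fun_prop
  let F : U × (Fin n → Z × ℝ) → ℝ≥0∞ := fun p =>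
    ∫⁻ x, ‖A n p.2 x - g p.1 x‖ₑ ^ 2 ∂P
  have hF : Measurable F := by
    have h1 : Measurable fun q : (U × (Fin n → Z × ℝ)) × Z => A n q.1.2 q.2 :=
      (hA.measurable n).comp (measurable_fst.snd.prodMk measurable_snd)
    have h2 : Measurable fun q : (U × (Fin n → Z × ℝ)) × Z => g q.1.1 q.2 :=
      hg.comp (measurable_fst.fst.prodMk measurable_snd)
    exact Measurable.lintegral_prod_right' (((h1.sub h2).enorm).pow_const 2)
  let τ : U × (Fin n → Z × ℝ) → U × (Fin n → Z × ℝ) := fun p =>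
    (p.1, fun i => ((p.2 i).1, g p.1 (p.2 i).1 + (p.2 i).2))
  have hτ : Measurable τ := measurable_fst.prodMk (measurable_pi_lambda _ fun i =>
    hobs.comp (measurable_fst.prodMk ((measurable_pi_apply i).comp measurable_snd)))
  have h1 : ∀ ω, ∫⁻ x, ‖A n (fun i => (z i ω, g (u j ω) (z i ω) + e i j ω)) x - g (u j ω) x‖ₑ ^ 2 ∂P
      = (F ∘ τ) (u j ω, fun i => (z i ω, e i j ω)) := fun ω => rfl
  simp_rw [h1]
  rw [← lintegral_map (hF.comp hτ) (h.measurable_sample j), h.map_sample j,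
    Measure.lintegral_compProd (hF.comp hτ)]
  refine lintegral_congr fun v => ?_
  have hv : Measurable fun p : Z × ℝ => (p.1, g v p.1 + p.2) :=
    hobs.comp measurable_prodMk_left
  rw [iidKernel_apply]
  have h2 := Measure.pi_map_pi (μ := fun _ : Fin n => κ v) (f := fun _ p => (p.1, g v p.1 + p.2))
    (fun _ => hv.aemeasurable)
  rw [← h2]
  exact (lintegral_map (f := fun D => F (v, D)) (hF.comp measurable_prodMk_left)
    (measurable_pi_lambda _ fun i => hv.comp (measurable_pi_apply i))).symm

end IsRegressionOracle

/-! ### Truncation, eigenvalue tails and approximate preimages -/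

section Truncation

variable {tr : ℝ → ℝ → ℝ}

lemma measurable_truncation (htr : tr ∈ truncations) (B : ℝ) : Measurable (tr B) := by
  rcases htr with rfl | rfl <;> fun_prop

lemma abs_truncation_le (htr : tr ∈ truncations) {B : ℝ} (hB : 0 ≤ B) (x : ℝ) :
    |tr B x| ≤ |x| + B := by
  have h1 := neg_abs_le x
  have h2 := le_abs_self x
  rcases htr with rfl | rfl <;> simp only [abs_le] <;> constructor <;>
    simp only [le_min_iff, le_max_iff, max_le_iff, min_le_iff] <;> grind

/-- Truncation at a level that bounds the target does not increase the error. -/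
lemma abs_truncation_sub_le (htr : tr ∈ truncations) {B y : ℝ} (hy : |y| ≤ B) (x : ℝ) :
    |tr B x - y| ≤ |x - y| := by
  obtain ⟨h1, h2⟩ := abs_le.1 hy
  rcases htr with rfl | rfl
  · rcases le_total B x with h | h
    · simp only [min_eq_left h]
      rw [abs_of_nonneg (by linarith), abs_of_nonneg (by linarith)]
      linarith
    · simp only [min_eq_right h, le_refl]
  · rcases le_total B x with h | h
    · simp only [min_eq_left h, max_eq_right (show -B ≤ B by linarith)]
      rw [abs_of_nonneg (by linarith), abs_of_nonneg (by linarith)]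
      linarith
    · rcases le_total (-B) x with h' | h'
      · simp only [min_eq_right h, max_eq_right h', le_refl]
      · simp only [min_eq_right h, max_eq_left h']
        rw [abs_of_nonpos (by linarith), abs_of_nonpos (by linarith)]
        linarith

end Truncation

section Eigendecay

/-- The increments of `x ↦ x ^ (-b)` dominate `x ^ (-(b + 1))`, which makes its sums telescope. -/
lemma mul_rpow_le_rpow_sub_rpow {b x : ℝ} (hb : 0 < b) (hx : 1 ≤ x) :
    b * 2 ^ (-(b + 1)) * x ^ (-(b + 1)) ≤ x ^ (-b) - (x + 1) ^ (-b) := by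
  have hx0 : 0 < x := by linarith
  have hy0 : 0 < x + 1 := by linarith
  have h1 : (x + 1) ^ (-b) * (1 + b / (x + 1)) ≤ x ^ (-b) := by
    have h2 : x ^ (-b) = (x + 1) ^ (-b) * (x / (x + 1)) ^ (-b) := by
      rw [← Real.mul_rpow hy0.le (by positivity), mul_div_cancel₀ _ hy0.ne']
    rw [h2]
    gcongr
    rw [Real.rpow_def_of_pos (by positivity)]
    have h3 := Real.log_le_sub_one_of_pos (show 0 < x / (x + 1) by positivity)
    have h4 : x / (x + 1) - 1 = -(1 / (x + 1)) := by field_simp; ring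
    have h5 := Real.add_one_le_exp (Real.log (x / (x + 1)) * -b)
    have h6 : b / (x + 1) = b * (1 / (x + 1)) := by ring
    rw [h4] at h3
    nlinarith
  have h7 : (2 : ℝ) ^ (-(b + 1)) * x ^ (-(b + 1)) ≤ (x + 1) ^ (-(b + 1)) := by
    rw [← Real.mul_rpow (by norm_num) hx0.le]
    exact Real.rpow_le_rpow_of_nonpos hy0 (by linarith) (by linarith)
  have h8 : (x + 1) ^ (-(b + 1)) = (x + 1) ^ (-b) / (x + 1) := by
    rw [neg_add, ← sub_eq_add_neg, Real.rpow_sub_one hy0.ne']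
  calc b * 2 ^ (-(b + 1)) * x ^ (-(b + 1)) ≤ b * (x + 1) ^ (-(b + 1)) := by
        rw [mul_assoc]; gcongr
    _ = (x + 1) ^ (-b) * (1 + b / (x + 1)) - (x + 1) ^ (-b) := by rw [h8]; ring
    _ ≤ _ := by linarith

/-- A polynomial eigendecay bounds the tail of the eigenvalues beyond the index `m / 2`, and the
sum of this tail. -/
lemma exists_tail_bound {lam : ℕ → ℝ} {b C : ℝ} (hb : 0 < b)
    (hlam : ∀ i, lam i ≤ C * ((i : ℝ) + 1) ^ (-(b + 1))) :
    ∃ C', 0 < C' ∧ ∀ m : ℕ, 0 < m → (∀ i, m / 2 ≤ i → lam i ≤ C' * (m : ℝ) ^ (-(b + 1))) ∧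
      ∀ s : Finset ℕ, (∀ i ∈ s, m / 2 ≤ i) → ∑ i ∈ s, lam i ≤ C' * (m : ℝ) ^ (-(b + 1)) * m := by
  set K : ℝ := |C| + 1 with hK
  have hK0 : 0 < K := by positivity
  have hlam' : ∀ i, lam i ≤ K * ((i : ℝ) + 1) ^ (-(b + 1)) := fun i =>
    (hlam i).trans (by gcongr; rw [hK]; linarith [le_abs_self C])
  set q : ℝ := b * 2 ^ (-(b + 1)) with hq
  have hq0 : 0 < q := by positivity
  have hhalf : ∀ (m i : ℕ), m / 2 ≤ i → (m : ℝ) / 2 ≤ i + 1 := fun m i hi => by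
    have : m ≤ 2 * (i + 1) := by omega
    have h : (m : ℝ) ≤ 2 * (i + 1) := by exact_mod_cast this
    linarith
  have hdiv : ∀ (m : ℕ) (x : ℝ), ((m : ℝ) / 2) ^ (-x) = 2 ^ x * (m : ℝ) ^ (-x) := fun m x => by
    rw [Real.div_rpow (by positivity) (by norm_num), Real.rpow_neg (by norm_num : (0:ℝ) ≤ 2)]
    field_simp
  refine ⟨K * 2 ^ (b + 1) + K / q * 2 ^ b, by positivity,
    fun m hm => ⟨fun i hi => ?_, fun s hs => ?_⟩⟩
  · have hm0 : (0 : ℝ) < m := by exact_mod_cast hm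
    calc lam i ≤ K * ((i : ℝ) + 1) ^ (-(b + 1)) := hlam' i
      _ ≤ K * ((m : ℝ) / 2) ^ (-(b + 1)) :=
          mul_le_mul_of_nonneg_left (Real.rpow_le_rpow_of_nonpos (by positivity) (hhalf m i hi)
            (by linarith)) hK0.le
      _ = K * 2 ^ (b + 1) * (m : ℝ) ^ (-(b + 1)) := by rw [hdiv]; ring
      _ ≤ _ := by
          gcongr
          linarith [show 0 ≤ K / q * 2 ^ b by positivity]
  · have hm0 : (0 : ℝ) < m := by exact_mod_cast hm
    have hsub : s ⊆ Finset.Ico (m / 2) (m / 2 + (s.sup id + 1)) := fun i hi => by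
      have h1 : i ≤ s.sup id := Finset.le_sup (f := id) hi
      have h2 := hs i hi
      simp only [Finset.mem_Ico]
      omega
    set f : ℕ → ℝ := fun i => ((i : ℝ) + 1) ^ (-b) with hf
    have hterm : ∀ i : ℕ, lam i ≤ K / q * (f i - f (i + 1)) := fun i => by
      have h := mul_rpow_le_rpow_sub_rpow hb (x := (i : ℝ) + 1)
        (by linarith [(Nat.cast_nonneg i : (0 : ℝ) ≤ i)])
      rw [← hq] at h
      have h' : ((i : ℝ) + 1) ^ (-(b + 1)) ≤ (f i - f (i + 1)) / q := by
        rw [le_div_iff₀ hq0, mul_comm, hf]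
        push_cast
        exact h
      calc lam i ≤ K * ((i : ℝ) + 1) ^ (-(b + 1)) := hlam' i
        _ ≤ K * ((f i - f (i + 1)) / q) := by gcongr
        _ = _ := by ring
    have hmono : ∀ i, 0 ≤ f i - f (i + 1) := fun i => by
      have h := mul_rpow_le_rpow_sub_rpow hb (x := (i : ℝ) + 1)
        (by linarith [(Nat.cast_nonneg i : (0 : ℝ) ≤ i)])
      simp only [hf]
      push_cast
      exact le_trans (by positivity) h
    calc ∑ i ∈ s, lam i ≤ ∑ i ∈ s, K / q * (f i - f (i + 1)) := Finset.sum_le_sum fun i _ => hterm i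
      _ ≤ ∑ i ∈ Finset.Ico (m / 2) (m / 2 + (s.sup id + 1)), K / q * (f i - f (i + 1)) :=
          Finset.sum_le_sum_of_subset_of_nonneg hsub fun i _ _ =>
            mul_nonneg (by positivity) (hmono i)
      _ = K / q * (f (m / 2) - f (m / 2 + (s.sup id + 1))) := by
          rw [← Finset.mul_sum, Finset.sum_Ico_eq_sum_range, Nat.add_sub_cancel_left]
          have := Finset.sum_range_sub' (fun i => f (m / 2 + i)) (s.sup id + 1)
          simp only [add_zero] at this
          rw [← this]
          rfl
      _ ≤ K / q * (2 ^ b * (m : ℝ) ^ (-b)) := by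
          gcongr
          rw [← hdiv]
          have h1 : 0 ≤ f (m / 2 + (s.sup id + 1)) := by positivity
          have h2 : f (m / 2) ≤ ((m : ℝ) / 2) ^ (-b) :=
            Real.rpow_le_rpow_of_nonpos (by positivity) (hhalf m _ le_rfl) (by linarith)
          linarith
      _ = K / q * 2 ^ b * (m : ℝ) ^ (-(b + 1)) * m := by
          rw [neg_add, ← sub_eq_add_neg, Real.rpow_sub_one hm0.ne']
          field_simp
      _ ≤ _ := by
          gcongr
          linarith [show 0 ≤ K * (2 : ℝ) ^ (b + 1) by positivity]

end Eigendecay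

section Density

variable {X W E : Type*} [NormedAddCommGroup X] [NormedSpace ℝ X] [NormedAddCommGroup W]
  [NormedSpace ℝ W] [NormedAddCommGroup E] [NormedSpace ℝ E] {κ κ' : Type*} {x : κ → X} {w : κ' → W}

/-- An approximate preimage can be replaced by a member of a dense sequence. -/
lemma exists_approx_of_denseRange (hx : DenseRange x) (T : X →L[ℝ] E) {v : E} {x₀ : X} {a c : ℝ}
    (h1 : ‖x₀‖ < a) (h2 : ‖T x₀ - v‖ < c) : ∃ l, ‖x l‖ < a ∧ ‖T (x l) - v‖ < c := by
  have ho : IsOpen {y : X | ‖y‖ < a ∧ ‖T y - v‖ < c} :=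
    (isOpen_lt continuous_norm continuous_const).inter
      (isOpen_lt (T.continuous.sub continuous_const).norm continuous_const)
  exact hx.exists_mem_open ho ⟨x₀, h1, h2⟩

/-- Approximate preimages on a dense sequence give approximate preimages everywhere. -/
lemma exists_approx_of_forall_denseRange (hw : DenseRange w) (T : X →L[ℝ] E) (h : W →L[ℝ] E)
    {a c : ℝ} (ha : 0 ≤ a) (hc : 0 < c)
    (H : ∀ l, w l ≠ 0 → ∃ y, ‖y‖ < a * ‖w l‖ ∧ ‖T y - h (w l)‖ < c * ‖w l‖) (v : W) :
    ∃ y, ‖y‖ ≤ 2 * a * ‖v‖ ∧ ‖T y - h v‖ ≤ 3 * c * ‖v‖ := by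
  by_cases hv : v = 0
  · exact ⟨0, by simp [hv], by simp [hv]⟩
  have hv0 : 0 < ‖v‖ := norm_pos_iff.2 hv
  have ho : IsOpen {y : W | y ≠ 0 ∧ ‖y‖ < 2 * ‖v‖ ∧ ‖h y - h v‖ < c * ‖v‖} :=
    isOpen_ne.inter ((isOpen_lt continuous_norm continuous_const).inter
      (isOpen_lt (h.continuous.sub continuous_const).norm continuous_const))
  obtain ⟨l, hl0, hl1, hl2⟩ := hw.exists_mem_open ho
    ⟨v, hv, by linarith, by rw [sub_self, norm_zero]; positivity⟩
  obtain ⟨y, hy1, hy2⟩ := H l hl0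
  refine ⟨y, hy1.le.trans (by nlinarith), ?_⟩
  calc ‖T y - h v‖ ≤ ‖T y - h (w l)‖ + ‖h (w l) - h v‖ := norm_sub_le_norm_sub_add_norm_sub _ _ _
    _ ≤ c * (2 * ‖v‖) + c * ‖v‖ := by
        refine add_le_add (hy2.le.trans ?_) hl2.le
        gcongr
    _ = 3 * c * ‖v‖ := by ring

end Density

section Core

variable {E I : Type*} [NormedAddCommGroup E] [InnerProductSpace ℝ E] {e : I → E} {lam : I → ℝ}
  {m : ℕ} {V G : Fin m → E} {good : Set (Fin m)} {s₀ : Finset I} {t ρ : ℝ}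

open Classical in
/-- The deterministic core: if the matrix of the leading normalised coefficients of the good draws
`V j` is well conditioned, if the trailing coefficients form a bounded operator and if `G j` is
close to `V j` for the good draws, then every combination of the leading eigenfunctions is close to
a combination of the `G j` with a small coefficient vector. -/
lemma exists_coefficients (he : Orthonormal ℝ e) (hlam : ∀ i, 0 < lam i)
    (hV : ∀ j, V j ∈ (Submodule.span ℝ (Set.range e)).topologicalClosure)
    (hm : 0 < m)
    (hlow : ∀ w : EuclideanSpace ℝ s₀, m / 4000000 * ‖w‖ ^ 2 ≤
      ∑ j, (if j ∈ good then ∑ i, w i * (inner ℝ (e i) (V j) / √(lam i)) else 0) ^ 2)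
    (htail : ∀ (s : Finset I) (θ : EuclideanSpace ℝ (Fin m)), Disjoint s s₀ →
      ∑ i ∈ s, lam i * (∑ j, θ j * (inner ℝ (e i) (V j) / √(lam i))) ^ 2 ≤ 64 * t * m * ‖θ‖ ^ 2)
    (hρ : ∃ D : Fin m → ℝ, (∀ j ∈ good, ‖G j - V j‖ ≤ D j) ∧ ∑ j, D j ^ 2 ≤ m * ρ ^ 2)
    (hρ0 : 0 ≤ ρ) (w : EuclideanSpace ℝ s₀) :
    ∃ θ : EuclideanSpace ℝ (Fin m), √m * ‖θ‖ ≤ 2000 * ‖w‖ ∧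
      ‖∑ j, θ j • G j - ∑ i, (w i * √(lam i)) • e i‖ ≤ √m * ‖θ‖ * (ρ + √(64 * t)) := by
  have hm0 : (0 : ℝ) < m := by exact_mod_cast hm
  set a : I → Fin m → ℝ := fun i j => inner ℝ (e i) (V j) / √(lam i) with ha
  obtain ⟨v, θ', hθv, hθw, hθ⟩ := exists_min_norm_preimage
    (fun (j : Fin m) (i : s₀) => if j ∈ good then a i j else 0) (c := √m / 2000) (by positivity)
    (fun w => by
      refine le_trans (le_of_eq ?_) ((hlow w).trans (le_of_eq ?_))
      · rw [div_pow, Real.sq_sqrt hm0.le]; norm_num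
      · refine Finset.sum_congr rfl fun j _ => ?_
        by_cases hj : j ∈ good <;> simp [hj, ha]) w
  refine ⟨θ', ?_, ?_⟩
  · linarith
  -- the solution of least norm is a combination of the rows, so it vanishes off the good draws
  have hbad : ∀ j, j ∉ good → θ' j = 0 := fun j hj => by
    rw [hθv]; simp [hj]
  have hw : ∀ i : s₀, ∑ j, θ' j * a i j = w i := fun i => by
    rw [← hθw i]
    refine Finset.sum_congr rfl fun j _ => ?_
    by_cases hj : j ∈ good
    · simp [hj]
    · simp [hbad j hj]
  set v : E := ∑ j, θ' j • V j with hv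
  have hinner : ∀ i, inner ℝ (e i) v = √(lam i) * ∑ j, θ' j * a i j := fun i => by
    rw [hv, inner_sum, Finset.mul_sum]
    refine Finset.sum_congr rfl fun j _ => ?_
    have := (Real.sqrt_pos.2 (hlam i)).ne'
    rw [real_inner_smul_right, ha]
    field_simp
  have h1 : ‖∑ j, θ' j • G j - v‖ ≤ √m * ‖θ'‖ * ρ := by
    obtain ⟨D, hD, hDsum⟩ := hρ
    calc ‖∑ j, θ' j • G j - v‖ = ‖∑ j, θ' j • (G j - V j)‖ := by
          rw [hv, ← Finset.sum_sub_distrib]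
          simp only [smul_sub]
      _ ≤ ∑ j, |θ' j| * |D j| := by
          refine (norm_sum_le _ _).trans (Finset.sum_le_sum fun j _ => ?_)
          rw [norm_smul, Real.norm_eq_abs]
          by_cases hj : j ∈ good
          · gcongr
            exact (hD j hj).trans (le_abs_self _)
          · simp [hbad j hj]
      _ ≤ √(∑ j, |θ' j| ^ 2) * √(∑ j, |D j| ^ 2) := Real.sum_mul_le_sqrt_mul_sqrt _ _ _
      _ ≤ ‖θ'‖ * (√m * ρ) := by
          simp only [sq_abs]
          rw [EuclideanSpace.norm_eq]
          simp only [Real.norm_eq_abs, sq_abs]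
          gcongr
          rw [← Real.sqrt_sq hρ0, ← Real.sqrt_mul hm0.le]
          exact Real.sqrt_le_sqrt hDsum
      _ = √m * ‖θ'‖ * ρ := by ring
  have h2 : ‖v - ∑ i : s₀, (w i * √(lam i)) • e i‖ ≤ √m * ‖θ'‖ * √(64 * t) := by
    have h3 : ∑ i : s₀, (w i * √(lam i)) • e i = ∑ i ∈ s₀, (inner ℝ (e i) v : ℝ) • e i := by
      rw [← Finset.sum_coe_sort s₀ fun i => (inner ℝ (e i) v : ℝ) • e i]
      refine Finset.sum_congr rfl fun i _ => ?_
      rw [hinner, hw, mul_comm]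
    have hvm : v ∈ (Submodule.span ℝ (Set.range e)).topologicalClosure :=
      Submodule.sum_mem _ fun j _ => Submodule.smul_mem _ _ (hV j)
    rw [h3]
    refine (norm_sub_sum_inner_smul_le he hvm (t := 64 * t * m * ‖θ'‖ ^ 2)
      fun s hs => ?_).trans (le_of_eq ?_)
    · refine le_trans (le_of_eq ?_) (htail s θ' hs)
      refine Finset.sum_congr rfl fun i _ => ?_
      rw [hinner, mul_pow, Real.sq_sqrt (hlam i).le]
    · rw [Real.sqrt_mul' _ (sq_nonneg _), Real.sqrt_sq (norm_nonneg _),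
        Real.sqrt_mul' _ hm0.le]
      ring
  calc ‖∑ j, θ' j • G j - ∑ i : s₀, (w i * √(lam i)) • e i‖
      ≤ ‖∑ j, θ' j • G j - v‖ + ‖v - ∑ i : s₀, (w i * √(lam i)) • e i‖ :=
        norm_sub_le_norm_sub_add_norm_sub _ _ _
    _ ≤ _ := by rw [mul_add]; exact add_le_add h1 h2

end Core

/-! ### Approximation of the leading eigenfunctions with high probability -/

lemma eLpNorm_two_sq {α : Type*} [MeasurableSpace α] {μ : Measure α} (f : α → ℝ) :
    eLpNorm f 2 μ ^ 2 = ∫⁻ x, ‖f x‖ₑ ^ 2 ∂μ := by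
  have h := eLpNorm_nnreal_pow_eq_lintegral (μ := μ) (f := f) (p := 2) two_ne_zero
  simpa using h

lemma measurable_eLpNorm_section {U Z : Type*} [MeasurableSpace U] [MeasurableSpace Z]
    {P : Measure Z} [SFinite P] {f : U → Z → ℝ} (hf : Measurable (Function.uncurry f)) :
    Measurable fun u => eLpNorm (f u) 2 P := by
  have h : (fun u => eLpNorm (f u) 2 P) = fun u => (∫⁻ z, ‖f u z‖ₑ ^ 2 ∂P) ^ (1 / 2 : ℝ) := by
    ext u
    rw [← eLpNorm_two_sq, ← ENNReal.rpow_natCast, ← ENNReal.rpow_mul]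
    norm_num
  rw [h]
  exact (hf.enorm.pow_const 2).lintegral_prod_right'.pow_const _

section GoodDraws

variable {Z U : Type*} [MeasurableSpace Z] [MeasurableSpace U] {k : Z → Z → ℝ} {P : Measure Z}
  [IsProbabilityMeasure P] {ν : Measure U} [IsProbabilityMeasure ν] {g : U → Z → ℝ}

/-- The draws that are bounded by `B`, up to a `P`-null set. -/
def boundedDraws (P : Measure Z) (g : U → Z → ℝ) (B : ℝ) : Set U := {u | ∀ᵐ x ∂P, |g u x| ≤ B}

omit [IsProbabilityMeasure P] [MeasurableSpace U] in
lemma boundedDraws_mono : Monotone (boundedDraws P g) := fun _ _ h _ hu => by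
  simp only [boundedDraws, Set.mem_ofPred_eq] at hu ⊢
  filter_upwards [hu] with x hx using hx.trans h

lemma measurableSet_boundedDraws (hg : Measurable (Function.uncurry g)) (B : ℝ) :
    MeasurableSet (boundedDraws P g B) := by
  have hS : MeasurableSet {p : U × Z | ¬ |g p.1 p.2| ≤ B} :=
    (measurableSet_le (continuous_abs.measurable.comp hg) measurable_const).compl
  have h : boundedDraws P g B = {u | P (Prod.mk u ⁻¹' {p : U × Z | ¬ |g p.1 p.2| ≤ B}) = 0} := rfl
  rw [h]
  exact measurable_measure_prodMk_left hS (measurableSet_singleton 0)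

/-- The draws are bounded by a common constant with probability close to one. -/
lemma IsBoundedGPPrior.exists_measure_boundedDraws_compl_le (hg : IsBoundedGPPrior k P ν g)
    {ε : ℝ≥0∞} (hε : 0 < ε) : ∃ B, 0 ≤ B ∧ ν (boundedDraws P g B)ᶜ ≤ ε := by
  have hanti : Antitone fun N : ℕ => (boundedDraws P g N)ᶜ := fun N M h =>
    Set.compl_subset_compl.2 (boundedDraws_mono (by exact_mod_cast h))
  have hlim := tendsto_measure_iInter_atTop (μ := ν) (s := fun N : ℕ => (boundedDraws P g N)ᶜ)
    (fun N => (measurableSet_boundedDraws hg.measurable N).compl.nullMeasurableSet) hanti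
    ⟨0, measure_ne_top _ _⟩
  have h0 : ν (⋂ N : ℕ, (boundedDraws P g N)ᶜ) = 0 := by
    refine measure_mono_null (t := {u | ¬ eLpNorm (g u) ∞ P < ∞}) (fun u hu hfin => ?_) hg.sup_norm
    obtain ⟨N, hN⟩ := exists_nat_ge (eLpNorm (g u) ∞ P).toReal
    refine Set.mem_iInter.1 hu N ?_
    simp only [boundedDraws, Set.mem_ofPred_eq]
    rw [eLpNorm_exponent_top] at hN hfin
    filter_upwards [ae_le_eLpNormEssSup (f := g u) (μ := P)] with x hx
    rw [← Real.norm_eq_abs, ← toReal_enorm]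
    exact (ENNReal.toReal_mono hfin.ne hx).trans hN
  rw [h0] at hlim
  obtain ⟨N, hN⟩ := (hlim.eventually (Iic_mem_nhds hε)).exists
  exact ⟨N, Nat.cast_nonneg N, hN⟩

end GoodDraws

section Denoised

variable {Z U Ω : Type*} [MeasurableSpace Z] [MeasurableSpace U] [MeasurableSpace Ω]
  {k : Z → Z → ℝ} {P : Measure Z} {ν : Measure U} {g : U → Z → ℝ} {κ : Kernel U (Z × ℝ)}
  {A : (n : ℕ) → (Fin n → Z × ℝ) → Z → ℝ} {ξ : ℕ → ℝ}
  {tr : ℝ → ℝ → ℝ} {Ck : ℝ}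
  {Q : Measure Ω} {n m : ℕ} {u : Fin m → Ω → U} {z : Fin n → Ω → Z}
  {e : Fin n → Fin m → Ω → ℝ} {lam : ℕ → ℝ} {psi : ℕ → Lp ℝ 2 P}

lemma measurable_denoised (hA : IsRegressionOracle P ν g κ A ξ) (htr : tr ∈ truncations)
    (j : Fin m) : Measurable (Function.uncurry fun (D : Fin n → Z × (Fin m → ℝ)) x =>
      denoised A tr Ck D j x) := by
  refine (measurable_truncation htr _).comp ((hA.measurable n).comp
    (Measurable.prodMk (measurable_pi_lambda _ fun i => ?_) measurable_snd))
  have h : Measurable fun p : (Fin n → Z × (Fin m → ℝ)) × Z => p.1 i :=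
    (measurable_pi_apply i).comp measurable_fst
  exact h.fst.prodMk ((measurable_pi_apply j).comp h.snd)

/-- The indices of the leading eigenfunctions. -/
abbrev leadingIndices (lam : ℕ → ℝ) (r : ℕ) : Finset {i : ℕ // 0 < lam i} :=
  (Finset.range r).subtype fun i => 0 < lam i

/-- All the combinations of the leading `m / 2` eigenfunctions are approximated, up to an error
proportional to `ρ`, by combinations of the square integrable functions `G j`. The eigenfunctions
carry the weights `√(lam i)`, so that `‖w‖` is a norm in the reproducing kernel Hilbert space. The
error is measured relative to `√m ‖θ‖`. -/
def ApproximatesLeading (P : Measure Z) (lam : ℕ → ℝ)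
    (psi : ℕ → Lp ℝ 2 P) (ρ : ℝ) (G : Fin m → Z → ℝ) : Prop :=
  (∀ j, MemLp (G j) 2 P) ∧ ∀ w : EuclideanSpace ℝ (leadingIndices lam (m / 2)),
    ∃ θ : EuclideanSpace ℝ (Fin m), √m * ‖θ‖ ≤ 2000 * ‖w‖ ∧
      ‖∑ j, θ j • sectionLp P G j - ∑ i, (w i * √(lam i)) • psi i‖ ≤ √m * ‖θ‖ * ρ

variable [IsProbabilityMeasure P]

open Classical in
/-- The estimates approximate the leading eigenfunctions as soon as the coefficients of the draws
satisfy the quadratic bounds that hold with high probability and the raw estimates `r j` have small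
total error. -/
lemma approximatesLeading_of_quadratic_bounds (hM : IsMercerSystem k P lam psi)
    (htr : tr ∈ truncations) {B : ℝ} (hB : 0 ≤ B) (hm : 0 < m) {f r : Fin m → Z → ℝ}
    (hr : ∀ j, Measurable (r j)) (hf : ∀ j, MemLp (f j) 2 P)
    (hspan : ∀ j, sectionLp P f j ∈ (Submodule.span ℝ
      (Set.range fun i : {i : ℕ // 0 < lam i} => psi i)).topologicalClosure) {t ρ : ℝ}
    (hlow : ∀ w : EuclideanSpace ℝ (leadingIndices lam (m / 2)), m / 4000000 * ‖w‖ ^ 2 ≤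
      ∑ j, (if ∀ᵐ x ∂P, |f j x| ≤ B then
        ∑ i, w i * (inner ℝ (psi i) (sectionLp P f j) / √(lam i)) else 0) ^ 2)
    (htail : ∀ (s : Finset {i : ℕ // 0 < lam i}) (θ : EuclideanSpace ℝ (Fin m)),
      Disjoint s (leadingIndices lam (m / 2)) →
      ∑ i ∈ s, lam i * (∑ j, θ j * (inner ℝ (psi i) (sectionLp P f j) / √(lam i))) ^ 2 ≤
        64 * t * m * ‖θ‖ ^ 2)
    (hsmall : ∑ j, ∫⁻ x, ‖r j x - f j x‖ₑ ^ 2 ∂P < ENNReal.ofReal (m * ρ ^ 2)) (hρ : 0 ≤ ρ) :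
    ApproximatesLeading P lam psi (ρ + √(64 * t)) fun j x => tr B (r j x) := by
  set G : Fin m → Z → ℝ := fun j x => tr B (r j x) with hG
  have herrfin : ∀ j, ∫⁻ x, ‖r j x - f j x‖ₑ ^ 2 ∂P ≠ ∞ := fun j =>
    ((Finset.single_le_sum (f := fun j => ∫⁻ x, ‖r j x - f j x‖ₑ ^ 2 ∂P) (fun _ _ => zero_le)
      (Finset.mem_univ j)).trans_lt (hsmall.trans ENNReal.ofReal_lt_top)).ne
  have hsub : ∀ j, MemLp (fun x => r j x - f j x) 2 P := fun j => by
    refine ⟨(hr j).aestronglyMeasurable.sub (hf j).1, lt_top_iff_ne_top.2 fun hcon => ?_⟩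
    have h := eLpNorm_two_sq (μ := P) fun x => r j x - f j x
    rw [hcon] at h
    exact herrfin j (by rw [← h]; simp)
  have hrL : ∀ j, MemLp (r j) 2 P := fun j =>
    (memLp_congr_ae (ae_of_all _ fun x => by simp)).1 ((hsub j).add (hf j))
  have hGL : ∀ j, MemLp (G j) 2 P := fun j => by
    refine MemLp.mono (g := fun x => |r j x| + B) ((hrL j).abs.add (memLp_const _))
      ((measurable_truncation htr _).comp (hr j)).aestronglyMeasurable (ae_of_all _ fun x => ?_)
    rw [Real.norm_eq_abs, Real.norm_eq_abs]
    exact (abs_truncation_le htr hB _).trans (le_abs_self _)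
  refine ⟨hGL, fun w => exists_coefficients (e := fun i : {i : ℕ // 0 < lam i} => psi i)
    (lam := fun i => lam i) (G := sectionLp P G) (V := sectionLp P f)
    (good := {j | ∀ᵐ x ∂P, |f j x| ≤ B}) hM.orthonormal (fun i => i.2) hspan hm hlow htail
    ⟨fun j => (eLpNorm (fun x => r j x - f j x) 2 P).toReal, fun j hj => ?_, ?_⟩ hρ w⟩
  · rw [sectionLp_of_memLp (hGL j), sectionLp_of_memLp (hf j), ← MemLp.toLp_sub, Lp.norm_toLp]
    refine ENNReal.toReal_mono (hsub j).2.ne (eLpNorm_mono_ae ?_)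
    filter_upwards [hj] with x hx
    exact abs_truncation_sub_le htr hx _
  · rw [← ENNReal.toReal_ofReal (show 0 ≤ m * ρ ^ 2 by positivity)]
    simp_rw [← ENNReal.toReal_pow, eLpNorm_two_sq]
    rw [← ENNReal.toReal_sum fun j _ => herrfin j]
    exact ENNReal.toReal_mono ENNReal.ofReal_ne_top hsmall.le

variable [IsProbabilityMeasure ν] [IsMarkovKernel κ] [IsProbabilityMeasure Q]

/-- The estimates approximate the leading eigenfunctions with high probability. The bound adds up
the failure probabilities of the lower bound for the leading coefficients, of the upper bound for
the trailing coefficients and of Markov's inequality for the total error of the raw estimates. -/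
lemma measure_not_approximatesLeading_le (hg : IsBoundedGPPrior k P ν g) {B : ℝ}
    (hB : ∀ z z', |k z z'| ≤ B) (hM : IsMercerSystem k P lam psi)
    (hA : IsRegressionOracle P ν g κ A ξ) (htr : tr ∈ truncations)
    (h : IsSharedDataset ν κ Q u z e) (hn : 0 < n) (hm : 0 < m) (hCk : 0 ≤ Ck * Real.log n)
    (hbd : ν (boundedDraws P g (Ck * Real.log n))ᶜ ≤ ENNReal.ofReal (1 / 4000))
    {t ρ : ℝ} (ht : 0 < t) (hρ : 0 < ρ) (hlam : ∀ i, m / 2 ≤ i → lam i ≤ t)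
    (hsum : ∀ s : Finset ℕ, (∀ i ∈ s, m / 2 ≤ i) → ∑ i ∈ s, lam i ≤ t * m) :
    Q {ω | ¬ ApproximatesLeading P lam psi (ρ + √(64 * t))
      (denoised A tr Ck (sharedData g u z e ω))} ≤
      ENNReal.ofReal (Real.exp (-m)) + ENNReal.ofReal ((1 / 2) ^ m) +
        ENNReal.ofReal (Real.exp (-m)) + ENNReal.ofReal (ξ n ^ 2 / ρ ^ 2) := by
  classical
  have hm0 : (0 : ℝ) < m := by exact_mod_cast hm
  set S := (boundedDraws P g (Ck * Real.log n))ᶜ with hS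
  have hSm : MeasurableSet S := (measurableSet_boundedDraws hg.measurable _).compl
  set s₀ := leadingIndices lam (m / 2) with hs₀
  have hstd := hg.isStdGaussianFamily_coeff hB hM
  have hcard : 2 * Fintype.card s₀ ≤ m := by
    have h1 : s₀.card ≤ m / 2 := by
      rw [hs₀, Finset.card_subtype]
      exact (Finset.card_filter_le _ _).trans (by simp)
    rw [Fintype.card_coe]
    omega
  have h1 := measure_exists_sum_indicator_sq_lt_le (ι := s₀)
    (hstd.comp Subtype.val_injective) h.measurable_draw h.indep_draws h.law_draw hcard hSm hbd
  -- the weights of the trailing coefficients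
  set σ : {i : ℕ // 0 < lam i} → ℝ := fun i => if i.1 < m / 2 then 0 else lam i with hσ
  have hσsum : ∀ s : Finset {i : ℕ // 0 < lam i}, ∑ i ∈ s, σ i ≤ t * m := fun s => by
    have h2 : ∑ i ∈ s, σ i = ∑ i ∈ (s.filter fun i => ¬ i.1 < m / 2).map
        (Function.Embedding.subtype _), lam i := by
      rw [Finset.sum_map, Finset.sum_filter]
      refine Finset.sum_congr rfl fun i _ => ?_
      by_cases hi : i.1 < m / 2 <;> simp [hσ, hi]
    rw [h2]
    refine hsum _ fun i hi => ?_
    simp only [Finset.mem_map, Finset.mem_filter] at hi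
    obtain ⟨i, ⟨_, hi⟩, rfl⟩ := hi
    exact not_lt.1 hi
  have h2 := measure_exists_finset_quadratic_gt_le hstd h.measurable_draw h.indep_draws h.law_draw
    (σ := σ) ht (fun i => by by_cases hi : i.1 < m / 2 <;> simp [hσ, hi, i.2.le])
    (fun i => by
      by_cases hi : i.1 < m / 2
      · simp [hσ, hi, ht.le]
      · simp only [hσ, hi, if_false]; exact hlam i (not_lt.1 hi)) hσsum
  -- the raw estimates and their errors
  let raw : Ω → Fin m → Z → ℝ := fun ω j => A n fun i => (z i ω, g (u j ω) (z i ω) + e i j ω)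
  let err : Fin m → Ω → ℝ≥0∞ := fun j ω => ∫⁻ x, ‖raw ω j x - g (u j ω) x‖ₑ ^ 2 ∂P
  have hraw : ∀ j, Measurable (Function.uncurry fun ω x => raw ω j x) := fun j => by
    refine (hA.measurable n).comp (Measurable.prodMk (measurable_pi_lambda _ fun i => ?_)
      measurable_snd)
    have hz := (h.measurable_instrument i).comp (measurable_fst : Measurable (Prod.fst : Ω × Z → Ω))
    have hu := (h.measurable_draw j).comp (measurable_fst : Measurable (Prod.fst : Ω × Z → Ω))
    have he := (h.measurable_noise i j).comp (measurable_fst : Measurable (Prod.fst : Ω × Z → Ω))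
    exact hz.prodMk ((hg.measurable.comp (hu.prodMk hz)).add he)
  have hgu : ∀ j, Measurable (Function.uncurry fun ω x => g (u j ω) x) := fun j =>
    hg.measurable.comp (((h.measurable_draw j).comp measurable_fst).prodMk measurable_snd)
  have herr : ∀ j, Measurable (err j) := fun j =>
    (((hraw j).sub (hgu j)).enorm.pow_const 2).lintegral_prod_right'
  have h3 : Q {ω | ENNReal.ofReal (m * ρ ^ 2) ≤ ∑ j, err j ω} ≤
      ENNReal.ofReal (ξ n ^ 2 / ρ ^ 2) := by
    have h4 := mul_meas_ge_le_lintegral₀ (μ := Q) (f := fun ω => ∑ j, err j ω)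
      (Finset.measurable_fun_sum _ fun j _ => herr j).aemeasurable (ENNReal.ofReal (m * ρ ^ 2))
    rw [lintegral_finsetSum _ fun j _ => herr j] at h4
    have h5 : ∑ j, ∫⁻ ω, err j ω ∂Q ≤ ENNReal.ofReal (m * ξ n ^ 2) := by
      refine (Finset.sum_le_sum fun j _ => hA.lintegral_error_le hg.measurable h hn j).trans ?_
      rw [Finset.sum_const, Finset.card_univ, Fintype.card_fin, nsmul_eq_mul,
        ENNReal.ofReal_mul hm0.le, ENNReal.ofReal_natCast]
    have h6 : ENNReal.ofReal (ξ n ^ 2 / ρ ^ 2) =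
        ENNReal.ofReal (m * ξ n ^ 2) / ENNReal.ofReal (m * ρ ^ 2) := by
      rw [← ENNReal.ofReal_div_of_pos (by positivity)]
      congr 1
      field_simp
    rw [h6, ENNReal.le_div_iff_mul_le (Or.inl (by
      rw [Ne, ENNReal.ofReal_eq_zero, not_le]; positivity)) (Or.inl ENNReal.ofReal_ne_top),
      mul_comm]
    exact h4.trans h5
  have hae : ∀ᵐ ω ∂Q, ∀ j, MemLp (g (u j ω)) 2 P ∧ sectionLp P g (u j ω) ∈
      (Submodule.span ℝ (Set.range fun i : {i : ℕ // 0 < lam i} => psi i)).topologicalClosure := by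
    rw [ae_all_iff]
    intro j
    have h4 := hg.ae_memLp.and (hg.ae_mem_closure_span hB hM)
    rw [← h.law_draw j] at h4
    exact ae_of_ae_map (h.measurable_draw j).aemeasurable h4
  have hsub : {ω | ¬ ApproximatesLeading P lam psi (ρ + √(64 * t))
      (denoised A tr Ck (sharedData g u z e ω))} ⊆
      (({ω | ¬ ∀ w : EuclideanSpace ℝ s₀, m / 4000000 * ‖w‖ ^ 2 ≤
        ∑ j, (Sᶜ.indicator (fun v => ∑ i, w i * IsBoundedGPPrior.coeff P g lam psi i.1 v)
          (u j ω)) ^ 2} ∪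
      {ω | ¬ ∀ (s : Finset {i : ℕ // 0 < lam i}) (θ : EuclideanSpace ℝ (Fin m)),
        ∑ i ∈ s, σ i * (∑ j, θ j * IsBoundedGPPrior.coeff P g lam psi i (u j ω)) ^ 2 ≤
          64 * t * m * ‖θ‖ ^ 2}) ∪ {ω | ENNReal.ofReal (m * ρ ^ 2) ≤ ∑ j, err j ω}) ∪
      {ω | ¬ ∀ j, MemLp (g (u j ω)) 2 P ∧ sectionLp P g (u j ω) ∈ (Submodule.span ℝ
        (Set.range fun i : {i : ℕ // 0 < lam i} => psi i)).topologicalClosure} := by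
    intro ω hω
    by_contra hcon
    simp only [Set.mem_union, not_or, Set.mem_ofPred_eq, not_not, not_le] at hcon
    obtain ⟨⟨⟨hlow, htail⟩, hsmall⟩, hspan⟩ := hcon
    apply hω
    set G := denoised A tr Ck (sharedData g u z e ω) with hG
    refine approximatesLeading_of_quadratic_bounds hM htr hCk hm (f := fun j => g (u j ω))
      (r := raw ω) (fun j => (hraw j).comp measurable_prodMk_left) (fun j => (hspan j).1)
      (fun j => (hspan j).2) (fun w => ?_) (fun s θ hs => ?_) hsmall hρ.le
    · refine (hlow w).trans (le_of_eq (Finset.sum_congr rfl fun j _ => ?_))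
      have hj : u j ω ∈ Sᶜ ↔ ∀ᵐ x ∂P, |g (u j ω) x| ≤ Ck * Real.log n := by
        rw [hS, compl_compl]; rfl
      simp only [Set.indicator, hj]
      rfl
    · refine le_trans (le_of_eq (Finset.sum_congr rfl fun i hi => ?_)) (htail s θ)
      have hi' : ¬ i.1 < m / 2 := fun hlt => Finset.disjoint_left.1 hs hi (by
        simpa [hs₀] using hlt)
      simp only [hσ, hi', if_false]
      rfl
  refine (measure_mono hsub).trans ?_
  refine (measure_union_le _ _).trans ?_
  rw [show Q {ω | ¬ ∀ j, MemLp (g (u j ω)) 2 P ∧ sectionLp P g (u j ω) ∈ (Submodule.span ℝ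
        (Set.range fun i : {i : ℕ // 0 < lam i} => psi i)).topologicalClosure} = 0 from hae,
    add_zero]
  refine (measure_union_le _ _).trans (add_le_add ?_ h3)
  exact (measure_union_le _ _).trans (add_le_add h1 h2)

end Denoised

/-! ### The event in terms of the data -/

section Event

/-- The linear combinations of a finite family of vectors, as a function of the coefficients. -/
def linearCombinationCLM {ι E : Type*} [Fintype ι] [NormedAddCommGroup E] [NormedSpace ℝ E]
    (v : ι → E) : EuclideanSpace ℝ ι →L[ℝ] E :=
  ∑ i, (EuclideanSpace.proj i : EuclideanSpace ℝ ι →L[ℝ] ℝ).smulRight (v i)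

lemma linearCombinationCLM_apply {ι E : Type*} [Fintype ι] [NormedAddCommGroup E]
    [NormedSpace ℝ E] (v : ι → E) (c : EuclideanSpace ℝ ι) :
    linearCombinationCLM v c = ∑ i, c i • v i := by
  simp [linearCombinationCLM]

variable {Z : Type*} [MeasurableSpace Z] {P : Measure Z}
  {lam : ℕ → ℝ} {psi : ℕ → Lp ℝ 2 P} {m : ℕ} {G : Fin m → Z → ℝ} {ρ : ℝ}

/-- The combination of the leading eigenfunctions, weighted by the square roots of their
eigenvalues, with the coefficients `w`. -/
def leadingCombination (lam : ℕ → ℝ) (psi : ℕ → Lp ℝ 2 P) (r : ℕ) :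
    EuclideanSpace ℝ (leadingIndices lam r) →L[ℝ] Lp ℝ 2 P :=
  linearCombinationCLM fun i => √(lam i) • psi i

lemma leadingCombination_apply (r : ℕ) (w : EuclideanSpace ℝ (leadingIndices lam r)) :
    leadingCombination lam psi r w = ∑ i, (w i * √(lam i)) • psi i := by
  rw [leadingCombination, linearCombinationCLM_apply]
  simp only [mul_smul]

lemma eLpNorm_sum_sub (hG : ∀ j, MemLp (G j) 2 P) (θ : EuclideanSpace ℝ (Fin m)) (F : Lp ℝ 2 P) :
    eLpNorm (fun x => ∑ j, θ j * G j x - F x) 2 P =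
      ENNReal.ofReal ‖linearCombinationCLM (sectionLp P G) θ - F‖ := by
  rw [ofReal_norm, Lp.enorm_def, linearCombinationCLM_apply]
  refine eLpNorm_congr_ae ?_
  have h1 : ∀ᵐ x ∂P, ∀ j, (θ j • sectionLp P G j) x = θ j * G j x := by
    rw [ae_all_iff]
    intro j
    filter_upwards [Lp.coeFn_smul (θ j) (sectionLp P G j), coeFn_sectionLp (hG j)] with x h1 h2
    rw [h1, Pi.smul_apply, h2, smul_eq_mul]
  filter_upwards [Lp.coeFn_sub (∑ j, θ j • sectionLp P G j) F,
    coeFn_finsetSum_Lp Finset.univ fun j => θ j • sectionLp P G j, h1] with x h2 h3 h4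
  rw [h2, Pi.sub_apply, h3]
  simp only [h4]

/-- A version of `ApproximatesLeading` with countably many strict inequalities between quantities
that are measurable in the functions `G j`. The constants exceed those of `ApproximatesLeading`, to
leave room for replacing coefficient vectors by members of a dense sequence. -/
def DenselyApproximatesLeading (P : Measure Z) (lam : ℕ → ℝ)
    (psi : ℕ → Lp ℝ 2 P) (ρ : ℝ) (G : Fin m → Z → ℝ) : Prop :=
  (∀ j, MemLp (G j) 2 P) ∧ ∀ k : ℕ,
    TopologicalSpace.denseSeq (EuclideanSpace ℝ (leadingIndices lam (m / 2))) k ≠ 0 → ∃ l : ℕ,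
      ‖TopologicalSpace.denseSeq (EuclideanSpace ℝ (Fin m)) l‖ < 3000 / √m *
        ‖TopologicalSpace.denseSeq (EuclideanSpace ℝ (leadingIndices lam (m / 2))) k‖ ∧
      eLpNorm (fun x => ∑ j, TopologicalSpace.denseSeq (EuclideanSpace ℝ (Fin m)) l j * G j x -
        leadingCombination lam psi (m / 2) (TopologicalSpace.denseSeq _ k) x) 2 P <
        ENNReal.ofReal (3000 * ρ * ‖TopologicalSpace.denseSeq
          (EuclideanSpace ℝ (leadingIndices lam (m / 2))) k‖)

lemma ApproximatesLeading.densely (h : ApproximatesLeading P lam psi ρ G) (hm : 0 < m)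
    (hρ : 0 < ρ) : DenselyApproximatesLeading P lam psi ρ G := by
  have hm0 : 0 < √(m : ℝ) := Real.sqrt_pos.2 (by exact_mod_cast hm)
  refine ⟨h.1, fun k hk => ?_⟩
  set w := TopologicalSpace.denseSeq (EuclideanSpace ℝ (leadingIndices lam (m / 2))) k
  have hw : 0 < ‖w‖ := norm_pos_iff.2 hk
  obtain ⟨θ, hθ, herr⟩ := h.2 w
  rw [← leadingCombination_apply, ← linearCombinationCLM_apply] at herr
  obtain ⟨l, hl1, hl2⟩ := exists_approx_of_denseRange
    (TopologicalSpace.denseRange_denseSeq (EuclideanSpace ℝ (Fin m)))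
    (linearCombinationCLM (sectionLp P G)) (v := leadingCombination lam psi (m / 2) w) (x₀ := θ)
    (a := 3000 / √m * ‖w‖) (c := 3000 * ρ * ‖w‖)
    (by rw [div_mul_eq_mul_div, lt_div_iff₀ hm0]; nlinarith)
    (herr.trans_lt (by nlinarith [mul_pos hρ hw]))
  refine ⟨l, hl1, ?_⟩
  rw [eLpNorm_sum_sub h.1]
  exact (ENNReal.ofReal_lt_ofReal_iff (by positivity)).2 hl2

lemma DenselyApproximatesLeading.exists_coefficients
    (h : DenselyApproximatesLeading P lam psi ρ G) (hm : 0 < m) (hρ : 0 < ρ)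
    (w : EuclideanSpace ℝ (leadingIndices lam (m / 2))) :
    ∃ θ : EuclideanSpace ℝ (Fin m), √m * ‖θ‖ ≤ 6000 * ‖w‖ ∧
      eLpNorm (fun x => ∑ j, θ j * G j x - leadingCombination lam psi (m / 2) w x) 2 P ≤
        ENNReal.ofReal (9000 * ρ * ‖w‖) := by
  have hm0 : 0 < √(m : ℝ) := Real.sqrt_pos.2 (by exact_mod_cast hm)
  obtain ⟨θ, h1, h2⟩ := exists_approx_of_forall_denseRange
    (TopologicalSpace.denseRange_denseSeq (EuclideanSpace ℝ (leadingIndices lam (m / 2))))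
    (linearCombinationCLM (sectionLp P G)) (leadingCombination lam psi (m / 2))
    (a := 3000 / √m) (c := 3000 * ρ) (by positivity) (by positivity) (fun k hk => by
      obtain ⟨l, h1, h2⟩ := h.2 k hk
      refine ⟨_, h1, ?_⟩
      rw [eLpNorm_sum_sub h.1] at h2
      exact (ENNReal.ofReal_lt_ofReal_iff (by
        have := norm_pos_iff.2 hk
        positivity)).1 h2) w
  refine ⟨θ, ?_, ?_⟩
  · calc √m * ‖θ‖ ≤ √m * (2 * (3000 / √m) * ‖w‖) := by gcongr
      _ = 6000 * ‖w‖ := by field_simp; ring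
  · rw [eLpNorm_sum_sub h.1]
    exact ENNReal.ofReal_le_ofReal (h2.trans (by linarith))

lemma ApproximatesLeading.mono {ρ' : ℝ} (h : ApproximatesLeading P lam psi ρ G) (hρ : ρ ≤ ρ') :
    ApproximatesLeading P lam psi ρ' G := by
  refine ⟨h.1, fun w => ?_⟩
  obtain ⟨θ, h1, h2⟩ := h.2 w
  exact ⟨θ, h1, h2.trans (by gcongr)⟩

lemma measurableSet_denselyApproximatesLeading [IsProbabilityMeasure P] {Y : Type*}
    [MeasurableSpace Y]
    {F : Y → Fin m → Z → ℝ} (hF : ∀ j, Measurable (Function.uncurry fun y x => F y j x)) :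
    MeasurableSet {y | DenselyApproximatesLeading P lam psi ρ (F y)} := by
  simp only [DenselyApproximatesLeading, Set.ofPred_and, Set.ofPred_forall, Set.ofPred_exists]
  refine (MeasurableSet.iInter fun j => measurableSet_memLp_section (hF j)).inter
    (MeasurableSet.iInter fun k => MeasurableSet.iInter fun hk => MeasurableSet.iUnion fun l => ?_)
  refine (MeasurableSet.const _).inter (measurableSet_lt ?_ measurable_const)
  refine measurable_eLpNorm_section (f := fun y x => ∑ j, _ * F y j x - _) ?_
  refine Measurable.sub (Finset.measurable_fun_sum _ fun j _ => (hF j).const_mul _) ?_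
  exact (Lp.stronglyMeasurable _).measurable.comp measurable_snd

end Event

section Limits

/-- The failure probability in `measure_not_approximatesLeading_le` vanishes in the limit. -/
lemma tendsto_failure_bound {m : ℕ → ℕ} (hm : Tendsto m atTop atTop) :
    Tendsto (fun n : ℕ => ENNReal.ofReal (Real.exp (-(m n : ℝ))) +
      ENNReal.ofReal ((1 / 2 : ℝ) ^ m n) + ENNReal.ofReal (Real.exp (-(m n : ℝ))) +
      ENNReal.ofReal (1 / Real.log n)) atTop (𝓝 0) := by
  have h1 : Tendsto (fun n : ℕ => ENNReal.ofReal (Real.exp (-(m n : ℝ)))) atTop (𝓝 0) := by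
    rw [← ENNReal.ofReal_zero]
    exact ENNReal.tendsto_ofReal (Real.tendsto_exp_neg_atTop_nhds_zero.comp
      (tendsto_natCast_atTop_atTop.comp hm))
  have h2 : Tendsto (fun n : ℕ => ENNReal.ofReal ((1 / 2 : ℝ) ^ m n)) atTop (𝓝 0) := by
    rw [← ENNReal.ofReal_zero]
    exact ENNReal.tendsto_ofReal
      ((tendsto_pow_atTop_nhds_zero_of_lt_one (by norm_num) (by norm_num)).comp hm)
  have h3 : Tendsto (fun n : ℕ => ENNReal.ofReal (1 / Real.log n)) atTop (𝓝 0) := by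
    rw [← ENNReal.ofReal_zero]
    simp only [one_div]
    exact ENNReal.tendsto_ofReal (tendsto_inv_atTop_zero.comp
      (Real.tendsto_log_atTop.comp tendsto_natCast_atTop_atTop))
  simpa using ((h1.add h2).add h1).add h3

lemma tendsto_measure_one_of_compl {Ω : ℕ → Type*} [∀ n, MeasurableSpace (Ω n)]
    {Q : ∀ n, Measure (Ω n)} [∀ n, IsProbabilityMeasure (Q n)] {E : ∀ n, Set (Ω n)}
    {δ : ℕ → ℝ≥0∞} (hδ : Tendsto δ atTop (𝓝 0)) (h : ∀ᶠ n in atTop, Q n (E n)ᶜ ≤ δ n) :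
    Tendsto (fun n => Q n (E n)) atTop (𝓝 1) := by
  have h1 : Tendsto (fun n => 1 - δ n) atTop (𝓝 1) := by
    simpa using ENNReal.Tendsto.sub tendsto_const_nhds hδ (Or.inl ENNReal.one_ne_top)
  refine tendsto_of_tendsto_of_tendsto_of_le_of_le' h1 tendsto_const_nhds ?_
    (Eventually.of_forall fun n => prob_le_one)
  filter_upwards [h] with n hn
  rw [tsub_le_iff_right, ← measure_univ (μ := Q n), ← Set.union_compl_self (E n)]
  exact (measure_union_le _ _).trans (by gcongr)

end Limits

/-! ### Approximation of the projection -/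

section LatentKernel

variable {Z : Type*} [TopologicalSpace Z] [MeasurableSpace Z] {P : Measure Z} {d : ℕ}
  {Zbar : Set (EuclideanSpace ℝ (Fin d))} {Phi : Z → Zbar} {kbar : Zbar → Zbar → ℝ} {b : ℝ}

lemma IsLatentKernel.inducedKernel_symm (hL : IsLatentKernel P Phi kbar b) (x y : Z) :
    inducedKernel Phi kbar x y = inducedKernel Phi kbar y x := by
  simpa [inducedKernel] using hL.posSemidef.isHermitian.apply (Phi y) (Phi x)

lemma IsLatentKernel.measurable_inducedKernel [OpensMeasurableSpace Z]
    (hL : IsLatentKernel P Phi kbar b) :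
    Measurable (Function.uncurry (inducedKernel Phi kbar)) :=
  hL.measurable_kernel.comp ((hL.continuous_phi.measurable.comp measurable_fst).prodMk
    (hL.continuous_phi.measurable.comp measurable_snd))

end LatentKernel

section Approximation

lemma approxNorm_le {Z : Type*} {m : ℕ} {G : Fin m → Z → ℝ} (θ : EuclideanSpace ℝ (Fin m)) :
    approxNorm G (fun x => ∑ j, θ j * G j x) ≤ √m * ‖θ‖ :=
  csInf_le ⟨0, by rintro _ ⟨θ', -, rfl⟩; positivity⟩ ⟨θ, rfl, rfl⟩

variable {Z : Type*} [MeasurableSpace Z] {P : Measure Z} [IsProbabilityMeasure P]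
  {H : Type*} [NormedAddCommGroup H] [InnerProductSpace ℝ H] [CompleteSpace H] [RKHS ℝ H Z ℝ]
  {k : Z → Z → ℝ} {B : ℝ} {lam : ℕ → ℝ} {psi : ℕ → Lp ℝ 2 P} {m : ℕ} {G : Fin m → Z → ℝ} {ρ : ℝ}

/-- The projection onto the leading eigenfunctions is the combination with the coefficients
`⟪psi i, f⟫ / √(lam i)`, whose Euclidean norm is bounded by the norm of the projection in the
reproducing kernel Hilbert space. -/
lemma exists_leadingCombination_eq_mercerProj (hkH : ∀ x y, RKHS.kernel H x y 1 = k x y)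
    (hk : Measurable (Function.uncurry k)) (hB : ∀ z z', |k z z'| ≤ B)
    (hsymm : ∀ z z', k z z' = k z' z) (hM : IsMercerSystem k P lam psi) (r : ℕ) (f : Lp ℝ 2 P) :
    ∃ w : EuclideanSpace ℝ (leadingIndices lam r),
      leadingCombination lam psi r w = mercerProj lam psi r f ∧
      ‖w‖ ≤ rkhsNorm P H (mercerProj lam psi r f) := by
  refine ⟨WithLp.toLp 2 fun i => (inner ℝ (psi i) f : ℝ) / √(lam i), ?_, ?_⟩
  · rw [leadingCombination_apply, mercerProj, ← Finset.sum_subtype_eq_sum_filter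
      (f := fun i => (inner ℝ (psi i) f : ℝ) • psi i),
      ← Finset.sum_coe_sort (leadingIndices lam r)]
    refine Finset.sum_congr rfl fun i _ => ?_
    simp only
    rw [div_mul_cancel₀ _ (Real.sqrt_pos.2 i.1.2).ne']
  · refine le_trans (le_of_eq ?_) (sum_sq_div_le_rkhsNorm hkH hk hB hsymm hM r f)
    rw [EuclideanSpace.norm_eq]
    congr 1
    rw [← Finset.sum_coe_sort (leadingIndices lam r)]
    refine Finset.sum_congr rfl fun i _ => ?_
    rw [Real.norm_eq_abs, sq_abs, div_pow, Real.sq_sqrt i.1.2.le]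

lemma DenselyApproximatesLeading.exists_approximant
    (h : DenselyApproximatesLeading P lam psi ρ G) (hm : 0 < m) (hρ : 0 < ρ)
    (hkH : ∀ x y, RKHS.kernel H x y 1 = k x y) (hk : Measurable (Function.uncurry k))
    (hB : ∀ z z', |k z z'| ≤ B) (hsymm : ∀ z z', k z z' = k z' z)
    (hM : IsMercerSystem k P lam psi) (f : Lp ℝ 2 P) :
    ∃ gt ∈ approxSpace G,
      approxNorm G gt ≤ 6000 * rkhsNorm P H (mercerProj lam psi (m / 2) f) ∧
      eLpNorm (fun x => gt x - f x) 2 P ≤ ENNReal.ofReal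
        (9000 * ρ * rkhsNorm P H (mercerProj lam psi (m / 2) f) +
          ‖f - mercerProj lam psi (m / 2) f‖) := by
  obtain ⟨w, hw, hwn⟩ := exists_leadingCombination_eq_mercerProj hkH hk hB hsymm hM (m / 2) f
  obtain ⟨θ, h1, h2⟩ := h.exists_coefficients hm hρ w
  refine ⟨fun x => ∑ j, θ j * G j x, ⟨θ, rfl⟩,
    (approxNorm_le θ).trans (h1.trans (by gcongr)), ?_⟩
  rw [eLpNorm_sum_sub h.1] at h2 ⊢
  have h3 := (ENNReal.ofReal_le_ofReal_iff (by positivity)).1 h2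
  rw [hw] at h3
  refine ENNReal.ofReal_le_ofReal ?_
  calc _ ≤ ‖linearCombinationCLM (sectionLp P G) θ - mercerProj lam psi (m / 2) f‖ +
        ‖mercerProj lam psi (m / 2) f - f‖ := norm_sub_le_norm_sub_add_norm_sub _ _ _
    _ ≤ _ := by
        rw [norm_sub_rev _ f]
        gcongr
        exact h3.trans (by gcongr)

end Approximation

end KernelLearning

open KernelLearning in
theorem mainTheorem1 :
    ∃ c_r : ℝ, 0 < c_r ∧
      ∀ (Z : Type*) [TopologicalSpace Z] [MeasurableSpace Z] [OpensMeasurableSpace Z]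
        (P : Measure Z) [IsProbabilityMeasure P]
        (d : ℕ) (Zbar : Set (EuclideanSpace ℝ (Fin d))) (Phi : Z → Zbar)
        (kbar : Zbar → Zbar → ℝ) (b : ℝ)
        -- the reproducing kernel Hilbert space of the induced kernel and a Mercer system
        (H : Type*) [NormedAddCommGroup H] [InnerProductSpace ℝ H] [CompleteSpace H]
        [RKHS ℝ H Z ℝ]
        (lam : ℕ → ℝ) (psi : ℕ → Lp ℝ 2 P)
        -- the Gaussian process prior, the noise model and the regression oracle
        (U : Type*) [MeasurableSpace U] (ν : Measure U) [IsProbabilityMeasure ν]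
        (g : U → Z → ℝ) (κ : Kernel U (Z × ℝ)) [IsMarkovKernel κ]
        (A : (n : ℕ) → (Fin n → Z × ℝ) → Z → ℝ) (ξ : ℕ → ℝ),
        KernelLearning.IsLatentKernel P Phi kbar b →
        (∀ x y, RKHS.kernel H x y 1 = KernelLearning.inducedKernel Phi kbar x y) →
        KernelLearning.IsMercerSystem (KernelLearning.inducedKernel Phi kbar) P lam psi →
        KernelLearning.IsBoundedGPPrior (KernelLearning.inducedKernel Phi kbar) P ν g →
        KernelLearning.IsNoiseModel P ν g κ →
        KernelLearning.IsRegressionOracle P ν g κ A ξ →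
        ∀ (Ck : ℝ), 0 < Ck → ∀ tr ∈ KernelLearning.truncations,
        ∀ (m : ℕ → ℕ), Tendsto m atTop atTop →
        ∀ (Ω : ℕ → Type*) [∀ n, MeasurableSpace (Ω n)] (Q : ∀ n, Measure (Ω n))
          [∀ n, IsProbabilityMeasure (Q n)]
          (u : ∀ n, Fin (m n) → Ω n → U) (z : ∀ n, Fin n → Ω n → Z)
          (e : ∀ n, Fin n → Fin (m n) → Ω n → ℝ),
        (∀ n, KernelLearning.IsSharedDataset ν κ (Q n) (u n) (z n) (e n)) →
        ∃ E : ∀ n, Set (Ω n),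
          (∀ n, MeasurableSet[KernelLearning.dataSigma g (u n) (z n) (e n)] (E n)) ∧
          Tendsto (fun n => Q n (E n)) atTop (𝓝 1) ∧
          ∀ n, ∀ ω ∈ E n, ∀ gstar : Lp ℝ 2 P,
            ∃ gt ∈ KernelLearning.approxSpace (KernelLearning.denoised A tr Ck
                (KernelLearning.sharedData g (u n) (z n) (e n) ω)),
              KernelLearning.approxNorm (KernelLearning.denoised A tr Ck
                  (KernelLearning.sharedData g (u n) (z n) (e n) ω)) gt
                ≤ c_r * KernelLearning.rkhsNorm P H
                    (KernelLearning.mercerProj lam psi (m n / 2) gstar) ∧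
              eLpNorm (fun x => gt x - gstar x) 2 P ≤ ENNReal.ofReal
                (c_r * KernelLearning.rkhsNorm P H
                    (KernelLearning.mercerProj lam psi (m n / 2) gstar)
                  * (ξ n + (m n : ℝ) ^ (-(b + 1) / 2)) * Real.sqrt (Real.log n)
                  + ‖gstar - KernelLearning.mercerProj lam psi (m n / 2) gstar‖) := by
  refine ⟨18000, by norm_num, ?_⟩
  intro Z _ _ _ P _ d Zbar Phi kbar b H _ _ _ _ lam psi U _ ν _ g κ _ A ξ hL hkH hM hg _ hA Ck hCk
    tr htr m hm Ω _ Q _ u z e h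
  obtain ⟨B, hB⟩ := hL.bounded_kernel
  have hkB : ∀ x y, |inducedKernel Phi kbar x y| ≤ B := fun x y => hB _ _
  obtain ⟨C, hC⟩ := hL.eigenvalue_le hM
  obtain ⟨C', hC'0, hC'⟩ := exists_tail_bound hL.b_pos hC
  obtain ⟨B₀, hB₀, hνB₀⟩ := hg.exists_measure_boundedDraws_compl_le
    (ε := ENNReal.ofReal (1 / 4000)) (by simp)
  set ρ : ℕ → ℝ := fun n => (ξ n + (m n : ℝ) ^ (-(b + 1) / 2)) * √(Real.log n) with hρ
  have hρn : ∀ n, ρ n = (ξ n + (m n : ℝ) ^ (-(b + 1) / 2)) * √(Real.log n) := fun n => rfl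
  have hρ0 : ∀ n, 0 < m n → 1 < n → 0 < ρ n := fun n h1 h2 => by
    have h3 : 0 < Real.log n := Real.log_pos (by exact_mod_cast h2)
    have h4 : (0 : ℝ) < m n := by exact_mod_cast h1
    have h5 := hA.nonneg n
    positivity
  -- The factor `2` accounts for the two contributions to the error, of the tail of the spectrum and
  -- of the regression algorithm.
  let S : ∀ n, Set (Ω n) := fun n => {ω | DenselyApproximatesLeading P lam psi (2 * ρ n)
    (denoised A tr Ck (sharedData g (u n) (z n) (e n) ω))}
  refine ⟨fun n => {ω | (0 < m n ∧ 1 < n) ∧ ω ∈ S n}, fun n => ?_, ?_, ?_⟩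
  · have h1 : MeasurableSet[dataSigma g (u n) (z n) (e n)] (S n) :=
      ⟨Prod.snd ⁻¹' {D | DenselyApproximatesLeading P lam psi (2 * ρ n) (denoised A tr Ck D)},
        measurable_snd (measurableSet_denselyApproximatesLeading (measurable_denoised hA htr)), rfl⟩
    exact (@MeasurableSet.const _ (dataSigma g (u n) (z n) (e n)) _).inter h1
  · refine tendsto_measure_one_of_compl (tendsto_failure_bound hm) ?_
    have hlog : Tendsto (fun n : ℕ => Real.log n) atTop atTop :=
      Real.tendsto_log_atTop.comp tendsto_natCast_atTop_atTop
    filter_upwards [hm.eventually_gt_atTop 0, eventually_gt_atTop 1,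
      hlog.eventually_ge_atTop (64 * C'), hlog.eventually_ge_atTop (B₀ / Ck)] with n hmn hn hnC hnB
    have hmn0 : (0 : ℝ) < m n := by exact_mod_cast hmn
    have hn0 : 0 < Real.log n := Real.log_pos (by exact_mod_cast hn)
    rw [div_le_iff₀' hCk] at hnB
    set t : ℝ := C' * (m n : ℝ) ^ (-(b + 1)) with ht
    -- the tail contributes at most the rate, since the constant `C'` is dominated by `log n`
    have htail : √(64 * t) ≤ ρ n := by
      rw [hρn, ← Real.sqrt_sq (show 0 ≤ ξ n + (m n : ℝ) ^ (-(b + 1) / 2) by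
        have := hA.nonneg n; positivity), ← Real.sqrt_mul (sq_nonneg _)]
      refine Real.sqrt_le_sqrt ?_
      have h1 : (m n : ℝ) ^ (-(b + 1)) = ((m n : ℝ) ^ (-(b + 1) / 2)) ^ 2 := by
        rw [← Real.rpow_natCast, ← Real.rpow_mul hmn0.le]
        norm_num
      have h2 : ((m n : ℝ) ^ (-(b + 1) / 2)) ^ 2 ≤ (ξ n + (m n : ℝ) ^ (-(b + 1) / 2)) ^ 2 := by
        have := hA.nonneg n
        gcongr
        linarith
      calc 64 * t = (m n : ℝ) ^ (-(b + 1)) * (64 * C') := by rw [ht]; ring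
        _ ≤ (ξ n + (m n : ℝ) ^ (-(b + 1) / 2)) ^ 2 * Real.log n := by
            rw [h1]
            gcongr
    -- by Markov's inequality the total error exceeds `m * ρ n ^ 2` with vanishing probability
    have hrate : ξ n ^ 2 / ρ n ^ 2 ≤ 1 / Real.log n := by
      have h1 : 0 < (m n : ℝ) ^ (-(b + 1) / 2) := by positivity
      have h2 := hA.nonneg n
      rw [hρn, mul_pow, Real.sq_sqrt hn0.le, div_le_div_iff₀ (by positivity) hn0, one_mul]
      gcongr
      linarith
    have hbad := measure_not_approximatesLeading_le hg hkB hM hA htr (h n) (by omega) hmn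
      (hB₀.trans hnB) ((measure_mono (Set.compl_subset_compl.2 (boundedDraws_mono hnB))).trans hνB₀)
      (t := t) (by positivity) (hρ0 n hmn hn) (hC' (m n) hmn).1 (hC' (m n) hmn).2
    refine le_trans (measure_mono ?_)
      (hbad.trans (add_le_add_right (ENNReal.ofReal_le_ofReal hrate) _))
    refine fun ω hω happ => hω ⟨⟨hmn, hn⟩, ?_⟩
    have hpos := hρ0 n hmn hn
    exact (happ.mono (by linarith)).densely hmn (by linarith)
  · rintro n ω ⟨⟨hmn, hn⟩, hω⟩ f
    have hpos := hρ0 n hmn hn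
    obtain ⟨gt, h1, h2, h3⟩ := DenselyApproximatesLeading.exists_approximant hω hmn
      (by linarith) hkH hL.measurable_inducedKernel hkB hL.inducedKernel_symm hM f
    have hR : 0 ≤ rkhsNorm P H (mercerProj lam psi (m n / 2) f) :=
      Real.sInf_nonneg (by rintro _ ⟨f, -, rfl⟩; exact norm_nonneg f)
    refine ⟨gt, h1, h2.trans (by gcongr; norm_num),
      h3.trans (ENNReal.ofReal_le_ofReal (le_of_eq ?_))⟩
    rw [hρn]
    ring
end
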